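/- **Theorem 2 (Covariate shift).** *Setting.* Fix a cluster size $n\ge 2$. A cluster is a pair $(X_i,Y_i)$ with covariates $X_i=(X_{i1},\dots,X_{in})\in[0,1]^n$ and responses $Y_i\in\mathbb R^n$; clusters are i.i.d. with law $P$. For every $I\in\mathbb N$ an individual clustered decision tree is built from $s_I$ splitting clusters and $s_I$ other, independent evaluation clusters. A randomised splitting rule (with auxiliary randomness $\xi$ independent of the data) produces a binary tree with threshold splits of $[0,1]$ and leaves $L_1,\dots,L_M$. Suppose the following. * (Honesty) The splits are a measurable function of the splitting clusters, $\xi$ and the evaluation covariates, and do not depend on the evaluation responses. * (Symmetry) When the covariates of the splitting clusters, and those of the evaluation clusters, are pairwise distinct, the law (under $\xi$) of the partition is unchanged when clusters, or observations within clusters, are reordered. * (Regularity) For some $\alpha\in(0,\tfrac12]$ and all large $I$: when the covariates of the splitting clusters, and those of the evaluation clusters, are pairwise distinct, almost surely each split leaves at least a fraction $\alpha$ of the evaluation observations of the node in each child, and every leaf contains between $k_I$ and $2k_I-1$ evaluation observations. * (Regime) $s_I\to\infty$, $k_I\to\infty$ and $k_I=o\bigl(s_I^{2\phi/(2\phi+1)}\bigr)$,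 where $\phi=(1-\epsilon)\frac{\log((1-\alpha)^{-1})}{\log(\alpha^{-1})}\pi$ with $\epsilon\in(0,1)$, $\pi\in(0,1]$. Let $W(\rho)=\bigl((\mathbf 1_{\{j=l\}}+\rho\mathbf 1_{\{j\ne l\}})_{j,l\in[n]}\bigr)^{-1}$ for $\rho\in[0,1)$, let $(\chi_i)_{jm}=\mathbf 1_{\{X_{ij}\in L_m\}}$, let $J(x)$ be the index of the leaf that contains $x$, and $$T_\rho(x)=e_{J(x)}^\top\Bigl(\sum_{i}\chi_i^\top W(\rho)\chi_i\Bigr)^{-1}\sum_{i}\chi_i^\top W(\rho)Y_i ,\qquad \mathcal V_Q(\rho)=k_I\int \mathrm{Var}_P\bigl(T_\rho(x)\bigr)\,dQ(x),$$ where the sums run over the evaluation clusters and the variance is over the data and $\xi$. Call $P$ *admissible* if: (a) all $X_{ij}$ have the same marginal law $P_X$, with a density on $[0,1]$ that is bounded above and away from $0$, and $X_{i1},\dots,X_{in}$ are either independent, or almost surely all equal with $n\mid k_I$ for all $I$; (b) $\mathbb E_P[Y_{ij}\mid X_i]=\mu(X_{ij})$ and $\mathrm{Cov}_P(Y_{ij},Y_{il}\mid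 X_{ij},X_{il})=v_{jl}(X_{ij},X_{il})$ with square-integrable responses and bounded Lipschitz functions $\mu$, $v_{jl}$; (c) the eigenvalues of $\mathrm{Cov}_P(Y_i\mid X_i)$ lie in $[\lambda^{-1},\lambda]$ almost surely for some $\lambda\ge1$; (d) for some $\delta,\tau>0$, almost surely for all $a\in\mathbb R^n$, $\mathbb E_P[|a^\top(Y_i-\mathbb E_P[Y_i|X_i])|^{2+\delta}\mid X_i]\le\tau\,\mathbb E_P[\{a^\top(Y_i-\mathbb E_P[Y_i|X_i])\}^2\mid X_i]^{1+\delta/2}$. *Claim.* Let $\varrho\in(0,1)$ and $\kappa\ge1$. Then there exist an admissible law $P$ with $\mathrm{Corr}_P(Y_{ij},Y_{il}\mid X_i)=\varrho$ almost surely for all $j\ne l$, and probability distributions $Q_1,Q_2$ on $[0,1]$, such that for all sufficiently large $I$ both $\mathcal V_{Q_1}$ and $\mathcal V_{Q_2}$ attain their minimum over $[0,1)$, and $$\frac{\mathcal V_{Q_1}(\rho_{Q_2\text{-opt}})}{\mathcal V_{Q_1}(\rho_{Q_1\text{-opt}})}\ge\kappa$$ for all minimisers $\rho_{Q_j\text{-opt}}\in\mathrm{argmin}_{\rho\in[0,1)}\mathcal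 V_{Q_j}(\rho)$, $j\in\{1,2\}$. Moreover, $Q_2$ can be required to be the training covariate distribution $P_X$; for every given $x\in(0,1)$, $Q_1$ can be required to be the point mass at $x$; and both can be required at once. -/

import Mathlib

open MeasureTheory ProbabilityTheory Filter Topology Set
open scoped ENNReal NNReal BigOperators

noncomputable section

/-- One cluster of `n` observations: the covariates `X = (X₁, …, Xₙ)` and the responses
`Y = (Y₁, …, Yₙ)`, in this order. -/
abbrev Cluster (n : ℕ) : Type := (Fin n → ℝ) × (Fin n → ℝ)

/-! ### Laws of a cluster -/

/-- Conditional mean `E[Y_j | X = x]`. -/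
def condMean {n : ℕ} (P : Measure (Cluster n)) [IsFiniteMeasure P]
    (x : Fin n → ℝ) (j : Fin n) : ℝ :=
  ∫ y, y j ∂(P.condKernel x)

/-- Conditional covariance matrix `Cov(Y | X = x)`. -/
def condCov {n : ℕ} (P : Measure (Cluster n)) [IsFiniteMeasure P]
    (x : Fin n → ℝ) : Matrix (Fin n) (Fin n) ℝ :=
  Matrix.of fun j l => cov[fun y => y j, fun y => y l; P.condKernel x]

/-- The marginal law of the `j`-th covariate of a cluster. -/
def marginalX {n : ℕ} (P : Measure (Cluster n)) (j : Fin n) : Measure ℝ :=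
  P.map (fun z => z.1 j)

/-- Assumptions on the law `P` of a cluster with scalar covariates in `[0,1]`; the leaf sizes `k`
only enter in the case of covariates that are constant within a cluster. -/
structure DataAssumptions {n : ℕ} (k : ℕ → ℕ) (P : Measure (Cluster n))
    [IsProbabilityMeasure P] : Prop where
  /-- every covariate has the same marginal density on `[0,1]`, bounded above and below -/
  density : ∃ (f : ℝ → ℝ) (b : ℝ), 1 ≤ b ∧ Measurable f ∧
    (∀ x ∈ Icc (0 : ℝ) 1, b⁻¹ ≤ f x ∧ f x ≤ b) ∧
    ∀ j, marginalX P j =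
      (volume.restrict (Icc (0 : ℝ) 1)).withDensity (fun x => ENNReal.ofReal (f x))
  /-- covariates in a cluster are either independent or all equal -/
  dependence : iIndepFun (fun (j : Fin n) (z : Cluster n) => z.1 j) P ∨
    ((∀ᵐ z ∂P, ∀ j l, z.1 j = z.1 l) ∧ ∀ I, n ∣ k I)
  /-- square integrable responses -/
  sq_integrable : ∀ j, MemLp (fun z : Cluster n => z.2 j) 2 P
  /-- `E[Y_j | X] = m(X_j)`, and `Cov(Y_j, Y_l | X_j, X_l) = v_{jl}(X_j, X_l)`, with bounded
  Lipschitz functions `m` and `v_{jl}` -/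
  lipschitz : ∃ (m : ℝ → ℝ) (v : Fin n → Fin n → ℝ × ℝ → ℝ) (B : ℝ) (Lm Lv : ℝ≥0),
    LipschitzOnWith Lm m (Icc 0 1) ∧ (∀ x ∈ Icc (0 : ℝ) 1, |m x| ≤ B) ∧
    (∀ᵐ x ∂P.fst, ∀ j, condMean P x j = m (x j)) ∧
    ∀ j l, LipschitzOnWith Lv (v j l) (Icc 0 1 ×ˢ Icc 0 1) ∧
      (∀ p ∈ Icc (0 : ℝ) 1 ×ˢ Icc (0 : ℝ) 1, |v j l p| ≤ B) ∧
      P[fun z => (z.2 j - m (z.1 j)) * (z.2 l - m (z.1 l)) |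
          MeasurableSpace.comap (fun z : Cluster n => (z.1 j, z.1 l)) inferInstance]
        =ᵐ[P] fun z => v j l (z.1 j, z.1 l)
  /-- the eigenvalues of `Cov(Y | X)` are bounded and bounded away from zero -/
  eigenvalues : ∃ lam : ℝ, 1 ≤ lam ∧ ∀ᵐ x ∂P.fst, ∀ t : ℝ,
    Module.End.HasEigenvalue (Matrix.toLin' (condCov P x)) t → t ∈ Icc lam⁻¹ lam
  /-- conditional moments of order `2 + δ` are controlled by conditional second moments -/
  moments : ∃ δ τ : ℝ, 0 < δ ∧ 0 < τ ∧ ∀ᵐ x ∂P.fst, ∀ a : Fin n → ℝ,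
    ∫⁻ y, ENNReal.ofReal (|∑ j, a j * (y j - condMean P x j)| ^ (2 + δ)) ∂(P.condKernel x) ≤
      ENNReal.ofReal
        (τ * (∫ y, (∑ j, a j * (y j - condMean P x j)) ^ 2 ∂(P.condKernel x)) ^ (1 + δ / 2))

/-- `Corr(Y_j, Y_l | X) = r` almost surely, for all `j ≠ l`. -/
def HasCondCorr {n : ℕ} (P : Measure (Cluster n)) [IsProbabilityMeasure P] (r : ℝ) : Prop :=
  ∀ᵐ x ∂P.fst, ∀ j l, j ≠ l →
    condCov P x j l / (Real.sqrt (condCov P x j j) * Real.sqrt (condCov P x l l)) = r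

/-! ### Decision trees on the real line -/

/-- Binary decision trees on a single feature: a node sends `x` left if `x ≤ t`, right if `t < x`. -/
inductive SplitTree : Type
  | leaf : SplitTree
  | node (t : ℝ) (l r : SplitTree) : SplitTree

/-- The number `M` of leaves. -/
def SplitTree.numLeaves : SplitTree → ℕ
  | .leaf => 1
  | .node _ l r => l.numLeaves + r.numLeaves

/-- The index `J(x)` of the leaf that contains `x`. -/
def SplitTree.leafOf : (T : SplitTree) → ℝ → Fin T.numLeaves
  | .leaf, _ => (0 : Fin 1)
  | .node t l r, x =>
      if x ≤ t then Fin.castAdd r.numLeaves (l.leafOf x)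
      else Fin.natAdd l.numLeaves (r.leafOf x)

/-- Regularity with respect to the observations `obs i`, `i ∈ S`: each split leaves at least a
fraction `α` of the observations of the node in both children, and each leaf contains between
`k` and `2k - 1` observations. -/
def SplitTree.IsRegular {ι : Type*} (α : ℝ) (k : ℕ) (obs : ι → ℝ) :
    SplitTree → Finset ι → Prop
  | .leaf, S => k ≤ S.card ∧ S.card < 2 * k
  | .node t l r, S =>
      α * (S.card : ℝ) ≤ ((S.filter fun i => obs i ≤ t).card : ℝ) ∧
      α * (S.card : ℝ) ≤ ((S.filter fun i => t < obs i).card : ℝ) ∧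
      SplitTree.IsRegular α k obs l (S.filter fun i => obs i ≤ t) ∧
      SplitTree.IsRegular α k obs r (S.filter fun i => t < obs i)

/-- An honest randomised splitting rule for trees that use `s` clusters for splitting and `s` other
clusters for evaluation. The tree is a function of the splitting clusters, of auxiliary randomness
`ξ ∈ Ξ` and of the evaluation covariates, but never of the evaluation responses. -/
structure SplittingRule (n s : ℕ) (Ξ : Type*) [MeasurableSpace Ξ] where
  tree : (Fin s → Cluster n) → (Fin s → Fin n → ℝ) → Ξ → SplitTree
  measurable_numLeaves : Measurable
    (fun p : (Fin s → Cluster n) × (Fin s → Fin n → ℝ) × Ξ =>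
      (tree p.1 p.2.1 p.2.2).numLeaves)
  measurable_leafOf : Measurable
    (fun p : ((Fin s → Cluster n) × (Fin s → Fin n → ℝ) × Ξ) × ℝ =>
      ((tree p.1.1 p.1.2.1 p.1.2.2).leafOf p.2 : ℕ))

/-- `s` clusters of covariates in general position: all observations in `[0,1]` and distinct. -/
def GeneralPosition {n s : ℕ} (x : Fin s → Fin n → ℝ) : Prop :=
  (∀ i j, x i j ∈ Icc (0 : ℝ) 1) ∧ Function.Injective fun p : Fin s × Fin n => x p.1 p.2

/-- Symmetry: for covariates in general position, the law of the random partition does not change when clusters are reordered, or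
when observations are reordered within clusters. -/
def SplittingRule.IsSymmetric {n s : ℕ} {Ξ : Type*} [MeasurableSpace Ξ]
    (R : SplittingRule n s Ξ) (ν : Measure Ξ) : Prop :=
  ∀ (D : Fin s → Cluster n) (x : Fin s → Fin n → ℝ) (σ σ' : Equiv.Perm (Fin s))
    (θ θ' : Fin s → Equiv.Perm (Fin n)),
    GeneralPosition (fun i => (D i).1) → GeneralPosition x →
    ν.map (fun ξ (u : ℝ) =>
        ((R.tree (fun i => ((D (σ i)).1 ∘ θ i, (D (σ i)).2 ∘ θ i))
          (fun i => x (σ' i) ∘ θ' i) ξ).leafOf u : ℕ)) =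
      ν.map (fun ξ (u : ℝ) => ((R.tree D x ξ).leafOf u : ℕ))

/-- Regularity: for covariates in general position, the tree is almost surely regular with respect
to the `s * n` evaluation observations. -/
def SplittingRule.IsRegular {n s : ℕ} {Ξ : Type*} [MeasurableSpace Ξ]
    (R : SplittingRule n s Ξ) (ν : Measure Ξ) (α : ℝ) (k : ℕ) : Prop :=
  ∀ (D : Fin s → Cluster n) (x : Fin s → Fin n → ℝ),
    GeneralPosition (fun i => (D i).1) → GeneralPosition x →
    ∀ᵐ ξ ∂ν, (R.tree D x ξ).IsRegular α k (fun p : Fin s × Fin n => x p.1 p.2) Finset.univ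

/-! ### Clustered decision trees -/

/-- The equicorrelated weight matrix `W(ρ)`: the inverse of the matrix with diagonal entries `1`
and off-diagonal entries `ρ`. -/
def equiWeight (n : ℕ) (ρ : ℝ) : Matrix (Fin n) (Fin n) ℝ :=
  (Matrix.of fun j l : Fin n => if j = l then (1 : ℝ) else ρ)⁻¹

/-- The matrix `χ` of leaf memberships of the observations of one cluster. -/
def leafMatrix {n : ℕ} (T : SplitTree) (x : Fin n → ℝ) : Matrix (Fin n) (Fin T.numLeaves) ℝ :=
  Matrix.of fun j m => if T.leafOf (x j) = m then 1 else 0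

/-- The prediction
`e_{J(x)}ᵀ (∑ᵢ χᵢᵀ W(ρ) χᵢ)⁻¹ (∑ᵢ χᵢᵀ W(ρ) Yᵢ)` of a tree with evaluation clusters `E`. -/
def clusteredTree {n s : ℕ} (ρ : ℝ) (T : SplitTree) (E : Fin s → Cluster n) (x : ℝ) : ℝ :=
  Matrix.mulVec
    (∑ i, (leafMatrix T (E i).1).transpose * equiWeight n ρ * leafMatrix T (E i).1)⁻¹
    (∑ i, Matrix.mulVec ((leafMatrix T (E i).1).transpose * equiWeight n ρ) (E i).2)
    (T.leafOf x)

/-- The sample space of one tree: splitting clusters, evaluation clusters, auxiliary randomness. -/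
abbrev TreeSample (n s : ℕ) (Ξ : Type*) : Type _ :=
  (Fin s → Cluster n) × (Fin s → Cluster n) × Ξ

/-- The law of the sample of one tree: all clusters are independent with law `P`, and independent of
the auxiliary randomness with law `ν`. -/
def treeLaw {n : ℕ} (s : ℕ) {Ξ : Type*} [MeasurableSpace Ξ]
    (P : Measure (Cluster n)) (ν : Measure Ξ) : Measure (TreeSample n s Ξ) :=
  (Measure.pi fun _ : Fin s => P).prod ((Measure.pi fun _ : Fin s => P).prod ν)

/-- The random prediction `T_ρ(x)` of an individual clustered decision tree with fixed `ρ`. -/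
def SplittingRule.prediction {n s : ℕ} {Ξ : Type*} [MeasurableSpace Ξ]
    (R : SplittingRule n s Ξ) (ρ : ℝ) (x : ℝ) (ω : TreeSample n s Ξ) : ℝ :=
  clusteredTree ρ (R.tree ω.1 (fun i => (ω.2.1 i).1) ω.2.2) ω.2.1 x

/-- The `Q`-integrated variance `𝒱_Q(ρ) = k ∫ Var_P(T_ρ(x)) dQ(x)`, with values in `[0,∞]`. -/
def SplittingRule.integratedVariance {n s : ℕ} {Ξ : Type*} [MeasurableSpace Ξ]
    (R : SplittingRule n s Ξ) (ν : Measure Ξ) (k : ℕ) (P : Measure (Cluster n))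
    (Q : Measure ℝ) (ρ : ℝ) : ℝ≥0∞ :=
  (k : ℝ≥0∞) * ∫⁻ x, evariance (R.prediction ρ x) (treeLaw s P ν) ∂Q

/-- `ρ` minimises `g` over the parameter set `[0,1)`. -/
def IsOptimalWeight (g : ℝ → ℝ≥0∞) (ρ : ℝ) : Prop :=
  ρ ∈ Ico (0 : ℝ) 1 ∧ IsMinOn g (Ico 0 1) ρ

/-- Given the forests with rules `R I` and leaf sizes `k I`: the law `P` is admissible with
conditional intra-cluster correlation `r`, `Q₁` and `Q₂` are laws of a covariate in `[0,1]`, and for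
all large `I` optimal weights for `Q₁` and for `Q₂` exist and the `Q₁`-integrated variance of any
`Q₂`-optimal weight is at least `κ` times the one of any `Q₁`-optimal weight. -/
def ShiftGap {n : ℕ} {s : ℕ → ℕ} {Ξ : Type*} [MeasurableSpace Ξ] (ν : Measure Ξ)
    (k : ℕ → ℕ) (R : ∀ I, SplittingRule n (s I) Ξ) (r κ : ℝ)
    (P : Measure (Cluster n)) (Q₁ Q₂ : Measure ℝ) : Prop :=
  ∃ _ : IsProbabilityMeasure P, DataAssumptions k P ∧ HasCondCorr P r ∧
    IsProbabilityMeasure Q₁ ∧ Q₁ (Icc 0 1) = 1 ∧ IsProbabilityMeasure Q₂ ∧ Q₂ (Icc 0 1) = 1 ∧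
    ∀ᶠ I in atTop,
      (∃ ρ₁, IsOptimalWeight ((R I).integratedVariance ν (k I) P Q₁) ρ₁) ∧
      (∃ ρ₂, IsOptimalWeight ((R I).integratedVariance ν (k I) P Q₂) ρ₂) ∧
      ∀ ρ₁ ρ₂, IsOptimalWeight ((R I).integratedVariance ν (k I) P Q₁) ρ₁ →
        IsOptimalWeight ((R I).integratedVariance ν (k I) P Q₂) ρ₂ →
        κ ≤ ((R I).integratedVariance ν (k I) P Q₁ ρ₂).toReal /
            ((R I).integratedVariance ν (k I) P Q₁ ρ₁).toReal

/-- The exponent `φ = (1 - ε) π log((1-α)⁻¹) / log(α⁻¹)`. -/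
def leafExponent (α π ε : ℝ) : ℝ :=
  (1 - ε) * (Real.log (1 - α)⁻¹ / Real.log α⁻¹) * π

end

/-! The gap comes from heteroscedastic noise. Put θ = ρ/(1+(n-1)ρ), which runs through [0, 1/n).
Then W(ρ) is a multiple of I - θJ, with J the all-ones matrix, so a prediction combines the
responses in the leaf with a negative multiple of the responses of their siblings. If the covariates
within a cluster are independent, most siblings lie in other leaves. Take uniform independent
covariates, mean zero, and noise with correlation ϱ whose scale is a small η close to x₀ and 1 at
distance at least d from x₀.

At x₀ the choice ρ = 0 averages the quiet responses of the leaf and has normalised variance about η²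
or less. If θ is bounded below, siblings with scale 1 enter, and the variance is at least of order
θ². For the uniform test distribution only a proportion O(d) of test points and siblings feels the
quiet region, so the variance is almost the homoscedastic one. Normalised by the leaf size, the
latter is close to G = (1-ϱ)/(1-θ_ϱ) at ρ = ϱ, where θ_ϱ is the value of θ at ρ = ϱ. It tends to 1
as ρ → 0 and to (1-ϱ)n/(n-1) as ρ → 1, and both exceed G strictly. Hence weights optimal for the
uniform law keep away from 0 by a margin that depends only on n and ϱ. Choosing first η, then d,
then I makes the ratio at x₀ as large as desired.

The rigorous version has three layers. Given trees and covariates, honesty makes the prediction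
linear in the noise with fixed weights, so its conditional variance is a quadratic form
(`evariance_prediction`). The weights solve normal equations, which differ from an idealised form
only through siblings that share leaves; Cauchy-Schwarz controls this by `siblingDefect`
(`IsLeafWeight.exists_beta`). This gives bounds of the form for each sample:
`equiForm_ge_of_near_zero`, `equiForm_ge_of_near_one`, `equiForm_mul_le`, `equiForm_ge_of_le`,
`equiForm_le_of_zero`.

The tree may depend on the evaluation covariates, so the error terms are next replaced by tree-free
ones: a leaf is an interval with fewer than 2k observations, hence lies in a rank window around the
test point (`LabelRegular.isNear`). Exchangeability of the covariates
(`card_embedding_mul_lintegral_le`) bounds the expected defect by O(1/k + k/s) and the expected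
influence of the quiet region by O(d) plus a term that vanishes as s → ∞. Finally, continuity in ρ
and the exclusion of weights near 1 give minimisers, and `exists_optimal_and_ratio_ge` compares
them. -/

noncomputable section

/-! ### Leaf counts, sibling counts and least squares weights -/

section Weights

variable {s n : ℕ}

/-- Indicator that observation `(i, j)` has label `m`. -/
def leafInd (L : Fin s → Fin n → ℕ) (m : ℕ) (i : Fin s) (j : Fin n) : ℝ :=
  if L i j = m then 1 else 0

/-- The number of observations of cluster `i` with label `m`. -/
def clusterCount (L : Fin s → Fin n → ℕ) (m : ℕ) (i : Fin s) : ℝ :=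
  ∑ j, leafInd L m i j

/-- The number of observations with label `m`. -/
def leafSize (L : Fin s → Fin n → ℕ) (m : ℕ) : ℝ :=
  ∑ i, ∑ j, leafInd L m i j

/-- The number of pairs of distinct observations of one cluster, the first with label `l` and the
second with label `m`. -/
def siblingCount (L : Fin s → Fin n → ℕ) (l m : ℕ) : ℝ :=
  ∑ i, ∑ j, ∑ j', if j' ≠ j then leafInd L l i j * leafInd L m i j' else 0

/-- The normalised sum of squares of the sibling counts of the leaf `l`. -/
def siblingDefect (k M : ℕ) (L : Fin s → Fin n → ℕ) (l : ℕ) : ℝ :=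
  (∑ m ∈ Finset.range M, siblingCount L l m ^ 2) / (k : ℝ) ^ 2

/-- The labels lie below `M`, and each label below `M` is taken between `k` and `2k - 1` times. -/
structure LabelRegular (k M : ℕ) (L : Fin s → Fin n → ℕ) : Prop where
  lt : ∀ i j, L i j < M
  le_size : ∀ m < M, (k : ℝ) ≤ leafSize L m
  size_lt : ∀ m < M, leafSize L m < 2 * k

/-- The weights of the generalised least squares estimator at leaf `l`, characterised by the normal
equations. -/
def IsLeafWeight (θ : ℝ) (L : Fin s → Fin n → ℕ) (l : ℕ) (w : Fin s → Fin n → ℝ) : Prop :=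
  ∃ a : ℕ → ℝ, (∀ i j, w i j = a (L i j) - θ * ∑ j', a (L i j')) ∧
    ∀ b : ℕ → ℝ, ∑ i, ∑ j, w i j * b (L i j) = b l

lemma leafInd_nonneg (L : Fin s → Fin n → ℕ) (m : ℕ) (i : Fin s) (j : Fin n) :
    0 ≤ leafInd L m i j := by unfold leafInd; split_ifs <;> norm_num

lemma leafInd_le_one (L : Fin s → Fin n → ℕ) (m : ℕ) (i : Fin s) (j : Fin n) :
    leafInd L m i j ≤ 1 := by unfold leafInd; split_ifs <;> norm_num

lemma leafInd_mul_self (L : Fin s → Fin n → ℕ) (m : ℕ) (i : Fin s) (j : Fin n) :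
    leafInd L m i j * leafInd L m i j = leafInd L m i j := by
  unfold leafInd; split_ifs <;> norm_num

lemma leafInd_mul_apply (L : Fin s → Fin n → ℕ) (m : ℕ) (i : Fin s) (j : Fin n) (b : ℕ → ℝ) :
    leafInd L m i j * b (L i j) = leafInd L m i j * b m := by
  unfold leafInd; split_ifs with h <;> simp [h]

lemma clusterCount_nonneg (L : Fin s → Fin n → ℕ) (m : ℕ) (i : Fin s) :
    0 ≤ clusterCount L m i := Finset.sum_nonneg fun _ _ => leafInd_nonneg _ _ _ _

lemma clusterCount_le (L : Fin s → Fin n → ℕ) (m : ℕ) (i : Fin s) :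
    clusterCount L m i ≤ n := by
  refine (Finset.sum_le_sum fun j _ => leafInd_le_one L m i j).trans ?_
  simp

lemma leafInd_le_clusterCount (L : Fin s → Fin n → ℕ) (m : ℕ) (i : Fin s) (j : Fin n) :
    leafInd L m i j ≤ clusterCount L m i :=
  Finset.single_le_sum (f := fun j => leafInd L m i j) (fun j _ => leafInd_nonneg L m i j)
    (Finset.mem_univ j)

lemma leafSize_eq (L : Fin s → Fin n → ℕ) (m : ℕ) :
    leafSize L m = ∑ i, clusterCount L m i := rfl

lemma clusterCount_le_sq (L : Fin s → Fin n → ℕ) (m : ℕ) (i : Fin s) :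
    clusterCount L m i ≤ clusterCount L m i ^ 2 := by
  have : clusterCount L m i = ((Finset.univ.filter fun j => L i j = m).card : ℝ) := by
    simp [clusterCount, leafInd, Finset.sum_boole]
  rw [this]
  exact_mod_cast Nat.le_self_pow (by norm_num) _

lemma LabelRegular.sum_mul_leafInd {k M : ℕ} {L : Fin s → Fin n → ℕ} (hL : LabelRegular k M L)
    (b : ℕ → ℝ) (i : Fin s) (j : Fin n) :
    ∑ m ∈ Finset.range M, b m * leafInd L m i j = b (L i j) := by
  simp [leafInd, hL.lt i j]

/-- Completing the sum over j' ≠ j to all j' produces cluster sums; the added diagonal, on which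
both labels agree, is the subtracted term. -/
lemma LabelRegular.sum_siblingCount {k M : ℕ} {L : Fin s → Fin n → ℕ} (hL : LabelRegular k M L)
    (l : ℕ) (b : ℕ → ℝ) :
    ∑ m ∈ Finset.range M, b m * siblingCount L l m =
      ∑ i, clusterCount L l i * ∑ j, b (L i j) - leafSize L l * b l := by
  have h1 : ∀ m, b m * siblingCount L l m =
      ∑ i, ∑ j, ∑ j', if j' ≠ j then leafInd L l i j * (b m * leafInd L m i j') else 0 := by
    intro m
    simp only [siblingCount, Finset.mul_sum]
    refine Finset.sum_congr rfl fun i _ => Finset.sum_congr rfl fun j _ =>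
      Finset.sum_congr rfl fun j' _ => ?_
    split_ifs <;> ring
  simp_rw [h1]
  rw [Finset.sum_comm, leafSize, Finset.sum_mul, ← Finset.sum_sub_distrib]
  refine Finset.sum_congr rfl fun i _ => ?_
  rw [Finset.sum_comm, clusterCount, Finset.sum_mul, Finset.sum_mul, ← Finset.sum_sub_distrib]
  refine Finset.sum_congr rfl fun j _ => ?_
  rw [Finset.sum_comm, ← leafInd_mul_apply, ← mul_sub]
  have h2 : ∀ j' : Fin n, (∑ m ∈ Finset.range M,
      if j' ≠ j then leafInd L l i j * (b m * leafInd L m i j') else 0) =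
      leafInd L l i j * (b (L i j') - if j' = j then b (L i j') else 0) := by
    intro j'
    by_cases h : j' = j
    · simp [h]
    · simp [h, ← Finset.mul_sum, hL.sum_mul_leafInd]
  simp_rw [h2, ← Finset.mul_sum, Finset.sum_sub_distrib]
  simp

lemma LabelRegular.mul_sum_sq_le {k M : ℕ} {L : Fin s → Fin n → ℕ} (hL : LabelRegular k M L)
    (b : ℕ → ℝ) :
    (k : ℝ) * ∑ m ∈ Finset.range M, b m ^ 2 ≤ ∑ i, ∑ j, b (L i j) ^ 2 := by
  have : ∑ m ∈ Finset.range M, b m ^ 2 * leafSize L m = ∑ i, ∑ j, b (L i j) ^ 2 := by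
    simp_rw [leafSize, Finset.mul_sum]
    rw [Finset.sum_comm]
    refine Finset.sum_congr rfl fun i _ => ?_
    rw [Finset.sum_comm]
    simp_rw [hL.sum_mul_leafInd (fun m => b m ^ 2) i]
  rw [← this, Finset.mul_sum]
  refine Finset.sum_le_sum fun m hm => ?_
  rw [mul_comm]
  exact mul_le_mul_of_nonneg_left (hL.le_size m (Finset.mem_range.1 hm)) (sq_nonneg _)

lemma siblingDefect_nonneg (k M : ℕ) (L : Fin s → Fin n → ℕ) (l : ℕ) :
    0 ≤ siblingDefect k M L l :=
  div_nonneg (Finset.sum_nonneg fun _ _ => sq_nonneg _) (sq_nonneg _)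

/-- Cauchy-Schwarz for the sibling counts. -/
lemma LabelRegular.sq_sum_siblingCount_le {k M : ℕ} {L : Fin s → Fin n → ℕ}
    (hL : LabelRegular k M L) (hk : 0 < k) (l : ℕ) (b : ℕ → ℝ) :
    (∑ m ∈ Finset.range M, b m * siblingCount L l m) ^ 2 ≤
      (∑ i, ∑ j, b (L i j) ^ 2) * (k * siblingDefect k M L l) := by
  have hk' : (0 : ℝ) < k := by exact_mod_cast hk
  calc _ ≤ (∑ m ∈ Finset.range M, b m ^ 2) * ∑ m ∈ Finset.range M, siblingCount L l m ^ 2 :=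
        Finset.sum_mul_sq_le_sq_mul_sq _ _ _
    _ = ((k : ℝ) * ∑ m ∈ Finset.range M, b m ^ 2) * (k * siblingDefect k M L l) := by
        unfold siblingDefect; field_simp
    _ ≤ _ := mul_le_mul_of_nonneg_right (hL.mul_sum_sq_le b)
        (mul_nonneg hk'.le (siblingDefect_nonneg _ _ _ _))

lemma LabelRegular.siblingCount_self {k M : ℕ} {L : Fin s → Fin n → ℕ} (hL : LabelRegular k M L)
    {l : ℕ} (hl : l < M) :
    siblingCount L l l = ∑ i, clusterCount L l i ^ 2 - leafSize L l := by
  have h := hL.sum_siblingCount l (fun m => if m = l then 1 else 0)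
  have h2 : ∀ i j, (if L i j = l then (1:ℝ) else 0) = leafInd L l i j := fun _ _ => rfl
  simp only [ite_mul, one_mul, zero_mul, Finset.sum_ite_eq', Finset.mem_range, hl, if_true,
    h2, mul_one] at h
  rw [h]
  congr 1
  refine Finset.sum_congr rfl fun i _ => ?_
  rw [sq]; rfl

/-- The excess of the left side over the leaf size is the diagonal sibling count. Its square is one
summand of the defect, and `k` is at most the leaf size. -/
lemma LabelRegular.sum_clusterCount_sq_le {k M : ℕ} {L : Fin s → Fin n → ℕ}
    (hL : LabelRegular k M L) (hk : 0 < k) {l : ℕ} (hl : l < M) :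
    ∑ i, clusterCount L l i ^ 2 ≤
      leafSize L l * (1 + Real.sqrt (siblingDefect k M L l)) := by
  have hk' : (0 : ℝ) < k := by exact_mod_cast hk
  have h1 : siblingCount L l l ^ 2 ≤ (k * Real.sqrt (siblingDefect k M L l)) ^ 2 := by
    rw [mul_pow, Real.sq_sqrt (siblingDefect_nonneg _ _ _ _), siblingDefect, mul_div_cancel₀ _ (by positivity)]
    exact Finset.single_le_sum (f := fun m => siblingCount L l m ^ 2) (fun _ _ => sq_nonneg _)
      (Finset.mem_range.2 hl)
  have h2 := abs_le_of_sq_le_sq' h1 (by positivity)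
  have h3 := mul_le_mul_of_nonneg_right (hL.le_size l hl) (Real.sqrt_nonneg (siblingDefect k M L l))
  rw [hL.siblingCount_self hl] at h2
  linarith [h2.2]

lemma leafSize_le_sum_clusterCount_sq (L : Fin s → Fin n → ℕ) (l : ℕ) :
    leafSize L l ≤ ∑ i, clusterCount L l i ^ 2 :=
  Finset.sum_le_sum fun i _ => clusterCount_le_sq L l i

lemma sum_clusterCount_sq_le_mul (L : Fin s → Fin n → ℕ) (l : ℕ) :
    ∑ i, clusterCount L l i ^ 2 ≤ n * leafSize L l := by
  rw [leafSize_eq, Finset.mul_sum]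
  refine Finset.sum_le_sum fun i _ => ?_
  rw [sq]
  exact mul_le_mul_of_nonneg_right (clusterCount_le L l i) (clusterCount_nonneg L l i)

/-- `‖f - θ (∑ f) 1‖² ≤ ‖f‖² - θ (∑ f)²` for `n θ ≤ 1`. -/
lemma sum_sub_sq_le {θ : ℝ} (h0 : 0 ≤ θ) (h1 : n * θ ≤ 1) (f : Fin n → ℝ) :
    ∑ j, (f j - θ * ∑ j', f j') ^ 2 ≤ ∑ j, f j ^ 2 - θ * (∑ j, f j) ^ 2 := by
  set F := ∑ j, f j with hF
  have : ∑ j, (f j - θ * F) ^ 2 = ∑ j, f j ^ 2 - 2 * θ * F ^ 2 + n * θ ^ 2 * F ^ 2 := by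
    have : ∀ j, (f j - θ * F) ^ 2 = f j ^ 2 - 2 * θ * F * f j + θ ^ 2 * F ^ 2 := fun j => by ring
    simp_rw [this, Finset.sum_add_distrib, Finset.sum_sub_distrib, ← Finset.mul_sum, ← hF]
    simp; ring
  rw [this]
  nlinarith [mul_nonneg h0 (sq_nonneg F), mul_nonneg (mul_nonneg h0 (sq_nonneg F)) (sub_nonneg.2 h1)]

lemma one_sub_mul_sum_sq_le {θ : ℝ} (h0 : 0 ≤ θ) (f : Fin n → ℝ) :
    (1 - n * θ) * ∑ j, f j ^ 2 ≤ ∑ j, f j ^ 2 - θ * (∑ j, f j) ^ 2 := by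
  have : (∑ j, f j) ^ 2 ≤ n * ∑ j, f j ^ 2 := by
    simpa using sq_sum_le_card_mul_sum_sq (s := (Finset.univ : Finset (Fin n))) (f := f)
  nlinarith

/-- The quadratic form of the equicorrelation matrix with correlation `r`, applied clusterwise. -/
def equiForm (r : ℝ) (f : Fin s → Fin n → ℝ) : ℝ :=
  (1 - r) * ∑ i, ∑ j, f i j ^ 2 + r * ∑ i, (∑ j, f i j) ^ 2

/-! ### Consequences of the normal equations -/

section Fit

variable {k M : ℕ} {L : Fin s → Fin n → ℕ} {l : ℕ} {θ : ℝ} {w : Fin s → Fin n → ℝ}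

lemma IsLeafWeight.sum_mul_leafInd (hw : IsLeafWeight θ L l w) :
    ∑ i, ∑ j, w i j * leafInd L l i j = 1 := by
  obtain ⟨a, -, hb⟩ := hw
  simpa [leafInd] using hb (fun m => if m = l then 1 else 0)

/-- The residual form `‖g‖² - θ ∑ᵢ (∑ⱼ gᵢⱼ)²` as an inner product. -/
lemma sum_residual_mul (f g : Fin s → Fin n → ℝ) :
    ∑ i, ∑ j, (f i j - θ * ∑ j', f i j') * g i j =
      ∑ i, ∑ j, f i j * g i j - θ * ∑ i, (∑ j, f i j) * ∑ j, g i j := by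
  rw [Finset.mul_sum, ← Finset.sum_sub_distrib]
  refine Finset.sum_congr rfl fun i _ => ?_
  simp_rw [sub_mul, Finset.sum_sub_distrib, ← Finset.mul_sum, mul_assoc]

/-- The matrix I - θJ has eigenvalues 1 and 1 - nθ, both in [0,1], so its square is dominated by
itself. -/
lemma sum_residual_sq_le (h0 : 0 ≤ θ) (h1 : n * θ ≤ 1) (f : Fin s → Fin n → ℝ) :
    ∑ i, ∑ j, (f i j - θ * ∑ j', f i j') ^ 2 ≤
      ∑ i, ∑ j, (f i j - θ * ∑ j', f i j') * f i j := by
  rw [sum_residual_mul, Finset.mul_sum, ← Finset.sum_sub_distrib]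
  refine Finset.sum_le_sum fun i _ => ?_
  have := sum_sub_sq_le h0 h1 (f i)
  simpa only [sq] using this

/-- The smallest eigenvalue of I - θJ is 1 - nθ. -/
lemma mul_sum_sq_le_residual (h0 : 0 ≤ θ) (f : Fin s → Fin n → ℝ) :
    (1 - n * θ) * ∑ i, ∑ j, f i j ^ 2 ≤
      ∑ i, ∑ j, (f i j - θ * ∑ j', f i j') * f i j := by
  rw [sum_residual_mul, Finset.mul_sum, Finset.mul_sum, ← Finset.sum_sub_distrib]
  refine Finset.sum_le_sum fun i _ => ?_
  have := one_sub_mul_sum_sq_le h0 (f i)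
  simpa only [sq] using this

lemma leafSize_mul_sq_le (L : Fin s → Fin n → ℕ) (l : ℕ) (a : ℕ → ℝ) :
    leafSize L l * a l ^ 2 ≤ ∑ i, ∑ j, a (L i j) ^ 2 := by
  rw [leafSize, Finset.sum_mul]
  refine Finset.sum_le_sum fun i _ => ?_
  rw [Finset.sum_mul]
  refine Finset.sum_le_sum fun j _ => ?_
  unfold leafInd
  split_ifs with h
  · simp [h]
  · simpa using sq_nonneg (a (L i j))

/-- With w = (I - θJ)a, the normal equations tested with `a` itself give ‖w‖² ≤ ⟨w, a⟩ = a(l). The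
smallest eigenvalue gives (1 - nθ) N a(l)² ≤ a(l), where N is the leaf size, and the two combine. -/
lemma IsLeafWeight.mul_leafSize_mul_sum_sq_le (hw : IsLeafWeight θ L l w)
    (hN : 0 < leafSize L l) (h0 : 0 ≤ θ) (h1 : n * θ < 1) :
    (1 - n * θ) * (leafSize L l * ∑ i, ∑ j, w i j ^ 2) ≤ 1 := by
  obtain ⟨a, ha, hb⟩ := hw
  have e1 := sum_residual_sq_le h0 h1.le (fun i j => a (L i j))
  have e2 := mul_sum_sq_le_residual h0 (fun i j => a (L i j))
  simp_rw [← ha] at e1 e2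
  rw [hb] at e1 e2
  have e3 := leafSize_mul_sq_le L l a
  have hθ : 0 < 1 - n * θ := by linarith
  have hal : 0 ≤ a l := le_trans (Finset.sum_nonneg fun i _ => Finset.sum_nonneg fun j _ =>
    sq_nonneg _) e1
  have e4 : (1 - n * θ) * (leafSize L l * a l) ≤ 1 := by
    rcases hal.eq_or_lt with h | h
    · rw [← h]; simp
    · have : (1 - n * θ) * (leafSize L l * a l) * a l ≤ 1 * a l := by nlinarith
      exact le_of_mul_le_mul_right this h
  refine le_trans ?_ e4
  gcongr

/-- The deviation of the normal equations from their idealised form. -/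
lemma IsLeafWeight.exists_beta (hw : IsLeafWeight θ L l w) (hL : LabelRegular k M L) (hk : 0 < k)
    (hl : l < M) (h0 : 0 ≤ θ) (h1 : n * θ < 1) :
    ∃ a : ℕ → ℝ, ∃ β : ℝ, (∀ i j, w i j = a (L i j) - θ * ∑ j', a (L i j')) ∧
      (∀ b : ℕ → ℝ, ∑ i, ∑ j, w i j * b (L i j) = b l) ∧
      (1 - θ) * (leafSize L l * a l) = 1 + θ * β ∧
      ∑ i, clusterCount L l i * ∑ j, a (L i j) = leafSize L l * a l + β ∧
      (1 - n * θ) * |β| ≤ Real.sqrt (siblingDefect k M L l) := by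
  have hkN := hL.le_size l hl
  have hk' : (0 : ℝ) < k := by exact_mod_cast hk
  have hw' := hw
  obtain ⟨a, ha, hb⟩ := hw
  have hθ : 0 < 1 - n * θ := by linarith
  have e2 := mul_sum_sq_le_residual h0 (fun i j => a (L i j))
  simp_rw [← ha] at e2
  rw [hb] at e2
  have e3 := leafSize_mul_sq_le L l a
  have hD := siblingDefect_nonneg k M L l
  have hc := hL.sum_siblingCount l a
  have hcs := hL.sq_sum_siblingCount_le hk l a
  -- The normal equations tested with the indicator of the leaf `l`.
  have hind : leafSize L l * a l - θ * ∑ i, clusterCount L l i * ∑ j, a (L i j) = 1 := by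
    have := hw'.sum_mul_leafInd
    simp_rw [ha] at this
    rw [sum_residual_mul (fun i j => a (L i j))] at this
    rw [← this]
    congr 1
    · simp_rw [leafSize, Finset.sum_mul, ← leafInd_mul_apply, mul_comm]
    · simp_rw [clusterCount, mul_comm]
  set Q := ∑ i, ∑ j, a (L i j) ^ 2
  set β := ∑ m ∈ Finset.range M, a m * siblingCount L l m with hβ
  refine ⟨a, β, ha, hb, by rw [hc]; linarith, by rw [hc]; ring, ?_⟩
  have hal : 0 ≤ a l := le_trans (mul_nonneg hθ.le (Finset.sum_nonneg fun i _ =>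
    Finset.sum_nonneg fun j _ => sq_nonneg _)) e2
  have e4 : (1 - n * θ) * (leafSize L l * a l) ≤ 1 := by
    rcases hal.eq_or_lt with h | h
    · rw [← h]; simp
    · have : (1 - n * θ) * (leafSize L l * a l) * a l ≤ 1 * a l := by nlinarith
      exact le_of_mul_le_mul_right this h
  apply Real.le_sqrt_of_sq_le
  rw [mul_pow, sq_abs]
  -- Cauchy-Schwarz for β, then in turn (1 - nθ)‖a‖² ≤ a(l), k ≤ N and (1 - nθ) N a(l) ≤ 1.
  calc (1 - n * θ) ^ 2 * β ^ 2 ≤ (1 - n * θ) ^ 2 * (Q * (k * siblingDefect k M L l)) := by gcongr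
    _ = ((1 - n * θ) * Q) * ((1 - n * θ) * k * siblingDefect k M L l) := by ring
    _ ≤ a l * ((1 - n * θ) * leafSize L l * siblingDefect k M L l) := by gcongr
    _ = ((1 - n * θ) * (leafSize L l * a l)) * siblingDefect k M L l := by ring
    _ ≤ 1 * siblingDefect k M L l := by gcongr
    _ = _ := one_mul _

lemma theta_le_half (hn : 2 ≤ n) (h1 : n * θ < 1) : θ ≤ 1 / 2 := by
  have : (2 : ℝ) ≤ n := by exact_mod_cast hn
  nlinarith

/-- I - θJ multiplies cluster sums by 1 - nθ, so the double sum equals (1 - nθ)(N a(l) + β) = (1 -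
nθ)(1 + β)/(1 - θ). The factor 2 bounds 1/(1 - θ), since θ ≤ 1/2. -/
lemma IsLeafWeight.abs_sum_clusterCount_sub_le (hw : IsLeafWeight θ L l w)
    (hL : LabelRegular k M L) (hk : 0 < k) (hl : l < M) (hn : 2 ≤ n) (h0 : 0 ≤ θ)
    (h1 : n * θ < 1) :
    |∑ i, ∑ j, w i j * clusterCount L l i - (1 - n * θ) / (1 - θ)| ≤
      2 * Real.sqrt (siblingDefect k M L l) := by
  obtain ⟨a, β, ha, hb, e1, e2, e3⟩ := hw.exists_beta hL hk hl h0 h1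
  have hθ := theta_le_half hn h1
  have hθ' : (0 : ℝ) < 1 - θ := by linarith
  have e4 : ∑ i, ∑ j, w i j * clusterCount L l i = (1 - n * θ) * (leafSize L l * a l + β) := by
    rw [← e2, Finset.mul_sum]
    refine Finset.sum_congr rfl fun i _ => ?_
    rw [← Finset.sum_mul]
    simp_rw [ha, Finset.sum_sub_distrib]
    simp; ring
  have e5 : leafSize L l * a l = (1 + θ * β) / (1 - θ) := by
    rw [eq_div_iff hθ'.ne', ← e1]; ring
  have e6 : ∑ i, ∑ j, w i j * clusterCount L l i - (1 - n * θ) / (1 - θ) =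
      (1 / (1 - θ)) * ((1 - n * θ) * β) := by
    rw [e4, e5]; field_simp; ring
  rw [e6, abs_mul, abs_mul, abs_of_pos (by linarith : 0 < 1 - n * θ)]
  gcongr
  rw [abs_of_pos (by positivity), div_le_iff₀ hθ']
  linarith

/-- For the matching θ, the matrices (1-r)I + rJ and I - θJ are inverse to each other up to the
factor 1 - r. The form therefore collapses to (1 - r) a(l), and `exists_beta` evaluates a(l). -/
lemma IsLeafWeight.equiForm_le {r : ℝ} (hr0 : 0 < r) (hr1 : r < 1)
    (hw : IsLeafWeight (r / (1 + (n - 1) * r)) L l w)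
    (hL : LabelRegular k M L) (hk : 0 < k) (hl : l < M) (hn : 2 ≤ n) :
    leafSize L l * equiForm r w ≤ (1 - r) / (1 - r / (1 + (n - 1) * r)) +
      (1 + (n - 1) * r) * Real.sqrt (siblingDefect k M L l) := by
  have hn' : (2 : ℝ) ≤ n := by exact_mod_cast hn
  have hR : 0 < 1 + (n - 1) * r := by nlinarith
  set R := 1 + (n - 1) * r with hRdef
  set θ := r / R with hθdef
  have h0 : 0 ≤ θ := by positivity
  have hnθ : 1 - n * θ = (1 - r) / R := by rw [hθdef]; field_simp; rw [hRdef]; ring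
  have h1 : n * θ < 1 := by
    have : 0 < (1 - r) / R := div_pos (by linarith) hR
    linarith
  obtain ⟨a, β, ha, hb, e1, e2, e3⟩ := hw.exists_beta hL hk hl h0 h1
  have hθ := theta_le_half hn h1
  have hθ' : (0 : ℝ) < 1 - θ := by linarith
  have key : equiForm r w = (1 - r) * a l := by
    have hal := hb a
    have s1 : ∀ i, ∑ j, w i j ^ 2 = ∑ j, w i j * a (L i j) - θ * (∑ j, w i j) * ∑ j, a (L i j) := by
      intro i
      rw [mul_assoc, Finset.sum_mul, Finset.mul_sum, ← Finset.sum_sub_distrib]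
      refine Finset.sum_congr rfl fun j _ => ?_
      rw [sq]; nth_rewrite 2 [ha]; ring
    have s2 : ∀ i, ∑ j, w i j = (1 - n * θ) * ∑ j, a (L i j) := by
      intro i
      simp_rw [ha, Finset.sum_sub_distrib]
      simp; ring
    have s3 : ∀ i, (∑ j, w i j) ^ 2 = (1 - n * θ) * ((∑ j, w i j) * ∑ j, a (L i j)) := by
      intro i
      rw [sq]; nth_rewrite 2 [s2]; ring
    rw [equiForm, ← hal]
    simp_rw [s1, s3, Finset.sum_sub_distrib, mul_assoc, ← Finset.mul_sum, hnθ, hθdef]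
    field_simp
    ring
  have e5 : leafSize L l * a l = (1 + θ * β) / (1 - θ) := by
    rw [eq_div_iff hθ'.ne', ← e1]; ring
  rw [key]
  have : leafSize L l * ((1 - r) * a l) = (1 - r) / (1 - θ) + (1 - r) * (θ / (1 - θ)) * β := by
    rw [mul_left_comm, e5]; field_simp
  rw [this]
  have h5 : (1 - r) * |β| ≤ R * Real.sqrt (siblingDefect k M L l) := by
    rw [hnθ, div_mul_eq_mul_div, div_le_iff₀ hR] at e3
    linarith
  have h6 : θ / (1 - θ) ≤ 1 := by rw [div_le_one hθ']; linarith
  have h7 : (1 - r) * (θ / (1 - θ)) * β ≤ (1 - r) * 1 * |β| := by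
    have := le_abs_self β
    have h8 : 0 ≤ θ / (1 - θ) := by positivity
    calc (1 - r) * (θ / (1 - θ)) * β ≤ (1 - r) * (θ / (1 - θ)) * |β| := by
          apply mul_le_mul_of_nonneg_left this (mul_nonneg (by linarith) h8)
      _ ≤ _ := by
          apply mul_le_mul_of_nonneg_right _ (abs_nonneg _)
          apply mul_le_mul_of_nonneg_left h6 (by linarith)
  linarith

/-- The ideal weights arise from a multiple of the indicator of `l`, so the difference is (I - θJ)b
for an explicit `b`. By the normal equations its energy is linear in the sibling sum of `b`, which
Cauchy-Schwarz bounds by the square root of that energy. -/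
lemma IsLeafWeight.sum_sub_ideal_sq_le (hw : IsLeafWeight θ L l w)
    (hL : LabelRegular k M L) (hk : 0 < k) (hl : l < M) (hn : 2 ≤ n) (h0 : 0 ≤ θ)
    (h1 : n * θ < 1) :
    (1 - n * θ) * (leafSize L l * ∑ i, ∑ j, (w i j -
      (leafInd L l i j - θ * clusterCount L l i) / ((1 - θ) * leafSize L l)) ^ 2) ≤
      siblingDefect k M L l := by
  have hkN := hL.le_size l hl
  have hk' : (0 : ℝ) < k := by exact_mod_cast hk
  set N := leafSize L l
  have hN : 0 < N := by linarith
  have hθ := theta_le_half hn h1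
  have hθ' : (0 : ℝ) < 1 - θ := by linarith
  have hD := siblingDefect_nonneg k M L l
  obtain ⟨a, ha, hb⟩ := hw
  set t := ((1 - θ) * N)⁻¹ with ht
  have htN : t * ((1 - θ) * N) = 1 := inv_mul_cancel₀ (by positivity)
  set b : ℕ → ℝ := fun m => a m - t * (if m = l then 1 else 0) with hbdef
  have hind : ∀ i j, (if L i j = l then (1 : ℝ) else 0) = leafInd L l i j := fun _ _ => rfl
  have hsum : ∀ i, ∑ j, b (L i j) = ∑ j, a (L i j) - t * clusterCount L l i := by
    intro i
    simp only [hbdef, Finset.sum_sub_distrib, ← Finset.mul_sum]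
    rfl
  have hres : ∀ i j, w i j - (leafInd L l i j - θ * clusterCount L l i) / ((1 - θ) * N) =
      b (L i j) - θ * ∑ j', b (L i j') := by
    intro i j
    rw [hsum, ha]
    simp only [hbdef, hind, div_eq_mul_inv, ← ht]
    ring
  simp_rw [hres]
  have e1 := sum_residual_sq_le h0 h1.le (fun i j => b (L i j))
  have e2 := mul_sum_sq_le_residual h0 (fun i j => b (L i j))
  have hc := hL.sum_siblingCount l b
  have hcs := hL.sq_sum_siblingCount_le hk l b
  set β := ∑ m ∈ Finset.range M, b m * siblingCount L l m
  -- The value of `t` makes all terms with `b l` cancel; only the sibling sum survives.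
  have e3 : ∑ i, ∑ j, (b (L i j) - θ * ∑ j', b (L i j')) * b (L i j) = θ * t * β := by
    have : ∀ i j, (b (L i j) - θ * ∑ j', b (L i j')) * b (L i j) = w i j * b (L i j) -
        t * (leafInd L l i j * b (L i j)) + t * θ * (clusterCount L l i * b (L i j)) := by
      intro i j
      rw [← hres, div_eq_mul_inv, ← ht]; ring
    simp_rw [this, leafInd_mul_apply, Finset.sum_add_distrib, Finset.sum_sub_distrib,
      ← Finset.mul_sum, ← Finset.sum_mul, hb]
    rw [hc]
    change b l - t * (N * b l) + _ = _
    linear_combination (-b l) * htN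
  set Q := ∑ i, ∑ j, (b (L i j) - θ * ∑ j', b (L i j')) * b (L i j)
  have hQ : 0 ≤ Q := le_trans (Finset.sum_nonneg fun i _ => Finset.sum_nonneg fun j _ =>
    sq_nonneg _) e1
  have hθn : 0 < 1 - n * θ := by linarith
  have ht0 : 0 < t := by positivity
  have e4 : (1 - n * θ) * Q ^ 2 ≤ Q * ((θ * t) ^ 2 * (k * siblingDefect k M L l)) := by
    calc (1 - n * θ) * Q ^ 2 = (θ * t) ^ 2 * ((1 - n * θ) * β ^ 2) := by rw [e3]; ring
      _ ≤ (θ * t) ^ 2 * ((1 - n * θ) * ((∑ i, ∑ j, b (L i j) ^ 2) *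
          (k * siblingDefect k M L l))) := by gcongr
      _ = (θ * t) ^ 2 * (((1 - n * θ) * ∑ i, ∑ j, b (L i j) ^ 2) *
          (k * siblingDefect k M L l)) := by ring
      _ ≤ (θ * t) ^ 2 * (Q * (k * siblingDefect k M L l)) := by gcongr
      _ = _ := by ring
  have e5 : (1 - n * θ) * Q ≤ (θ * t) ^ 2 * (k * siblingDefect k M L l) := by
    rcases hQ.eq_or_lt with h | h
    · rw [← h]; simp; positivity
    · refine le_of_mul_le_mul_left ?_ h
      linarith
  have e6 : θ * t * N ≤ 1 := by
    have : θ * t * N ≤ (1 - θ) * t * N := by gcongr; linarith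
    linarith
  calc (1 - n * θ) * (N * ∑ i, ∑ j, (b (L i j) - θ * ∑ j', b (L i j')) ^ 2)
      ≤ (1 - n * θ) * (N * Q) := by gcongr
    _ = N * ((1 - n * θ) * Q) := by ring
    _ ≤ N * ((θ * t) ^ 2 * (k * siblingDefect k M L l)) := by gcongr
    _ ≤ N * ((θ * t) ^ 2 * (N * siblingDefect k M L l)) := by gcongr
    _ = (θ * t * N) ^ 2 * siblingDefect k M L l := by ring
    _ ≤ 1 ^ 2 * siblingDefect k M L l := by gcongr
    _ = _ := by ring

end Fit

end Weights

/-! ### Bounds on the quadratic form of the weights for heteroscedastic scales -/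

section PathwiseBounds

variable {s n k M : ℕ} {L : Fin s → Fin n → ℕ} {l : ℕ} {θ r η : ℝ} {w sg : Fin s → Fin n → ℝ}

/-- The normalised size of the clusters that meet the leaf `l`, over the observations whose scale
differs from `1`. -/
def spill (sg : Fin s → Fin n → ℝ) (L : Fin s → Fin n → ℕ) (l : ℕ) : ℝ :=
  (∑ i, ∑ j, if sg i j = 1 then 0 else clusterCount L l i ^ 2) / leafSize L l

/-- As `spill`, but counting only the siblings of an observation. -/
def siblingSpill (sg : Fin s → Fin n → ℝ) (L : Fin s → Fin n → ℕ) (l : ℕ) : ℝ :=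
  (∑ i, ∑ j, if sg i j = 1 then 0 else (clusterCount L l i - leafInd L l i j) ^ 2) / leafSize L l

lemma leafSize_nonneg (L : Fin s → Fin n → ℕ) (l : ℕ) : 0 ≤ leafSize L l :=
  Finset.sum_nonneg fun _ _ => Finset.sum_nonneg fun _ _ => leafInd_nonneg _ _ _ _

lemma spill_nonneg (sg : Fin s → Fin n → ℝ) (L : Fin s → Fin n → ℕ) (l : ℕ) :
    0 ≤ spill sg L l := by
  refine div_nonneg (Finset.sum_nonneg fun _ _ => Finset.sum_nonneg fun _ _ => ?_)
    (leafSize_nonneg L l)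
  split_ifs <;> positivity

lemma siblingSpill_nonneg (sg : Fin s → Fin n → ℝ) (L : Fin s → Fin n → ℕ) (l : ℕ) :
    0 ≤ siblingSpill sg L l := by
  refine div_nonneg (Finset.sum_nonneg fun _ _ => Finset.sum_nonneg fun _ _ => ?_)
    (leafSize_nonneg L l)
  split_ifs <;> positivity

lemma equiForm_nonneg (h0 : 0 ≤ r) (h1 : r ≤ 1) (f : Fin s → Fin n → ℝ) : 0 ≤ equiForm r f :=
  add_nonneg (mul_nonneg (by linarith) (by positivity)) (mul_nonneg h0 (by positivity))

lemma equiForm_ge (h0 : 0 ≤ r) (f : Fin s → Fin n → ℝ) :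
    (1 - r) * ∑ i, ∑ j, f i j ^ 2 ≤ equiForm r f :=
  le_add_of_nonneg_right (mul_nonneg h0 (by positivity))

lemma equiForm_le_mul (hn : 2 ≤ n) (h0 : 0 ≤ r) (h1 : r ≤ 1) (f : Fin s → Fin n → ℝ) :
    equiForm r f ≤ n * ∑ i, ∑ j, f i j ^ 2 := by
  have hn' : (2 : ℝ) ≤ n := by exact_mod_cast hn
  have : ∑ i, (∑ j, f i j) ^ 2 ≤ n * ∑ i, ∑ j, f i j ^ 2 := by
    rw [Finset.mul_sum]
    refine Finset.sum_le_sum fun i _ => ?_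
    simpa using sq_sum_le_card_mul_sum_sq (s := (Finset.univ : Finset (Fin n))) (f := f i)
  have h2 : 0 ≤ ∑ i, ∑ j, f i j ^ 2 := by positivity
  unfold equiForm
  nlinarith [mul_le_mul_of_nonneg_left this h0, mul_nonneg (sub_nonneg.2 h1) h2]

/-- The bilinear form of `equiForm`. -/
def equiBilin (r : ℝ) (f g : Fin s → Fin n → ℝ) : ℝ :=
  ∑ i, ∑ j, f i j * ((1 - r) * g i j + r * ∑ j', g i j')

lemma equiForm_sub (r : ℝ) (f g : Fin s → Fin n → ℝ) :
    equiForm r (fun i j => f i j - g i j) =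
      equiForm r f - 2 * equiBilin r f g + equiForm r g := by
  have : equiBilin r f g = (1 - r) * ∑ i, ∑ j, f i j * g i j +
      r * ∑ i, (∑ j, f i j) * ∑ j, g i j := by
    simp_rw [equiBilin, mul_add, Finset.sum_add_distrib, Finset.sum_mul, Finset.mul_sum]
    congr 1 <;> refine Finset.sum_congr rfl fun i _ => Finset.sum_congr rfl fun j _ => ?_
    · ring
    · exact Finset.sum_congr rfl fun j' _ => by ring
  rw [this]
  simp only [equiForm, sub_sq, Finset.sum_sub_distrib, Finset.sum_add_distrib, mul_assoc,
    ← Finset.mul_sum]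
  ring

lemma sum_leafInd_mul_clusterCount (L : Fin s → Fin n → ℕ) (l : ℕ) :
    ∑ i, ∑ j, leafInd L l i j * clusterCount L l i = ∑ i, clusterCount L l i ^ 2 := by
  refine Finset.sum_congr rfl fun i _ => ?_
  rw [← Finset.sum_mul, sq]; rfl

lemma sum_sub_mul_clusterCount_sq (L : Fin s → Fin n → ℕ) (l : ℕ) (t : ℝ) :
    ∑ i, ∑ j, (leafInd L l i j - t * clusterCount L l i) ^ 2 =
      leafSize L l - 2 * t * ∑ i, clusterCount L l i ^ 2 +
        t ^ 2 * n * ∑ i, clusterCount L l i ^ 2 := by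
  have : ∀ i j, (leafInd L l i j - t * clusterCount L l i) ^ 2 = leafInd L l i j -
      2 * t * (leafInd L l i j * clusterCount L l i) + t ^ 2 * clusterCount L l i ^ 2 := by
    intro i j
    nlinarith [leafInd_mul_self L l i j]
  simp_rw [this, Finset.sum_add_distrib, Finset.sum_sub_distrib, ← Finset.mul_sum,
    sum_leafInd_mul_clusterCount]
  simp only [Finset.sum_const, Finset.card_univ, Fintype.card_fin, nsmul_eq_mul, ← Finset.mul_sum]
  rw [leafSize]; ring

/-- A lower bound on the scaled quadratic form by a test vector. -/
lemma equiForm_mul_ge (hr0 : 0 ≤ r) (hr1 : r ≤ 1) (hη : 0 < η) (hsg : ∀ i j, η ≤ sg i j)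
    (w g : Fin s → Fin n → ℝ) :
    (1 - r) * (2 * ∑ i, ∑ j, w i j * g i j - ∑ i, ∑ j, g i j ^ 2 -
      (∑ i, ∑ j, if sg i j = 1 then 0 else g i j ^ 2) / η ^ 2) ≤
      equiForm r (fun i j => sg i j * w i j) := by
  refine le_trans (mul_le_mul_of_nonneg_left ?_ (sub_nonneg.2 hr1)) (equiForm_ge hr0 _)
  rw [Finset.mul_sum, Finset.sum_div, ← Finset.sum_sub_distrib, ← Finset.sum_sub_distrib]
  refine Finset.sum_le_sum fun i _ => ?_
  rw [Finset.mul_sum, Finset.sum_div, ← Finset.sum_sub_distrib, ← Finset.sum_sub_distrib]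
  refine Finset.sum_le_sum fun j _ => ?_
  have h := hsg i j
  split_ifs with h1
  · rw [h1, zero_div]; nlinarith [sq_nonneg (w i j - g i j)]
  · have hpos : 0 < sg i j := hη.trans_le h
    -- Completing the square with g/sg instead of g: a scale below 1 costs at most an extra g²/η².
    have h2 : 2 * (w i j * g i j) - g i j ^ 2 / sg i j ^ 2 ≤ (sg i j * w i j) ^ 2 := by
      have : (sg i j * w i j - g i j / sg i j) ^ 2 =
          (sg i j * w i j) ^ 2 - 2 * (w i j * g i j) + g i j ^ 2 / sg i j ^ 2 := by
        field_simp
        ring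
      nlinarith [sq_nonneg (sg i j * w i j - g i j / sg i j)]
    have h3 : g i j ^ 2 / sg i j ^ 2 ≤ g i j ^ 2 / η ^ 2 := by gcongr
    nlinarith [sq_nonneg (g i j)]

lemma sum_mul_sub_clusterCount (hw : IsLeafWeight θ L l w) (t : ℝ) :
    ∑ i, ∑ j, w i j * (leafInd L l i j - t * clusterCount L l i) =
      1 - t * ∑ i, ∑ j, w i j * clusterCount L l i := by
  have : ∀ i j, w i j * (leafInd L l i j - t * clusterCount L l i) =
    w i j * leafInd L l i j - t * (w i j * clusterCount L l i) := fun i j => by ring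
  simp_rw [this, Finset.sum_sub_distrib, ← Finset.mul_sum, hw.sum_mul_leafInd]

lemma one_sub_div_le_two_mul (hn : 2 ≤ n) (h1 : n * θ < 1) :
    (1 - n * θ) / (1 - θ) ≤ 2 * (1 - n * θ) := by
  have := theta_le_half hn h1
  rw [div_le_iff₀ (by linarith)]
  nlinarith

/-- The conditional variance for weights close to the fixed effects estimator. -/
lemma IsLeafWeight.equiForm_ge_of_near_one (hw : IsLeafWeight θ L l w)
    (hL : LabelRegular k M L) (hk : 0 < k) (hl : l < M) (hn : 2 ≤ n) (h0 : 0 ≤ θ)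
    (h1 : n * θ < 1) (hr0 : 0 ≤ r) (hr1 : r ≤ 1) (hη : 0 < η) (hsg : ∀ i j, η ≤ sg i j) :
    (1 - r) * (n / (n - 1)) - 4 * (1 - n * θ) - 4 * Real.sqrt (siblingDefect k M L l) -
      4 / η ^ 2 * spill sg L l ≤ leafSize L l * equiForm r (fun i j => sg i j * w i j) := by
  have hkN := hL.le_size l hl
  have hk' : (0 : ℝ) < k := by exact_mod_cast hk
  have hn' : (2 : ℝ) ≤ n := by exact_mod_cast hn
  have hN : 0 < leafSize L l := by linarith
  set c : ℝ := n / (n - 1) with hc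
  have hc2 : c ≤ 2 := by rw [hc, div_le_iff₀ (by linarith)]; linarith
  have hc0 : 0 < c := by apply div_pos <;> linarith
  -- This identity fixes the size of the test vector: twice the inner product minus the squared norm
  -- becomes 2c - c = c, the value in the limit ρ → 1.
  have hcn : c ^ 2 * (1 - 1 / n) = c := by
    have : (n : ℝ) - 1 ≠ 0 := by linarith
    rw [hc]; field_simp
  -- The test vector is the leaf indicator centred within clusters, rescaled by c/N.
  have hz := equiForm_mul_ge hr0 hr1 hη hsg w (fun i j => c / leafSize L l *
    (leafInd L l i j - (1 / n) * clusterCount L l i))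
  have hy := hw.abs_sum_clusterCount_sub_le hL hk hl hn h0 h1
  have hy' := (abs_le.1 hy).2
  have hy2 := one_sub_div_le_two_mul hn h1
  have hD := Real.sqrt_nonneg (siblingDefect k M L l)
  have hS := leafSize_le_sum_clusterCount_sq L l
  simp_rw [mul_pow, mul_left_comm (w _ _) (c / leafSize L l), ← Finset.mul_sum,
    sum_mul_sub_clusterCount hw, sum_sub_mul_clusterCount_sq] at hz
  set N := leafSize L l
  set S := ∑ i, clusterCount L l i ^ 2
  set Y := ∑ i, ∑ j, w i j * clusterCount L l i
  set D := Real.sqrt (siblingDefect k M L l)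
  set X := ∑ i, ∑ j, if sg i j = 1 then 0 else
    (c / N) ^ 2 * (leafInd L l i j - (1 / n) * clusterCount L l i) ^ 2 with hX
  have hXle : N * X ≤ 4 * spill sg L l := by
    rw [spill, hX, Finset.mul_sum, Finset.sum_div, Finset.mul_sum]
    refine Finset.sum_le_sum fun i _ => ?_
    rw [Finset.mul_sum, Finset.sum_div, Finset.mul_sum]
    refine Finset.sum_le_sum fun j _ => ?_
    split_ifs
    · simp
    · have e1 := leafInd_nonneg L l i j
      have e2 := leafInd_le_clusterCount L l i j
      have e3 : (1 : ℝ) / n * clusterCount L l i ≤ clusterCount L l i := by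
        have : (1 : ℝ) / n ≤ 1 := by rw [div_le_one (by linarith)]; linarith
        exact mul_le_of_le_one_left (clusterCount_nonneg L l i) this
      have e4 : 0 ≤ (1 : ℝ) / n * clusterCount L l i :=
        mul_nonneg (by positivity) (clusterCount_nonneg L l i)
      have e5 : (leafInd L l i j - 1 / n * clusterCount L l i) ^ 2 ≤ clusterCount L l i ^ 2 := by
        apply sq_le_sq'
        · linarith
        · linarith
      have e6 : c ^ 2 ≤ 4 := by nlinarith only [hc2, hc0]
      calc N * ((c / N) ^ 2 * (leafInd L l i j - 1 / n * clusterCount L l i) ^ 2)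
          = c ^ 2 * ((leafInd L l i j - 1 / n * clusterCount L l i) ^ 2 / N) := by field_simp
        _ ≤ 4 * (clusterCount L l i ^ 2 / N) := by gcongr
  clear_value X Y S D N c
  have hY : Y / n ≤ (1 - n * θ) + D := by
    rw [div_le_iff₀ (by linarith)]
    have : 0 ≤ (n - 2) * ((1 - n * θ) + D) := mul_nonneg (by linarith) (by linarith)
    linarith
  -- Several members of one cluster in the leaf only shorten the centred indicator, because S ≥ N.
  have hq : N * ((c / N) ^ 2 * (N - 2 * (1 / n) * S + (1 / n) ^ 2 * n * S)) ≤ c := by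
    have : N * ((c / N) ^ 2 * (N - 2 * (1 / n) * S + (1 / n) ^ 2 * n * S)) =
      c ^ 2 * (1 - 1 / n * (S / N)) := by field_simp; ring
    rw [this]
    refine le_trans ?_ hcn.le
    have : 1 ≤ S / N := by rwa [one_le_div hN]
    refine mul_le_mul_of_nonneg_left ?_ (sq_nonneg c)
    have : (1 : ℝ) / n * 1 ≤ 1 / n * (S / N) := by gcongr
    linarith
  have hz2 := mul_le_mul_of_nonneg_left hz hN.le
  refine le_trans ?_ hz2
  have e1 : N * ((1 - r) * (2 * (c / N * (1 - 1 / n * Y)) -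
      (c / N) ^ 2 * (N - 2 * (1 / n) * S + (1 / n) ^ 2 * n * S) - X / η ^ 2)) =
      (1 - r) * (2 * c - 2 * c * (Y / n) -
        N * ((c / N) ^ 2 * (N - 2 * (1 / n) * S + (1 / n) ^ 2 * n * S)) - N * X / η ^ 2) := by
    have hNN : N * (c / N) = c := mul_div_cancel₀ _ hN.ne'
    linear_combination ((1 - r) * 2 * (1 - 1 / n * Y)) * hNN
  rw [e1]
  have e2 : N * X / η ^ 2 ≤ 4 / η ^ 2 * spill sg L l := by
    rw [div_mul_eq_mul_div]; gcongr
  have e3 : 2 * c * (Y / n) ≤ 4 * (1 - n * θ) + 4 * D := by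
    have : 0 ≤ 1 - n * θ := by linarith
    calc 2 * c * (Y / n) ≤ 2 * c * (1 - n * θ + D) := by gcongr
      _ ≤ 2 * 2 * (1 - n * θ + D) := by gcongr
      _ = _ := by ring
  have e4 := spill_nonneg sg L l
  have e5 : 0 ≤ 4 / η ^ 2 * spill sg L l := by positivity
  have e6 : (1 - r) * (c - (4 * (1 - n * θ) + 4 * D + 4 / η ^ 2 * spill sg L l)) ≤
      (1 - r) * (2 * c - 2 * c * (Y / n) -
        N * ((c / N) ^ 2 * (N - 2 * (1 / n) * S + (1 / n) ^ 2 * n * S)) - N * X / η ^ 2) := by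
    apply mul_le_mul_of_nonneg_left _ (by linarith)
    linarith
  refine le_trans ?_ e6
  have : 0 ≤ 4 * (1 - n * θ) + 4 * D + 4 / η ^ 2 * spill sg L l := by
    have : 0 ≤ 1 - n * θ := by linarith
    positivity
  linarith [mul_nonneg hr0 this]

/-- The conditional variance for weights bounded away from zero: the siblings of the observations in
the leaf contribute. -/
lemma IsLeafWeight.equiForm_ge_of_le (hw : IsLeafWeight θ L l w)
    (hL : LabelRegular k M L) (hk : 0 < k) (hl : l < M) (hn : 2 ≤ n) (h0 : 0 ≤ θ)
    (h1 : n * θ < 1) (hr0 : 0 ≤ r) (hr1 : r ≤ 1) (hη : 0 < η) (hsg : ∀ i j, η ≤ sg i j) :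
    (1 - r) * θ ^ 2 / n ^ 2 - 4 * Real.sqrt (siblingDefect k M L l) -
      1 / η ^ 2 * siblingSpill sg L l ≤
      leafSize L l * equiForm r (fun i j => sg i j * w i j) := by
  have hkN := hL.le_size l hl
  have hk' : (0 : ℝ) < k := by exact_mod_cast hk
  have hn' : (2 : ℝ) ≤ n := by exact_mod_cast hn
  have hN : 0 < leafSize L l := by linarith
  have hθ := theta_le_half hn h1
  -- With this size the normalised squared norm of the test vector is at most cθ, half of the inner
  -- product term 2cθ.
  set c : ℝ := θ / n ^ 2 with hc
  have hc0 : 0 ≤ c := by positivity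
  have hn4 : (4 : ℝ) ≤ n ^ 2 := by nlinarith only [hn']
  have hc1 : c ≤ 1 := by rw [hc, div_le_one (by positivity)]; linarith
  -- The test vector lives on siblings of observations in the leaf. It vanishes at an observation of
  -- the leaf without siblings there, so a small scale inside the leaf does no harm; only siblings
  -- with small scale do.
  have hz := equiForm_mul_ge hr0 hr1 hη hsg w (fun i j => c / leafSize L l *
    (leafInd L l i j - 1 * clusterCount L l i))
  have hy := hw.abs_sum_clusterCount_sub_le hL hk hl hn h0 h1
  have hy' := (abs_le.1 hy).2
  have hD := Real.sqrt_nonneg (siblingDefect k M L l)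
  have hS := sum_clusterCount_sq_le_mul L l
  have hS1 := leafSize_le_sum_clusterCount_sq L l
  simp_rw [mul_pow, mul_left_comm (w _ _) (c / leafSize L l), ← Finset.mul_sum,
    sum_mul_sub_clusterCount hw, sum_sub_mul_clusterCount_sq] at hz
  set N := leafSize L l
  set S := ∑ i, clusterCount L l i ^ 2
  set Y := ∑ i, ∑ j, w i j * clusterCount L l i
  set D := Real.sqrt (siblingDefect k M L l)
  set X := ∑ i, ∑ j, if sg i j = 1 then 0 else
    (c / N) ^ 2 * (leafInd L l i j - 1 * clusterCount L l i) ^ 2 with hX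
  have hXle : N * X ≤ siblingSpill sg L l := by
    rw [siblingSpill, hX, Finset.mul_sum, Finset.sum_div]
    refine Finset.sum_le_sum fun i _ => ?_
    rw [Finset.mul_sum, Finset.sum_div]
    refine Finset.sum_le_sum fun j _ => ?_
    split_ifs
    · simp
    · calc N * ((c / N) ^ 2 * (leafInd L l i j - 1 * clusterCount L l i) ^ 2)
          = c ^ 2 * ((clusterCount L l i - leafInd L l i j) ^ 2 / N) := by field_simp; ring
        _ ≤ 1 ^ 2 * ((clusterCount L l i - leafInd L l i j) ^ 2 / N) := by gcongr
        _ = _ := by ring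
  clear_value X Y S D N c
  -- Since w sums to 1 over the leaf, this says that the siblings carry total weight at most -θ +
  -- 2D.
  have hY : Y ≤ 1 - θ + 2 * D := by
    have : (1 - n * θ) / (1 - θ) ≤ 1 - θ := by
      rw [div_le_iff₀ (by linarith)]
      have : 2 * θ ≤ n * θ := by gcongr
      linarith [sq_nonneg θ]
    linarith
  have hq : N * ((c / N) ^ 2 * (N - 2 * 1 * S + 1 ^ 2 * n * S)) ≤ c * θ := by
    have : N * ((c / N) ^ 2 * (N - 2 * 1 * S + 1 ^ 2 * n * S)) =
      c ^ 2 * (1 + (n - 2) * (S / N)) := by field_simp; ring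
    have h2 : S / N ≤ n := by rwa [div_le_iff₀ hN]
    have h3 : 1 + (n - 2) * (S / N) ≤ (n : ℝ) ^ 2 := by
      have : (n - 2) * (S / N) ≤ (n - 2) * n := mul_le_mul_of_nonneg_left h2 (by linarith)
      linarith
    rw [this]
    calc c ^ 2 * (1 + (n - 2) * (S / N)) ≤ c ^ 2 * (n : ℝ) ^ 2 := by gcongr
      _ = c * θ := by rw [hc]; field_simp
  have hz2 := mul_le_mul_of_nonneg_left hz hN.le
  refine le_trans ?_ hz2
  have e1 : N * ((1 - r) * (2 * (c / N * (1 - 1 * Y)) -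
      (c / N) ^ 2 * (N - 2 * 1 * S + 1 ^ 2 * n * S) - X / η ^ 2)) =
      (1 - r) * (2 * c * (1 - Y) -
        N * ((c / N) ^ 2 * (N - 2 * 1 * S + 1 ^ 2 * n * S)) - N * X / η ^ 2) := by
    have hNN : N * (c / N) = c := mul_div_cancel₀ _ hN.ne'
    linear_combination ((1 - r) * 2 * (1 - 1 * Y)) * hNN
  rw [e1]
  have e2 : N * X / η ^ 2 ≤ 1 / η ^ 2 * siblingSpill sg L l := by
    rw [div_mul_eq_mul_div, one_mul]; gcongr
  have e3 : 2 * c * (1 - Y) ≥ 2 * c * θ - 4 * D := by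
    have f1 : 2 * c * (θ - 2 * D) ≤ 2 * c * (1 - Y) :=
      mul_le_mul_of_nonneg_left (by linarith) (by positivity)
    have f2 : c * D ≤ 1 * D := by gcongr
    linarith
  have e4 := siblingSpill_nonneg sg L l
  have e5 : 0 ≤ 1 / η ^ 2 * siblingSpill sg L l := by positivity
  have e6 : (1 - r) * (c * θ - (4 * D + 1 / η ^ 2 * siblingSpill sg L l)) ≤
      (1 - r) * (2 * c * (1 - Y) -
        N * ((c / N) ^ 2 * (N - 2 * 1 * S + 1 ^ 2 * n * S)) - N * X / η ^ 2) := by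
    apply mul_le_mul_of_nonneg_left _ (by linarith)
    linarith
  refine le_trans ?_ e6
  have h7 : 0 ≤ 4 * D + 1 / η ^ 2 * siblingSpill sg L l := by positivity
  have h8 : (1 - r) * θ ^ 2 / n ^ 2 = (1 - r) * (c * θ) := by rw [hc]; field_simp
  rw [h8]
  linarith [mul_nonneg hr0 h7]

/-- Both sides are sums of off-diagonal products, which increase with nonnegative entries. -/
lemma sum_sq_sub_le {f u : Fin n → ℝ} (h0 : ∀ j, 0 ≤ f j) (h1 : ∀ j, f j ≤ u j) :
    (∑ j, f j) ^ 2 - ∑ j, f j ^ 2 ≤ (∑ j, u j) ^ 2 - ∑ j, u j ^ 2 := by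
  have key : ∀ f : Fin n → ℝ, (∑ j, f j) ^ 2 - ∑ j, f j ^ 2 = ∑ j, f j * (∑ j', f j' - f j) := by
    intro f
    simp_rw [mul_sub, Finset.sum_sub_distrib, ← Finset.sum_mul, sq]
  rw [key, key]
  refine Finset.sum_le_sum fun j _ => ?_
  have e : ∀ f : Fin n → ℝ, ∑ j', f j' - f j = ∑ j', if j' = j then 0 else f j' := by
    intro f
    have : ∀ j', (if j' = j then 0 else f j') = f j' - if j' = j then f j' else 0 :=
      fun j' => by split_ifs <;> simp
    simp_rw [this, Finset.sum_sub_distrib]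
    simp
  rw [e, e]
  refine mul_le_mul (h1 j) (Finset.sum_le_sum fun j' _ => ?_)
    (Finset.sum_nonneg fun j' _ => ?_) ((h0 j).trans (h1 j))
  · split_ifs
    exacts [le_rfl, h1 j']
  · split_ifs
    exacts [le_rfl, h0 j']

/-- The weights for `θ = 0` are the ones of the leaf average. -/
lemma IsLeafWeight.eq_of_zero (hw : IsLeafWeight 0 L l w) (hN : 0 < leafSize L l) (i : Fin s)
    (j : Fin n) : w i j = leafInd L l i j / leafSize L l := by
  have hu := hw.sum_mul_leafInd
  obtain ⟨a, ha, hb⟩ := hw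
  have ha' : ∀ i j, w i j = a (L i j) := fun i j => by simpa using ha i j
  have h1 : ∑ i, ∑ j, w i j ^ 2 = a l := by
    rw [← hb a]; simp_rw [← ha', sq]
  have h2 : leafSize L l * a l = 1 := by
    rw [← hu, leafSize, Finset.sum_mul]
    simp_rw [Finset.sum_mul, ha', ← leafInd_mul_apply, mul_comm]
  -- Expanding the square, ‖w‖² = a(l) = 1/N and ⟨w, indicator⟩ = 1 leave nothing.
  have h3 : ∑ i, ∑ j, (w i j - leafInd L l i j / leafSize L l) ^ 2 = 0 := by
    have : ∀ i j, (w i j - leafInd L l i j / leafSize L l) ^ 2 = w i j ^ 2 -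
        2 / leafSize L l * (w i j * leafInd L l i j) +
        1 / leafSize L l ^ 2 * leafInd L l i j := by
      intro i j
      have := leafInd_mul_self L l i j
      field_simp
      linear_combination this
    simp_rw [this, Finset.sum_add_distrib, Finset.sum_sub_distrib, ← Finset.mul_sum, hu, h1]
    rw [← leafSize]
    have : a l = 1 / leafSize L l := by rw [eq_div_iff hN.ne']; linarith
    rw [this]; field_simp; ring
  have h4 := (Finset.sum_eq_zero_iff_of_nonneg (fun i _ => Finset.sum_nonneg fun j _ =>
    sq_nonneg _)).1 h3 i (Finset.mem_univ i)
  have h5 := (Finset.sum_eq_zero_iff_of_nonneg (fun j _ => sq_nonneg _)).1 h4 j (Finset.mem_univ j)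
  have := pow_eq_zero_iff (two_ne_zero) |>.1 h5
  linarith

/-- The conditional variance of the leaf average. -/
lemma IsLeafWeight.equiForm_le_of_zero (hw : IsLeafWeight 0 L l w)
    (hL : LabelRegular k M L) (hk : 0 < k) (hl : l < M) (hr0 : 0 ≤ r) (hr1 : r ≤ 1)
    (hsg0 : ∀ i j, 0 ≤ sg i j) (hsg : ∀ i j, sg i j ≤ 1) :
    leafSize L l * equiForm r (fun i j => sg i j * w i j) ≤ η ^ 2 +
      (∑ i, ∑ j, if sg i j = η then 0 else leafInd L l i j) / leafSize L l +
      Real.sqrt (siblingDefect k M L l) := by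
  have hkN := hL.le_size l hl
  have hk' : (0 : ℝ) < k := by exact_mod_cast hk
  have hN : 0 < leafSize L l := by linarith
  have hS := hL.sum_clusterCount_sq_le hk hl
  have hD := Real.sqrt_nonneg (siblingDefect k M L l)
  have h1 : equiForm r (fun i j => sg i j * w i j) =
      equiForm r (fun i j => sg i j * leafInd L l i j) / leafSize L l ^ 2 := by
    have : ∀ i j, sg i j * w i j = (sg i j * leafInd L l i j) * (leafSize L l)⁻¹ := fun i j => by
      rw [hw.eq_of_zero hN]; ring
    simp only [equiForm, this, mul_pow, ← Finset.sum_mul]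
    field_simp
  have h2 : equiForm r (fun i j => sg i j * leafInd L l i j) ≤
      ∑ i, ∑ j, sg i j ^ 2 * leafInd L l i j + (∑ i, clusterCount L l i ^ 2 - leafSize L l) := by
    have e1 : ∀ i j, (sg i j * leafInd L l i j) ^ 2 = sg i j ^ 2 * leafInd L l i j := by
      intro i j
      rw [mul_pow, sq (leafInd L l i j), leafInd_mul_self]
    -- The diagonal keeps the small scales; only the products of two siblings in the leaf are
    -- bounded with scale 1.
    have e2 : ∀ i, (∑ j, sg i j * leafInd L l i j) ^ 2 ≤
        ∑ j, sg i j ^ 2 * leafInd L l i j +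
          (clusterCount L l i ^ 2 - ∑ j, leafInd L l i j) := by
      intro i
      have := sum_sq_sub_le (f := fun j => sg i j * leafInd L l i j) (u := fun j => leafInd L l i j)
        (fun j => mul_nonneg (hsg0 i j) (leafInd_nonneg L l i j))
        (fun j => mul_le_of_le_one_left (leafInd_nonneg L l i j) (hsg i j))
      simp_rw [e1, sq (leafInd L l i _), leafInd_mul_self] at this
      rw [clusterCount]
      linarith
    have e3 : ∑ i, (∑ j, sg i j * leafInd L l i j) ^ 2 ≤
        ∑ i, ∑ j, sg i j ^ 2 * leafInd L l i j +
          (∑ i, clusterCount L l i ^ 2 - leafSize L l) := by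
      rw [leafSize, ← Finset.sum_sub_distrib, ← Finset.sum_add_distrib]
      exact Finset.sum_le_sum fun i _ => e2 i
    have e4 := leafSize_le_sum_clusterCount_sq L l
    rw [equiForm]
    simp_rw [e1]
    nlinarith [mul_le_mul_of_nonneg_left e3 hr0]
  have h3 : ∑ i, ∑ j, sg i j ^ 2 * leafInd L l i j ≤ η ^ 2 * leafSize L l +
      ∑ i, ∑ j, if sg i j = η then 0 else leafInd L l i j := by
    rw [leafSize, Finset.mul_sum, ← Finset.sum_add_distrib]
    refine Finset.sum_le_sum fun i _ => ?_
    rw [Finset.mul_sum, ← Finset.sum_add_distrib]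
    refine Finset.sum_le_sum fun j _ => ?_
    have := leafInd_nonneg L l i j
    split_ifs with h
    · rw [h]; simp
    · have : sg i j ^ 2 ≤ 1 := by nlinarith [hsg0 i j, hsg i j]
      nlinarith [sq_nonneg η, mul_nonneg (sq_nonneg η) (leafInd_nonneg L l i j)]
  rw [h1]
  have : leafSize L l * (equiForm r (fun i j => sg i j * leafInd L l i j) / leafSize L l ^ 2) =
    equiForm r (fun i j => sg i j * leafInd L l i j) / leafSize L l := by field_simp
  rw [this, div_le_iff₀ hN, add_mul, add_mul, div_mul_cancel₀ _ hN.ne']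
  nlinarith

lemma IsLeafWeight.leafSize_mul_sum_sq_le (hw : IsLeafWeight θ L l w)
    (hN : 0 < leafSize L l) (h0 : 0 ≤ θ) (h1 : n * θ < 1) :
    leafSize L l * ∑ i, ∑ j, w i j ^ 2 ≤ 1 / (1 - n * θ) := by
  rw [le_div_iff₀ (by linarith), mul_comm]
  exact hw.mul_leafSize_mul_sum_sq_le hN h0 h1

/-- The conditional variance for weights close to zero. -/
lemma IsLeafWeight.equiForm_ge_of_near_zero (hw : IsLeafWeight θ L l w)
    (hL : LabelRegular k M L) (hk : 0 < k) (hl : l < M) (hn : 2 ≤ n) (h0 : 0 ≤ θ)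
    (h1 : n * θ ≤ 1 / 2) (hr0 : 0 ≤ r) (hr1 : r ≤ 1)
    (hsg0 : ∀ i j, 0 ≤ sg i j) (hsg : ∀ i j, sg i j ≤ 1) :
    1 - 2 * n * θ - 5 * Real.sqrt (siblingDefect k M L l) - 4 * Real.sqrt (spill sg L l) ≤
      leafSize L l * equiForm r (fun i j => sg i j * w i j) := by
  have hkN := hL.le_size l hl
  have hk' : (0 : ℝ) < k := by exact_mod_cast hk
  have hn' : (2 : ℝ) ≤ n := by exact_mod_cast hn
  have hN : 0 < leafSize L l := by linarith
  have h1' : n * θ < 1 := by linarith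
  have hθ := theta_le_half hn h1'
  have hD := Real.sqrt_nonneg (siblingDefect k M L l)
  have hS := hL.sum_clusterCount_sq_le hk hl
  have hy := hw.abs_sum_clusterCount_sub_le hL hk hl hn h0 h1'
  have hy' := (abs_le.1 hy).1
  have hw2 := hw.leafSize_mul_sum_sq_le hN h0 h1'
  have hw3 : leafSize L l * ∑ i, ∑ j, w i j ^ 2 ≤ 2 := by
    refine hw2.trans ?_
    rw [div_le_iff₀ (by linarith)]; linarith
  have hu := hw.sum_mul_leafInd
  -- Comparison with the leaf average z: positivity of the form at sg·w - z bounds the form at sg·w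
  -- below by twice the bilinear term minus the form at z.
  have hpos := equiForm_nonneg hr0 hr1
    (fun i j => sg i j * w i j - leafInd L l i j / leafSize L l)
  rw [equiForm_sub] at hpos
  have hz : leafSize L l * equiForm r (fun i j => leafInd L l i j / leafSize L l) ≤
      1 + Real.sqrt (siblingDefect k M L l) := by
    have e1 : equiForm r (fun i j => leafInd L l i j / leafSize L l) =
        ((1 - r) * leafSize L l + r * ∑ i, clusterCount L l i ^ 2) / leafSize L l ^ 2 := by
      simp only [equiForm, div_pow, ← Finset.sum_div, sq (leafInd L l _ _), leafInd_mul_self]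
      rw [← leafSize, add_div, mul_div_assoc, mul_div_assoc]
      rfl
    have e2 : leafSize L l * equiForm r (fun i j => leafInd L l i j / leafSize L l) =
      ((1 - r) * leafSize L l + r * ∑ i, clusterCount L l i ^ 2) / leafSize L l := by
      rw [e1]; field_simp
    rw [e2, div_le_iff₀ hN]
    nlinarith [mul_le_mul_of_nonneg_left hS hr0, mul_nonneg hN.le hD]
  set N := leafSize L l
  set D := Real.sqrt (siblingDefect k M L l)
  set Y := ∑ i, ∑ j, w i j * clusterCount L l i
  set h : Fin s → Fin n → ℝ := fun i j => (1 - r) * leafInd L l i j + r * clusterCount L l i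
  have hh0 : ∀ i j, 0 ≤ h i j := fun i j => add_nonneg (mul_nonneg (by linarith)
    (leafInd_nonneg L l i j)) (mul_nonneg hr0 (clusterCount_nonneg L l i))
  have hh1 : ∀ i j, h i j ≤ clusterCount L l i := fun i j => by
    have := leafInd_le_clusterCount L l i j
    change (1 - r) * leafInd L l i j + r * clusterCount L l i ≤ _
    nlinarith
  have hb : N * equiBilin r (fun i j => sg i j * w i j) (fun i j => leafInd L l i j / N) =
      (1 - r) + r * Y - ∑ i, ∑ j, (1 - sg i j) * w i j * h i j := by
    have e1 : (1 - r) + r * Y = ∑ i, ∑ j, w i j * h i j := by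
      have : ∀ i j, w i j * h i j = (1 - r) * (w i j * leafInd L l i j) +
        r * (w i j * clusterCount L l i) := fun i j => by simp only [h]; ring
      simp_rw [this, Finset.sum_add_distrib, ← Finset.mul_sum, hu, mul_one]
      rfl
    rw [e1, ← Finset.sum_sub_distrib, equiBilin, Finset.mul_sum]
    refine Finset.sum_congr rfl fun i _ => ?_
    rw [← Finset.sum_sub_distrib, Finset.mul_sum]
    refine Finset.sum_congr rfl fun j _ => ?_
    rw [← Finset.sum_div]
    change N * (sg i j * w i j * ((1 - r) * (leafInd L l i j / N) +
      r * (clusterCount L l i / N))) = _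
    simp only [h]
    field_simp
    ring
  -- Scales other than 1 perturb the bilinear term by at most this, by Cauchy-Schwarz and N‖w‖² ≤ 2.
  have hcs : |∑ i, ∑ j, (1 - sg i j) * w i j * h i j| ≤ 2 * Real.sqrt (spill sg L l) := by
    rw [← Real.sqrt_sq (by norm_num : (0 : ℝ) ≤ 2), ← Real.sqrt_mul (by norm_num)]
    apply Real.abs_le_sqrt
    have e1 : (∑ p : Fin s × Fin n, w p.1 p.2 * ((1 - sg p.1 p.2) * h p.1 p.2)) ^ 2 ≤
      (∑ p : Fin s × Fin n, w p.1 p.2 ^ 2) *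
        ∑ p : Fin s × Fin n, ((1 - sg p.1 p.2) * h p.1 p.2) ^ 2 :=
      Finset.sum_mul_sq_le_sq_mul_sq _ _ _
    simp only [Fintype.sum_prod_type] at e1
    have e2 : ∑ i, ∑ j, ((1 - sg i j) * h i j) ^ 2 ≤ N * spill sg L l := by
      rw [spill, mul_div_cancel₀ _ hN.ne']
      refine Finset.sum_le_sum fun i _ => Finset.sum_le_sum fun j _ => ?_
      split_ifs with hs
      · simp [hs]
      · have f1 : (1 - sg i j) * h i j ≤ clusterCount L l i := by
          have := hh0 i j
          have := hh1 i j
          have := hsg0 i j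
          have := hsg i j
          nlinarith
        have f2 : 0 ≤ (1 - sg i j) * h i j := mul_nonneg (by linarith [hsg i j]) (hh0 i j)
        exact pow_le_pow_left₀ f2 f1 2
    have e3 := spill_nonneg sg L l
    have e4 : 0 ≤ ∑ i, ∑ j, w i j ^ 2 := by positivity
    calc (∑ i, ∑ j, (1 - sg i j) * w i j * h i j) ^ 2
        = (∑ i, ∑ j, w i j * ((1 - sg i j) * h i j)) ^ 2 := by
          congr 1
          exact Finset.sum_congr rfl fun i _ => Finset.sum_congr rfl fun j _ => by ring
      _ ≤ _ := e1
      _ ≤ (∑ i, ∑ j, w i j ^ 2) * (N * spill sg L l) := by gcongr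
      _ = (N * ∑ i, ∑ j, w i j ^ 2) * spill sg L l := by ring
      _ ≤ 2 * spill sg L l := by gcongr
      _ ≤ 2 ^ 2 * spill sg L l := by gcongr; norm_num
  have hpos2 := mul_nonneg hN.le hpos
  clear_value Y D N h
  have e5 : 1 - n * θ ≤ (1 - n * θ) / (1 - θ) := by
    rw [le_div_iff₀ (by linarith)]; nlinarith
  have e6 := (abs_le.1 hcs).2
  have e7 : r * Y ≥ r - n * θ - 2 * D := by
    have : 1 - n * θ - 2 * D ≤ Y := by linarith
    have h3 : 0 ≤ n * θ + 2 * D := by positivity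
    nlinarith
  nlinarith

set_option maxHeartbeats 800000 in
/-- The conditional variance for the weights that are optimal under homoscedasticity. -/
lemma IsLeafWeight.equiForm_mul_le (hr0 : 0 < r) (hr1 : r < 1)
    (hw : IsLeafWeight (r / (1 + (n - 1) * r)) L l w)
    (hL : LabelRegular k M L) (hk : 0 < k) (hl : l < M) (hn : 2 ≤ n)
    (hsg0 : ∀ i j, 0 ≤ sg i j) (hsg : ∀ i j, sg i j ≤ 1) {ζ K : ℝ} (hζ : 0 < ζ)
    (hK : K = (1 + (n - 1) * r) / (1 - r)) :
    leafSize L l * equiForm r (fun i j => sg i j * w i j) ≤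
      (1 - r) / (1 - r / (1 + (n - 1) * r)) +
        n * Real.sqrt (siblingDefect k M L l) + ζ * (n * K) +
        (1 + 1 / ζ) * n * (2 * K * siblingDefect k M L l + 8 * spill sg L l) := by
  have hkN := hL.le_size l hl
  have hk' : (0 : ℝ) < k := by exact_mod_cast hk
  have hn' : (2 : ℝ) ≤ n := by exact_mod_cast hn
  have hN : 0 < leafSize L l := by linarith
  have hR : 0 < 1 + (n - 1) * r := by nlinarith
  have hmain := hw.equiForm_le hr0 hr1 hL hk hl hn
  set θ := r / (1 + (n - 1) * r) with hθdef
  have h0 : 0 ≤ θ := by positivity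
  have hnθ : 1 - n * θ = 1 / K := by
    rw [hK, one_div_div, hθdef, eq_div_iff hR.ne', sub_mul, mul_assoc, div_mul_cancel₀ _ hR.ne']
    ring
  have hKpos : 0 < K := by rw [hK]; exact div_pos hR (by linarith)
  have h1 : n * θ < 1 := by
    have : 0 < 1 / K := by positivity
    linarith
  have hθ := theta_le_half hn h1
  have hw2 := hw.leafSize_mul_sum_sq_le hN h0 h1
  have hw0 := hw.sum_sub_ideal_sq_le hL hk hl hn h0 h1
  rw [hnθ] at hw2 hw0
  rw [one_div_one_div] at hw2
  rw [div_mul_eq_mul_div, one_mul, div_le_iff₀ hKpos] at hw0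
  have hD := Real.sqrt_nonneg (siblingDefect k M L l)
  set N := leafSize L l
  set e : Fin s → Fin n → ℝ := fun i j => (1 - sg i j) * w i j with he
  -- Young's inequality for sg·w = w - e, where `e` is supported on scales other than 1. The cross
  -- term costs a factor ζ on the main part.
  have h2 : equiForm r (fun i j => sg i j * w i j) ≤
      equiForm r w + ζ * equiForm r w + (1 + 1 / ζ) * equiForm r e := by
    have e1 : (fun i j => sg i j * w i j) = fun i j => w i j - e i j := by
      funext i j; simp only [he]; ring
    have e2 := equiForm_nonneg hr0.le hr1.le (fun i j => (-ζ) * w i j - e i j)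
    rw [equiForm_sub] at e2
    have e3 : equiForm r (fun i j => (-ζ) * w i j) = ζ ^ 2 * equiForm r w := by
      simp only [equiForm, mul_pow, ← Finset.mul_sum]; ring
    have e4 : equiBilin r (fun i j => (-ζ) * w i j) e = -ζ * equiBilin r w e := by
      simp only [equiBilin, mul_assoc, ← Finset.mul_sum]
    rw [e3, e4] at e2
    have e5 : -2 * equiBilin r w e ≤ ζ * equiForm r w + 1 / ζ * equiForm r e := by
      refine le_of_mul_le_mul_left ?_ hζ
      have : ζ * (ζ * equiForm r w + 1 / ζ * equiForm r e) =
        ζ ^ 2 * equiForm r w + equiForm r e := by field_simp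
      rw [this]; linarith
    rw [e1, equiForm_sub]
    linarith
  have h3 : N * equiForm r w ≤ n * K := by
    have := equiForm_le_mul hn hr0.le hr1.le w
    calc N * equiForm r w ≤ N * (n * ∑ i, ∑ j, w i j ^ 2) := by gcongr
      _ = n * (N * ∑ i, ∑ j, w i j ^ 2) := by ring
      _ ≤ _ := by gcongr
  have h4 : N * ∑ i, ∑ j, e i j ^ 2 ≤ 2 * K * siblingDefect k M L l + 8 * spill sg L l := by
    -- Where the scale is not 1, w² ≤ 2(w - w₀)² + 2w₀² with the ideal weight w₀. The first part is
    -- governed by the defect; the second by `spill`, because |w₀| is at most twice the cluster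
    -- count over N.
    have f1 : ∑ i, ∑ j, e i j ^ 2 ≤ 2 * ∑ i, ∑ j, (w i j -
        (leafInd L l i j - θ * clusterCount L l i) / ((1 - θ) * N)) ^ 2 +
        8 * (spill sg L l / N) := by
      rw [spill, div_div, Finset.sum_div, Finset.mul_sum, Finset.mul_sum,
        ← Finset.sum_add_distrib]
      refine Finset.sum_le_sum fun i _ => ?_
      rw [Finset.sum_div, Finset.mul_sum, Finset.mul_sum, ← Finset.sum_add_distrib]
      refine Finset.sum_le_sum fun j _ => ?_
      split_ifs with hs
      · simp only [he, hs]; simp; positivity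
      · have g1 : e i j ^ 2 ≤ w i j ^ 2 := by
          simp only [he, mul_pow]
          have : (1 - sg i j) ^ 2 ≤ 1 := by nlinarith [hsg0 i j, hsg i j]
          nlinarith [sq_nonneg (w i j)]
        have g2 : ((leafInd L l i j - θ * clusterCount L l i) / ((1 - θ) * N)) ^ 2 ≤
            4 * (clusterCount L l i ^ 2 / (N * N)) := by
          have q1 := leafInd_nonneg L l i j
          have q2 := leafInd_le_clusterCount L l i j
          have q3 : (leafInd L l i j - θ * clusterCount L l i) ^ 2 ≤ clusterCount L l i ^ 2 := by
            apply sq_le_sq'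
            · nlinarith
            · nlinarith
          rw [div_pow, mul_pow, ← mul_div_assoc, div_le_div_iff₀ (by
            have : 0 < 1 - θ := by linarith
            positivity) (by positivity)]
          have q4 : 1 ≤ 4 * (1 - θ) ^ 2 := by nlinarith
          calc _ ≤ clusterCount L l i ^ 2 * (N * N) := by gcongr
            _ = 1 * (clusterCount L l i ^ 2 * (N * N)) := by ring
            _ ≤ (4 * (1 - θ) ^ 2) * (clusterCount L l i ^ 2 * (N * N)) := by gcongr
            _ = _ := by ring
        set w0 := (leafInd L l i j - θ * clusterCount L l i) / ((1 - θ) * N)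
        nlinarith [sq_nonneg (w i j - 2 * w0)]
    calc N * ∑ i, ∑ j, e i j ^ 2 ≤ N * _ := mul_le_mul_of_nonneg_left f1 hN.le
      _ = 2 * (N * ∑ i, ∑ j, (w i j -
        (leafInd L l i j - θ * clusterCount L l i) / ((1 - θ) * N)) ^ 2) +
          8 * spill sg L l := by field_simp
      _ ≤ _ := by linarith
  have h5 : N * equiForm r e ≤ n * (2 * K * siblingDefect k M L l + 8 * spill sg L l) := by
    have := equiForm_le_mul hn hr0.le hr1.le e
    calc N * equiForm r e ≤ N * (n * ∑ i, ∑ j, e i j ^ 2) := by gcongr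
      _ = n * (N * ∑ i, ∑ j, e i j ^ 2) := by ring
      _ ≤ _ := by gcongr
  have h6 : 1 + (n - 1) * r ≤ (n : ℝ) := by nlinarith
  calc N * equiForm r (fun i j => sg i j * w i j) ≤
      N * (equiForm r w + ζ * equiForm r w + (1 + 1 / ζ) * equiForm r e) := by gcongr
    _ = N * equiForm r w + ζ * (N * equiForm r w) + (1 + 1 / ζ) * (N * equiForm r e) := by ring
    _ ≤ ((1 - r) / (1 - θ) + n * Real.sqrt (siblingDefect k M L l)) + ζ * (n * K) +
        (1 + 1 / ζ) * (n * (2 * K * siblingDefect k M L l + 8 * spill sg L l)) := by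
      gcongr
      exact hmain.trans (by gcongr)
    _ = _ := by ring

end PathwiseBounds

/-! ### Rank windows of independent points and exchangeability -/

section Exchangeability

open scoped Classical in
/-- Fewer than `K` of the points `Z` lie between `x` and `Z p`. -/
def IsNear {ι : Type*} [Fintype ι] (K : ℕ) (Z : ι → ℝ) (x : ℝ) (p : ι) : Prop :=
  (Finset.univ.filter fun r => Z r ∈ uIcc x (Z p)).card < K

variable {ι : Type*} [Fintype ι]

lemma isNear_comp_perm (K : ℕ) (Z : ι → ℝ) (x : ℝ) (p : ι) (σ : Equiv.Perm ι) :
    IsNear K (fun r => Z (σ r)) x p ↔ IsNear K Z x (σ p) := by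
  classical
  unfold IsNear
  have : (Finset.univ.filter fun r => Z r ∈ uIcc x (Z (σ p))) =
      (Finset.univ.filter fun r => Z (σ r) ∈ uIcc x (Z (σ p))).map σ.toEmbedding := by
    ext r
    simp only [Finset.mem_filter, Finset.mem_univ, true_and, Finset.mem_map_equiv,
      Equiv.apply_symm_apply]
  rw [this, Finset.card_map]

-- On either side of `x`, all near points lie between `x` and the farthest near point of that side,
-- so there are fewer than `K` of them if there are any.
open scoped Classical in
lemma card_isNear_le (K : ℕ) (Z : ι → ℝ) (x : ℝ) :
    (Finset.univ.filter fun p => IsNear K Z x p).card ≤ 2 * K := by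
  have h1 : (Finset.univ.filter fun p => IsNear K Z x p ∧ x ≤ Z p).card ≤ K := by
    rcases (Finset.univ.filter fun p => IsNear K Z x p ∧ x ≤ Z p).eq_empty_or_nonempty with h | h
    · simp [h]
    · obtain ⟨q, hq, hmax⟩ := Finset.exists_max_image _ Z h
      have hq' := (Finset.mem_filter.1 hq).2
      refine le_trans (Finset.card_le_card fun p hp => ?_) hq'.1.le
      have hp' := (Finset.mem_filter.1 hp).2
      simp only [Finset.mem_filter, Finset.mem_univ, true_and]
      exact mem_uIcc_of_le hp'.2 (hmax p hp)
  have h2 : (Finset.univ.filter fun p => IsNear K Z x p ∧ Z p ≤ x).card ≤ K := by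
    rcases (Finset.univ.filter fun p => IsNear K Z x p ∧ Z p ≤ x).eq_empty_or_nonempty with h | h
    · simp [h]
    · obtain ⟨q, hq, hmin⟩ := Finset.exists_min_image _ Z h
      have hq' := (Finset.mem_filter.1 hq).2
      refine le_trans (Finset.card_le_card fun p hp => ?_) hq'.1.le
      have hp' := (Finset.mem_filter.1 hp).2
      simp only [Finset.mem_filter, Finset.mem_univ, true_and]
      exact mem_uIcc_of_ge (hmin p hp) hp'.2
  calc _ ≤ ((Finset.univ.filter fun p => IsNear K Z x p ∧ x ≤ Z p) ∪
        (Finset.univ.filter fun p => IsNear K Z x p ∧ Z p ≤ x)).card := by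
        refine Finset.card_le_card fun p hp => ?_
        have hp' := (Finset.mem_filter.1 hp).2
        rcases le_total x (Z p) with h | h <;> simp [hp', h]
    _ ≤ _ := Finset.card_union_le _ _
    _ ≤ _ := by omega

lemma measurableSet_isNear (K : ℕ) (p : ι) :
    MeasurableSet {q : (ι → ℝ) × ℝ | IsNear K q.1 q.2 p} := by
  classical
  have : Measurable fun q : (ι → ℝ) × ℝ =>
      (Finset.univ.filter fun r => q.1 r ∈ uIcc q.2 (q.1 p)).card := by
    simp_rw [Finset.card_filter]
    refine Finset.measurable_sum _ fun r _ => Measurable.ite ?_ measurable_const measurable_const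
    have h : {q : (ι → ℝ) × ℝ | q.1 r ∈ uIcc q.2 (q.1 p)} =
      {q | q.2 ⊓ q.1 p ≤ q.1 r} ∩ {q | q.1 r ≤ q.2 ⊔ q.1 p} := by
      ext q; simp [uIcc, Set.mem_Icc]
    rw [h]
    exact (measurableSet_le (by fun_prop) (by fun_prop)).inter
      (measurableSet_le (by fun_prop) (by fun_prop))
  exact this (measurableSet_Iio (a := K))

lemma measurableSet_isNear_left (K : ℕ) (x : ℝ) (p : ι) :
    MeasurableSet {Z : ι → ℝ | IsNear K Z x p} :=
  (measurableSet_isNear K p).preimage (f := fun Z : ι → ℝ => (Z, x)) (by fun_prop)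

lemma measurableSet_isNear_pair (K : ℕ) (q p : ι) :
    MeasurableSet {Z : ι → ℝ | IsNear K Z (Z q) p} :=
  (measurableSet_isNear K p).preimage (f := fun Z : ι → ℝ => (Z, Z q)) (by fun_prop)

variable (μ₀ : Measure ℝ) [IsProbabilityMeasure μ₀]

lemma lintegral_comp_perm (σ : Equiv.Perm ι) (f : (ι → ℝ) → ℝ≥0∞) :
    ∫⁻ Z, f (fun r => Z (σ r)) ∂(Measure.pi fun _ : ι => μ₀) =
      ∫⁻ Z, f Z ∂(Measure.pi fun _ : ι => μ₀) := by
  have h := measurePreserving_arrowCongr' (fun _ : ι => μ₀) (fun _ : ι => μ₀) σ.symm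
    (MeasurableEquiv.refl ℝ) (fun _ => MeasurePreserving.id _)
  exact h.lintegral_comp_emb (MeasurableEquiv.measurableEmbedding _) f

/-- Exchangeability: an integral for one tuple of distinct points is bounded by the average. -/
lemma card_embedding_mul_lintegral_le {m : ℕ} (f : (ι → ℝ) → (Fin m → ι) → ℝ≥0∞)
    (hf : ∀ t, Measurable fun Z => f Z t)
    (hperm : ∀ (σ : Equiv.Perm ι) Z t, f (fun r => Z (σ r)) t = f Z (fun a => σ (t a)))
    (g : (ι → ℝ) → ℝ≥0∞) (hg : ∀ Z, ∑ t : Fin m → ι, f Z t ≤ g Z)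
    {t : Fin m → ι} (ht : Function.Injective t) :
    (Fintype.card ι).descFactorial m * ∫⁻ Z, f Z t ∂(Measure.pi fun _ : ι => μ₀) ≤
      ∫⁻ Z, g Z ∂(Measure.pi fun _ : ι => μ₀) := by
  classical
  -- A permutation moves any injective tuple to any other and preserves the product law, so all
  -- injective tuples have the same integral.
  have h1 : ∀ t' : Fin m ↪ ι, ∫⁻ Z, f Z t' ∂(Measure.pi fun _ : ι => μ₀) =
      ∫⁻ Z, f Z t ∂(Measure.pi fun _ : ι => μ₀) := by
    intro t'
    obtain ⟨σ, hσ⟩ := Equiv.Perm.exists_extending_pair t t' ht t'.injective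
    rw [← lintegral_comp_perm μ₀ σ (fun Z => f Z t)]
    refine lintegral_congr fun Z => ?_
    rw [hperm]
    congr 1
    funext a
    exact (hσ a).symm
  have h2 : ∑ t' : Fin m ↪ ι, ∫⁻ Z, f Z t' ∂(Measure.pi fun _ : ι => μ₀) =
      (Fintype.card ι).descFactorial m * ∫⁻ Z, f Z t ∂(Measure.pi fun _ : ι => μ₀) := by
    simp_rw [h1]
    rw [Finset.sum_const, Finset.card_univ, Fintype.card_embedding_eq, Fintype.card_fin,
      nsmul_eq_mul]
  rw [← h2, ← lintegral_finsetSum Finset.univ (f := fun (t' : Fin m ↪ ι) Z => f Z t')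
    fun t' _ => hf t']
  refine lintegral_mono fun Z => le_trans ?_ (hg Z)
  let c : (Fin m ↪ ι) ↪ (Fin m → ι) := ⟨fun e a => e a, DFunLike.coe_injective⟩
  calc ∑ t' : Fin m ↪ ι, f Z t' = ∑ t' ∈ (Finset.univ : Finset (Fin m ↪ ι)).map c, f Z t' :=
        (Finset.sum_map Finset.univ c (fun t' => f Z t')).symm
    _ ≤ _ := Finset.sum_le_sum_of_subset (Finset.subset_univ _)

lemma sum_fin_four {β : Type*} [AddCommMonoid β] (F : ι → ι → ι → ι → β) :
    ∑ t : Fin 4 → ι, F (t 0) (t 1) (t 2) (t 3) = ∑ a, ∑ b, ∑ c, ∑ d, F a b c d := by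
  rw [← (Fin.consEquiv fun _ : Fin 4 => ι).sum_comp, Fintype.sum_prod_type]
  refine Finset.sum_congr rfl fun a _ => ?_
  rw [← (Fin.consEquiv fun _ : Fin 3 => ι).sum_comp, Fintype.sum_prod_type]
  refine Finset.sum_congr rfl fun b _ => ?_
  rw [← (finTwoArrowEquiv ι).symm.sum_comp, Fintype.sum_prod_type]
  rfl

-- For fixed points, at most N(2K)³ quadruples satisfy the three relations: `q` is free and each
-- other entry has at most 2K choices. Averaging over N(N-1)(N-2)(N-3) ≥ N⁴/64 injective quadruples
-- gives the constant 64·8 = 512.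
open scoped Classical in
lemma lintegral_isNear_quadruple_le (hN : 4 ≤ Fintype.card ι) (K : ℕ) (x : ℝ) {p p' q q' : ι}
    (ht : Function.Injective ![p, p', q, q']) :
    (Fintype.card ι : ℝ≥0∞) ^ 3 * ∫⁻ Z, (if IsNear K Z x p ∧ IsNear K Z x p' ∧
      IsNear K Z (Z q) q' then 1 else 0) ∂(Measure.pi fun _ : ι => μ₀) ≤ 512 * (K : ℝ≥0∞) ^ 3 := by
  set N := Fintype.card ι
  have key := card_embedding_mul_lintegral_le μ₀ (m := 4)
    (fun Z t => if IsNear K Z x (t 0) ∧ IsNear K Z x (t 1) ∧ IsNear K Z (Z (t 2)) (t 3)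
      then 1 else 0)
    (fun t => Measurable.ite ((measurableSet_isNear_left K x _).inter
      ((measurableSet_isNear_left K x _).inter (measurableSet_isNear_pair K _ _)))
      measurable_const measurable_const)
    (fun σ Z t => by
      have := isNear_comp_perm K Z x (t 0) σ
      have := isNear_comp_perm K Z x (t 1) σ
      have := isNear_comp_perm K Z (Z (σ (t 2))) (t 3) σ
      simp only [*])
    (fun _ => N * (2 * K) ^ 3) (fun Z => by
      have h1 : ∀ y : ℝ, ∑ p : ι, (if IsNear K Z y p then (1 : ℝ≥0∞) else 0) ≤ 2 * K := by
        intro y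
        rw [Finset.sum_boole]
        exact_mod_cast card_isNear_le K Z y
      have h2 : ∀ t : Fin 4 → ι, (if IsNear K Z x (t 0) ∧ IsNear K Z x (t 1) ∧
          IsNear K Z (Z (t 2)) (t 3) then (1 : ℝ≥0∞) else 0) =
          (if IsNear K Z x (t 0) then 1 else 0) * ((if IsNear K Z x (t 1) then 1 else 0) *
            (if IsNear K Z (Z (t 2)) (t 3) then 1 else 0)) := by
        intro t
        split_ifs <;> simp_all
      simp_rw [h2]
      rw [sum_fin_four fun a b c d => (if IsNear K Z x a then (1 : ℝ≥0∞) else 0) *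
        ((if IsNear K Z x b then 1 else 0) * (if IsNear K Z (Z c) d then 1 else 0))]
      simp only [← Finset.mul_sum, ← Finset.sum_mul]
      calc _ ≤ (2 * K) * ((2 * K) * ∑ _ : ι, (2 * K : ℝ≥0∞)) := by
            gcongr
            · exact h1 x
            · exact h1 x
            · exact h1 _
        _ = _ := by
          rw [Finset.sum_const, Finset.card_univ, nsmul_eq_mul]; ring) ht
  rw [lintegral_const, measure_univ, mul_one] at key
  simp only [Matrix.cons_val_zero, Matrix.cons_val_one, Matrix.cons_val] at key
  set A := ∫⁻ Z, (if IsNear K Z x p ∧ IsNear K Z x p' ∧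
      IsNear K Z (Z q) q' then 1 else 0) ∂(Measure.pi fun _ : ι => μ₀)
  have hd : N ^ 4 ≤ 64 * N.descFactorial 4 := by
    simp only [Nat.descFactorial_succ, Nat.descFactorial_zero, mul_one, Nat.sub_zero]
    calc N ^ 4 = N * N * N * N := by ring
      _ ≤ (4 * (N - 3)) * (4 * (N - 2)) * (4 * (N - 1)) * N := by
        gcongr <;> omega
      _ = _ := by ring
  have hN0 : (N : ℝ≥0∞) ≠ 0 := by
    simp only [ne_eq, Nat.cast_eq_zero]; omega
  refine (ENNReal.mul_le_mul_iff_right hN0 (ENNReal.natCast_ne_top N)).1 ?_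
  calc (N : ℝ≥0∞) * (N ^ 3 * A) = ((N ^ 4 : ℕ) : ℝ≥0∞) * A := by push_cast; ring
    _ ≤ ((64 * N.descFactorial 4 : ℕ) : ℝ≥0∞) * A := by gcongr
    _ = 64 * (N.descFactorial 4 * A) := by push_cast; ring
    _ ≤ 64 * (N * (2 * K) ^ 3) := mul_le_mul' le_rfl key
    _ = _ := by ring

-- Same averaging for pairs: at most 2K choices of `p`, and the expected number of choices of `q` is
-- N times the mass of `U`.
open scoped Classical in
lemma lintegral_isNear_mem_le (hN : 2 ≤ Fintype.card ι) (K : ℕ) (x : ℝ) {U : Set ℝ}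
    (hU : MeasurableSet U) {p q : ι} (hpq : p ≠ q) :
    (Fintype.card ι : ℝ≥0∞) * ∫⁻ Z, (if IsNear K Z x p ∧ Z q ∈ U then 1 else 0)
      ∂(Measure.pi fun _ : ι => μ₀) ≤ 4 * K * μ₀ U := by
  set N := Fintype.card ι
  have hmem : ∀ q : ι, MeasurableSet {Z : ι → ℝ | Z q ∈ U} := fun q => measurable_pi_apply q hU
  have ht : Function.Injective ![p, q] := by
    intro a b
    fin_cases a <;> fin_cases b <;> simp [hpq, hpq.symm]
  have key := card_embedding_mul_lintegral_le μ₀ (m := 2)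
    (fun Z t => if IsNear K Z x (t 0) ∧ Z (t 1) ∈ U then 1 else 0)
    (fun t => Measurable.ite ((measurableSet_isNear_left K x _).inter (hmem _))
      measurable_const measurable_const)
    (fun σ Z t => by
      have := isNear_comp_perm K Z x (t 0) σ
      simp only [*])
    (fun Z => 2 * K * ∑ q, (if Z q ∈ U then 1 else 0)) (fun Z => by
      have h1 : ∀ y : ℝ, ∑ p : ι, (if IsNear K Z y p then (1 : ℝ≥0∞) else 0) ≤ 2 * K := by
        intro y
        rw [Finset.sum_boole]
        exact_mod_cast card_isNear_le K Z y
      have h2 : ∀ t : Fin 2 → ι, (if IsNear K Z x (t 0) ∧ Z (t 1) ∈ U then (1 : ℝ≥0∞) else 0) =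
          (if IsNear K Z x (t 0) then 1 else 0) * (if Z (t 1) ∈ U then 1 else 0) := by
        intro t
        split_ifs <;> simp_all
      simp_rw [h2]
      rw [← (finTwoArrowEquiv ι).symm.sum_comp, Fintype.sum_prod_type]
      simp only [finTwoArrowEquiv_symm_apply, Matrix.cons_val_zero, Matrix.cons_val_one,
        ← Finset.mul_sum, ← Finset.sum_mul]
      gcongr
      exact h1 x) ht
  have hsum : ∫⁻ Z, (2 * K * ∑ q, (if Z q ∈ U then 1 else 0)) ∂(Measure.pi fun _ : ι => μ₀) =
      2 * K * (N * μ₀ U) := by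
    rw [lintegral_const_mul _ (Finset.measurable_sum _ fun q _ =>
      Measurable.ite (hmem q) measurable_const measurable_const),
      lintegral_finsetSum _ fun q _ => Measurable.ite (hmem q) measurable_const measurable_const]
    congr 1
    have : ∀ q : ι, ∫⁻ Z, (if Z q ∈ U then 1 else 0) ∂(Measure.pi fun _ : ι => μ₀) = μ₀ U := by
      intro q
      have h := (measurePreserving_eval (fun _ : ι => μ₀) q).lintegral_comp
        (f := fun z => if z ∈ U then (1 : ℝ≥0∞) else 0)
        (Measurable.ite hU measurable_const measurable_const)
      refine h.trans ?_
      have : (fun z => if z ∈ U then (1 : ℝ≥0∞) else 0) = U.indicator 1 := by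
        funext z; simp [indicator]
      rw [this, lintegral_indicator_one hU]
    simp_rw [this]
    rw [Finset.sum_const, Finset.card_univ, nsmul_eq_mul]
  rw [hsum] at key
  simp only [Matrix.cons_val_zero, Matrix.cons_val_one] at key
  set A := ∫⁻ Z, (if IsNear K Z x p ∧ Z q ∈ U then 1 else 0) ∂(Measure.pi fun _ : ι => μ₀)
  have hd : N ^ 2 ≤ 2 * N.descFactorial 2 := by
    simp only [Nat.descFactorial_succ, Nat.descFactorial_zero, mul_one, Nat.sub_zero]
    calc N ^ 2 = N * N := by ring
      _ ≤ (2 * (N - 1)) * N := by gcongr; omega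
      _ = _ := by ring
  have hN0 : (N : ℝ≥0∞) ≠ 0 := by
    simp only [ne_eq, Nat.cast_eq_zero]; omega
  refine (ENNReal.mul_le_mul_iff_right hN0 (ENNReal.natCast_ne_top N)).1 ?_
  calc (N : ℝ≥0∞) * (N * A) = ((N ^ 2 : ℕ) : ℝ≥0∞) * A := by push_cast; ring
    _ ≤ ((2 * N.descFactorial 2 : ℕ) : ℝ≥0∞) * A := by gcongr
    _ = 2 * (N.descFactorial 2 * A) := by push_cast; ring
    _ ≤ 2 * (2 * K * (N * μ₀ U)) := mul_le_mul' le_rfl key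
    _ = _ := by ring

open scoped Classical in
/-- Chebyshev's inequality for the number of points in a set. -/
lemma measure_card_lt_le {I : Set ℝ} (hI : MeasurableSet I) (K : ℕ)
    (hpos : 0 < μ₀.real I) (hN : 0 < Fintype.card ι)
    (hK : 2 * K ≤ Fintype.card ι * μ₀.real I) :
    (Measure.pi fun _ : ι => μ₀) {Z | (Finset.univ.filter fun r => Z r ∈ I).card < K} ≤
      ENNReal.ofReal (4 / (Fintype.card ι * μ₀.real I)) := by
  set N := Fintype.card ι
  set ε := μ₀.real I
  set P := Measure.pi fun _ : ι => μ₀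
  set F : ℝ → ℝ := I.indicator 1 with hF
  have hN' : (0 : ℝ) < N := by exact_mod_cast hN
  have hFm : MemLp F 2 μ₀ := (memLp_indicator_const 2 hI (1 : ℝ) (Or.inr (measure_ne_top _ _)))
  set S : (ι → ℝ) → ℝ := ∑ i, fun Z => F (Z i) with hS
  have hvar : Var[S; P] = ∑ _i : ι, Var[F; μ₀] := variance_sum_pi (fun _ => hFm)
  have hmem : ∀ i : ι, MemLp (fun Z : ι → ℝ => F (Z i)) 2 P := fun i =>
    hFm.comp_measurePreserving (measurePreserving_eval (fun _ : ι => μ₀) i)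
  have hSm : MemLp S 2 P := memLp_finsetSum' _ fun i _ => hmem i
  have hFint : ∫ z, F z ∂μ₀ = ε := by rw [hF, integral_indicator_one hI]
  have hmean : ∫ Z, S Z ∂P = N * ε := by
    simp only [hS, Finset.sum_apply]
    rw [integral_finsetSum _ fun i _ => (hmem i).integrable (by norm_num)]
    have : ∀ i : ι, ∫ Z, F (Z i) ∂P = ε := by
      intro i
      rw [← hFint]
      exact integral_comp_eval (μ := fun _ : ι => μ₀) (i := i) hFm.aestronglyMeasurable
    simp_rw [this]
    rw [Finset.sum_const, Finset.card_univ, nsmul_eq_mul]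
  have hvF : Var[F; μ₀] ≤ ε := by
    refine (variance_le_expectation_sq hFm.aestronglyMeasurable).trans_eq ?_
    rw [← hFint]
    refine integral_congr_ae (ae_of_all _ fun z => ?_)
    simp only [hF, indicator, Pi.pow_apply, Pi.one_apply]
    split_ifs <;> norm_num
  -- By `hK`, fewer than `K` points means a deviation from the mean Nε by at least half of it.
  have hc : 0 < N * ε / 2 := by positivity
  have hch := meas_ge_le_variance_div_sq hSm hc
  refine (measure_mono fun Z hZ => ?_).trans (hch.trans (ENNReal.ofReal_le_ofReal ?_))
  · simp only [mem_ofPred_eq] at hZ ⊢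
    have h1 : S Z = ((Finset.univ.filter fun r => Z r ∈ I).card : ℝ) := by
      simp only [hS, Finset.sum_apply, hF, indicator, Pi.one_apply, Finset.sum_boole]
    have h2 : S Z < K := by rw [h1]; exact_mod_cast hZ
    rw [hmean, abs_sub_comm]
    refine le_trans ?_ (le_abs_self _)
    linarith
  · rw [hvar, Finset.sum_const, Finset.card_univ, nsmul_eq_mul]
    rw [div_le_div_iff₀ (by positivity) (by positivity)]
    calc N * Var[F; μ₀] * (N * ε) ≤ N * ε * (N * ε) := by gcongr
      _ = 4 * (N * ε / 2) ^ 2 := by ring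

end Exchangeability

/-! ### Leaf counts dominated by counts in rank windows -/

section LeafWindows

variable {s n : ℕ}

/-- All observations of `s` clusters, as one family. -/
def flatten (X : Fin s → Fin n → ℝ) (p : Fin s × Fin n) : ℝ := X p.1 p.2

open scoped Classical in
/-- The number of pairs of sibling pairs from different clusters that start near `x` and end near
each other. -/
def quadCount (K : ℕ) (X : Fin s → Fin n → ℝ) (x : ℝ) : ℕ :=
  (Finset.univ.filter fun e : (Fin s × Fin n × Fin n) × (Fin s × Fin n × Fin n) =>
    (e.1.1 ≠ e.2.1 ∧ e.1.2.1 ≠ e.1.2.2 ∧ e.2.2.1 ≠ e.2.2.2) ∧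
    IsNear K (flatten X) x (e.1.1, e.1.2.1) ∧ IsNear K (flatten X) x (e.2.1, e.2.2.1) ∧
    IsNear K (flatten X) (flatten X (e.1.1, e.1.2.2)) (e.2.1, e.2.2.2)).card

open scoped Classical in
/-- The number of sibling pairs that start near `x` and end in `U`. -/
def pairCount (K : ℕ) (U : Set ℝ) (X : Fin s → Fin n → ℝ) (x : ℝ) : ℕ :=
  (Finset.univ.filter fun e : Fin s × Fin n × Fin n =>
    e.2.1 ≠ e.2.2 ∧ IsNear K (flatten X) x (e.1, e.2.1) ∧ flatten X (e.1, e.2.2) ∈ U).card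

/-- Some observation near `x` in rank is at distance at least `ε` from `x`. -/
def Escapes (K : ℕ) (ε : ℝ) (X : Fin s → Fin n → ℝ) (x : ℝ) : Prop :=
  ∃ p, IsNear K (flatten X) x p ∧ ε ≤ |flatten X p - x|

variable {k M : ℕ} {X : Fin s → Fin n → ℝ} {L : Fin s → Fin n → ℕ} {lab : ℝ → ℕ} {x : ℝ}
  {sg : Fin s → Fin n → ℝ}

/-- By monotonicity every observation between y and X i j has their common label, and a label occurs
fewer than 2k times. This window no longer refers to the tree, which may depend on all evaluation
covariates. -/
lemma LabelRegular.isNear (hL : LabelRegular k M L) (hlab : Monotone lab)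
    (hX : ∀ i j, L i j = lab (X i j)) {y : ℝ} {i : Fin s} {j : Fin n} (h : L i j = lab y) :
    IsNear (2 * k) (flatten X) y (i, j) := by
  classical
  have h1 := hL.size_lt (L i j) (hL.lt i j)
  have h2 : leafSize L (L i j) =
      ((Finset.univ.filter fun p : Fin s × Fin n => L p.1 p.2 = L i j).card : ℝ) := by
    rw [leafSize, ← Finset.sum_boole, Fintype.sum_prod_type]; rfl
  rw [h2] at h1
  have h3 : (Finset.univ.filter fun p : Fin s × Fin n => L p.1 p.2 = L i j).card < 2 * k := by
    exact_mod_cast h1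
  refine lt_of_le_of_lt (Finset.card_le_card fun p hp => ?_) h3
  have hp' := (Finset.mem_filter.1 hp).2
  simp only [Finset.mem_filter, Finset.mem_univ, true_and]
  have hp1 : min y (X i j) ≤ X p.1 p.2 := hp'.1
  have hp2 : X p.1 p.2 ≤ max y (X i j) := hp'.2
  have e1 := hlab hp1
  have e2 := hlab hp2
  rw [hlab.map_min, ← hX, ← h, min_self, ← hX] at e1
  rw [hlab.map_max, ← h, ← hX i j, max_self, ← hX] at e2
  exact le_antisymm e2 e1

/-- The squares count pairs of sibling pairs which both start in the leaf of `x` and end in one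
common leaf. Two pairs from the same cluster contribute at most n³ per observation-sized unit of the
leaf, here 2kn³ altogether; pairs from different clusters satisfy the rank relations of `quadCount`.
-/
lemma LabelRegular.sum_siblingCount_sq_le (hL : LabelRegular k M L) (hlab : Monotone lab)
    (hX : ∀ i j, L i j = lab (X i j)) (hx : lab x < M) :
    ∑ m ∈ Finset.range M, siblingCount L (lab x) m ^ 2 ≤
      2 * k * n ^ 3 + quadCount (2 * k) X x := by
  classical
  set l := lab x with hl
  set F : Fin s × Fin n × Fin n → ℕ → ℝ := fun e m =>
    if e.2.2 ≠ e.2.1 then leafInd L l e.1 e.2.1 * leafInd L m e.1 e.2.2 else 0 with hF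
  have h1 : ∀ m, siblingCount L l m = ∑ e : Fin s × Fin n × Fin n, F e m := by
    intro m
    rw [siblingCount, Fintype.sum_prod_type]
    exact Finset.sum_congr rfl fun i _ => (Fintype.sum_prod_type (fun y => F (i, y) m)).symm
  have h2 : ∑ m ∈ Finset.range M, siblingCount L l m ^ 2 =
      ∑ e : Fin s × Fin n × Fin n, ∑ e' : Fin s × Fin n × Fin n, ∑ m ∈ Finset.range M, F e m * F e' m := by
    simp_rw [h1, sq, Finset.sum_mul_sum]
    rw [Finset.sum_comm]
    exact Finset.sum_congr rfl fun e _ => Finset.sum_comm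
  set G : Fin s × Fin n × Fin n → Fin s × Fin n × Fin n → ℝ := fun e e' => if ((e.1 ≠ e'.1 ∧ e.2.1 ≠ e.2.2 ∧ e'.2.1 ≠ e'.2.2) ∧
    IsNear (2 * k) (flatten X) x (e.1, e.2.1) ∧ IsNear (2 * k) (flatten X) x (e'.1, e'.2.1) ∧
    IsNear (2 * k) (flatten X) (flatten X (e.1, e.2.2)) (e'.1, e'.2.2)) then 1 else 0 with hG
  have h3 : ∀ e e' : Fin s × Fin n × Fin n, ∑ m ∈ Finset.range M, F e m * F e' m ≤
      (if e.1 = e'.1 then leafInd L l e.1 e.2.1 else 0) + G e e' := by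
    intro e e'
    have hG0 : 0 ≤ G e e' := by simp only [hG]; split_ifs <;> norm_num
    have hI0 := leafInd_nonneg L l e.1 e.2.1
    have hR : 0 ≤ (if e.1 = e'.1 then leafInd L l e.1 e.2.1 else 0) + G e e' := by
      refine add_nonneg ?_ hG0
      split_ifs
      exacts [hI0, le_rfl]
    by_cases hne : e.2.2 ≠ e.2.1
    swap
    · simp only [hF, if_neg hne, zero_mul, Finset.sum_const_zero]; exact hR
    by_cases hne' : e'.2.2 ≠ e'.2.1
    swap
    · simp only [hF, if_neg hne', mul_zero, Finset.sum_const_zero]; exact hR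
    have e1 : ∑ m ∈ Finset.range M, F e m * F e' m =
        leafInd L l e.1 e.2.1 * leafInd L l e'.1 e'.2.1 * leafInd L (L e'.1 e'.2.2) e.1 e.2.2 := by
      simp only [hF, if_pos hne, if_pos hne']
      have := hL.sum_mul_leafInd (fun m => leafInd L m e.1 e.2.2) e'.1 e'.2.2
      rw [← this, Finset.mul_sum]
      exact Finset.sum_congr rfl fun m _ => by ring
    rw [e1]
    by_cases hc : e.1 = e'.1
    · rw [if_pos hc]
      have a1 := leafInd_le_one L l e'.1 e'.2.1
      have a2 := leafInd_nonneg L l e'.1 e'.2.1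
      have a3 := leafInd_le_one L (L e'.1 e'.2.2) e.1 e.2.2
      have a4 := leafInd_nonneg L (L e'.1 e'.2.2) e.1 e.2.2
      calc _ ≤ leafInd L l e.1 e.2.1 * 1 * 1 := by gcongr
        _ ≤ _ := by linarith
    · rw [if_neg hc, zero_add]
      by_cases q1 : L e.1 e.2.1 = l
      swap
      · rw [leafInd, if_neg q1, zero_mul, zero_mul]; exact hG0
      by_cases q2 : L e'.1 e'.2.1 = l
      swap
      · rw [leafInd, leafInd, if_neg q2, mul_zero, zero_mul]; exact hG0
      by_cases q3 : L e.1 e.2.2 = L e'.1 e'.2.2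
      swap
      · rw [leafInd, leafInd, leafInd, if_neg q3, mul_zero]; exact hG0
      have : G e e' = 1 := by
        simp only [hG]
        rw [if_pos]
        -- The third relation centres a window at the end of the first pair, which shares its leaf
        -- with the end of the second.
        exact ⟨⟨hc, fun h => hne h.symm, fun h => hne' h.symm⟩, hL.isNear hlab hX q1,
          hL.isNear hlab hX q2, hL.isNear hlab hX (q3.symm.trans (hX _ _))⟩
      rw [this, leafInd, leafInd, leafInd, if_pos q1, if_pos q2, if_pos q3]
      norm_num
  rw [h2]
  calc _ ≤ ∑ e : Fin s × Fin n × Fin n, ∑ e' : Fin s × Fin n × Fin n, ((if e.1 = e'.1 then leafInd L l e.1 e.2.1 else 0) + G e e') :=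
        Finset.sum_le_sum fun e _ => Finset.sum_le_sum fun e' _ => h3 e e'
    _ = ∑ e : Fin s × Fin n × Fin n, ∑ e' : Fin s × Fin n × Fin n, (if e.1 = e'.1 then leafInd L l e.1 e.2.1 else 0) +
        ∑ e : Fin s × Fin n × Fin n, ∑ e' : Fin s × Fin n × Fin n, G e e' := by simp_rw [Finset.sum_add_distrib]
    _ ≤ _ := by
      refine add_le_add ?_ (le_of_eq ?_)
      · have : ∀ e : Fin s × Fin n × Fin n, ∑ e' : Fin s × Fin n × Fin n, (if e.1 = e'.1 then leafInd L l e.1 e.2.1 else 0) =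
            n ^ 2 * leafInd L l e.1 e.2.1 := by
          intro e
          calc _ = ∑ i, ∑ _q : Fin n × Fin n, (if e.1 = i then leafInd L l e.1 e.2.1 else 0) :=
                Fintype.sum_prod_type _
            _ = _ := by simp [sq]
        simp_rw [this, ← Finset.mul_sum]
        have h5 : ∑ e : Fin s × Fin n × Fin n, leafInd L l e.1 e.2.1 = n * leafSize L l := by
          rw [Fintype.sum_prod_type, leafSize, Finset.mul_sum]
          refine Finset.sum_congr rfl fun i _ => ?_
          rw [Fintype.sum_prod_type, Finset.mul_sum]
          simp
        rw [h5]
        have := (hL.size_lt l hx).le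
        have h6 : (n : ℝ) ^ 3 * leafSize L l ≤ (n : ℝ) ^ 3 * (2 * k) := by gcongr
        linear_combination h6
      · rw [quadCount, ← Finset.sum_boole]
        exact (Fintype.sum_prod_type (fun q : (Fin s × Fin n × Fin n) × (Fin s × Fin n × Fin n) =>
          G q.1 q.2)).symm

lemma LabelRegular.siblingDefect_le (hL : LabelRegular k M L) (hlab : Monotone lab)
    (hX : ∀ i j, L i j = lab (X i j)) (hx : lab x < M) (hk : 0 < k) :
    siblingDefect k M L (lab x) ≤ 2 * n ^ 3 / k + quadCount (2 * k) X x / k ^ 2 := by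
  have hk' : (0 : ℝ) < k := by exact_mod_cast hk
  have := hL.sum_siblingCount_sq_le hlab hX hx
  rw [siblingDefect, div_le_iff₀ (by positivity)]
  refine this.trans (le_of_eq ?_)
  field_simp

/-- A cluster has at most `n` siblings in the leaf, so the square costs a factor `n`. Read from the
other end, each such sibling starts a pair near `x` that ends in `U`. -/
lemma LabelRegular.siblingSpill_le (hL : LabelRegular k M L) (hlab : Monotone lab)
    (hX : ∀ i j, L i j = lab (X i j)) (hx : lab x < M) (hk : 0 < k) {U : Set ℝ}
    (hsg : ∀ i j, sg i j ≠ 1 → X i j ∈ U) :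
    siblingSpill sg L (lab x) ≤ n / k * pairCount (2 * k) U X x := by
  classical
  have hk' : (0 : ℝ) < k := by exact_mod_cast hk
  have hkN := hL.le_size _ hx
  have hN : 0 < leafSize L (lab x) := by linarith
  set l := lab x with hl
  have h1 : ∑ i, ∑ j, (if sg i j = 1 then 0 else (clusterCount L l i - leafInd L l i j) ^ 2) ≤
      n * pairCount (2 * k) U X x := by
    rw [pairCount, ← Finset.sum_boole, Fintype.sum_prod_type, Finset.mul_sum]
    refine Finset.sum_le_sum fun i _ => ?_
    rw [Fintype.sum_prod_type, Finset.sum_comm, Finset.mul_sum]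
    refine Finset.sum_le_sum fun j _ => ?_
    split_ifs with hs
    · exact mul_nonneg (by positivity) (Finset.sum_nonneg fun _ _ => by split_ifs <;> norm_num)
    · have e1 := leafInd_le_clusterCount L l i j
      have e2 := clusterCount_le L l i
      have e3 := leafInd_nonneg L l i j
      calc (clusterCount L l i - leafInd L l i j) ^ 2 ≤
          n * (clusterCount L l i - leafInd L l i j) := by
            rw [sq]
            exact mul_le_mul_of_nonneg_right (by linarith) (by linarith)
        _ = n * ∑ j', if j' ≠ j then leafInd L l i j' else 0 := by
            congr 1
            have : ∀ j', (if j' ≠ j then leafInd L l i j' else 0) =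
              leafInd L l i j' - if j' = j then leafInd L l i j' else 0 := fun j' => by
                by_cases h : j' = j <;> simp [h]
            simp_rw [this, Finset.sum_sub_distrib]
            simp [clusterCount]
        _ ≤ _ := by
            gcongr with j'
            split_ifs with q1 q2 q2
            · exact leafInd_le_one _ _ _ _
            · have : L i j' ≠ l := fun h => q2 ⟨q1, hL.isNear hlab hX h, hsg i j hs⟩
              simp [leafInd, this]
            · norm_num
            · exact le_rfl
  rw [siblingSpill, div_le_iff₀ hN]
  refine h1.trans ?_
  have : (0 : ℝ) ≤ pairCount (2 * k) U X x := by positivity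
  calc (n : ℝ) * pairCount (2 * k) U X x = n / k * pairCount (2 * k) U X x * k := by field_simp
    _ ≤ _ := by gcongr

/-- A cluster count is the sibling count plus the indicator; then (u + v)² ≤ 2u² + 2v². -/
lemma spill_le (hN : 0 < leafSize L (lab x)) :
    spill sg L (lab x) ≤ 2 * siblingSpill sg L (lab x) +
      2 * ((∑ i, ∑ j, if sg i j = 1 then 0 else leafInd L (lab x) i j) / leafSize L (lab x)) := by
  rw [spill, siblingSpill, ← mul_add, ← add_div, ← mul_div_assoc, ← Finset.sum_add_distrib,
    Finset.mul_sum]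
  gcongr with i
  rw [← Finset.sum_add_distrib, Finset.mul_sum]
  refine Finset.sum_le_sum fun j _ => ?_
  split_ifs
  · simp
  · have := leafInd_mul_self L (lab x) i j
    nlinarith [sq_nonneg (clusterCount L (lab x) i - 2 * leafInd L (lab x) i j)]

/-- If no point of the rank window is ε-far from `x`, the leaf lies in the ε-ball around `x` and the
sum is empty. Otherwise the fraction is at most 1. -/
lemma LabelRegular.sum_ite_leafInd_div_le (hL : LabelRegular k M L) (hlab : Monotone lab)
    (hX : ∀ i j, L i j = lab (X i j)) (hN : 0 < leafSize L (lab x)) {ε c : ℝ}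
    (hsg : ∀ i j, |X i j - x| < ε → sg i j = c) [Decidable (Escapes (2 * k) ε X x)] :
    (∑ i, ∑ j, if sg i j = c then 0 else leafInd L (lab x) i j) / leafSize L (lab x) ≤
      if Escapes (2 * k) ε X x then 1 else 0 := by
  split_ifs with h
  · rw [div_le_one hN]
    refine Finset.sum_le_sum fun i _ => Finset.sum_le_sum fun j _ => ?_
    split_ifs
    exacts [leafInd_nonneg _ _ _ _, le_rfl]
  · have : ∑ i, ∑ j, (if sg i j = c then 0 else leafInd L (lab x) i j) = 0 := by
      refine Finset.sum_eq_zero fun i _ => Finset.sum_eq_zero fun j _ => ?_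
      split_ifs with hs
      · rfl
      · have h1 : ε ≤ |X i j - x| := by
          by_contra h2
          exact hs (hsg i j (not_le.1 h2))
        have : L i j ≠ lab x := fun h3 => h ⟨(i, j), hL.isNear hlab hX h3, h1⟩
        simp [leafInd, this]
    rw [this, zero_div]

end LeafWindows

/-! ### Expected window counts for uniform covariates -/

section Windows

variable {s n : ℕ}

/-- The uniform distribution on `[0,1]`. -/
def unif : Measure ℝ := volume.restrict (Icc 0 1)

instance : IsProbabilityMeasure unif := ⟨by simp [unif]⟩

/-- The law of `s` clusters of `n` independent uniform covariates. -/
def covariateLaw (s n : ℕ) : Measure (Fin s → Fin n → ℝ) :=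
  Measure.pi fun _ => Measure.pi fun _ => unif

instance : IsProbabilityMeasure (covariateLaw s n) := by unfold covariateLaw; infer_instance

lemma measurePreserving_flatten :
    MeasurePreserving (flatten : (Fin s → Fin n → ℝ) → Fin s × Fin n → ℝ) (covariateLaw s n)
      (Measure.pi fun _ => unif) where
  measurable := by unfold flatten; fun_prop
  map_eq := by
    have h := Measure.infinitePi_map_curry_symm (fun (_ : Fin s) (_ : Fin n) => unif)
    simp_rw [Measure.infinitePi_eq_pi] at h
    exact h

lemma measurable_quadCount (K : ℕ) :
    Measurable fun q : (Fin s → Fin n → ℝ) × ℝ => quadCount K q.1 q.2 := by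
  classical
  unfold quadCount
  simp_rw [Finset.card_filter]
  have hf : Measurable (flatten : (Fin s → Fin n → ℝ) → Fin s × Fin n → ℝ) :=
    measurePreserving_flatten.measurable
  refine Finset.measurable_sum _ fun e _ => Measurable.ite ?_ measurable_const measurable_const
  refine (MeasurableSet.const _).inter (MeasurableSet.inter ?_ (MeasurableSet.inter ?_ ?_))
  · exact (measurableSet_isNear K (e.1.1, e.1.2.1)).preimage
      (f := fun q : (Fin s → Fin n → ℝ) × ℝ => (flatten q.1, q.2)) (by fun_prop)
  · exact (measurableSet_isNear K (e.2.1, e.2.2.1)).preimage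
      (f := fun q : (Fin s → Fin n → ℝ) × ℝ => (flatten q.1, q.2)) (by fun_prop)
  · exact (measurableSet_isNear K (e.2.1, e.2.2.2)).preimage
      (f := fun q : (Fin s → Fin n → ℝ) × ℝ => (flatten q.1, flatten q.1 (e.1.1, e.1.2.2)))
      (by fun_prop)

lemma measurable_pairCount (K : ℕ) {U : Set ℝ} (hU : MeasurableSet U) :
    Measurable fun q : (Fin s → Fin n → ℝ) × ℝ => pairCount K U q.1 q.2 := by
  classical
  unfold pairCount
  simp_rw [Finset.card_filter]
  have hf : Measurable (flatten : (Fin s → Fin n → ℝ) → Fin s × Fin n → ℝ) :=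
    measurePreserving_flatten.measurable
  refine Finset.measurable_sum _ fun e _ => Measurable.ite ?_ measurable_const measurable_const
  refine (MeasurableSet.const _).inter (MeasurableSet.inter ?_ ?_)
  · exact (measurableSet_isNear K (e.1, e.2.1)).preimage
      (f := fun q : (Fin s → Fin n → ℝ) × ℝ => (flatten q.1, q.2)) (by fun_prop)
  · exact hU.preimage
      (f := fun q : (Fin s → Fin n → ℝ) × ℝ => flatten q.1 (e.1, e.2.2)) (by fun_prop)

lemma measurableSet_escapes (K : ℕ) (ε : ℝ) :
    MeasurableSet {q : (Fin s → Fin n → ℝ) × ℝ | Escapes K ε q.1 q.2} := by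
  have hf : Measurable (flatten : (Fin s → Fin n → ℝ) → Fin s × Fin n → ℝ) :=
    measurePreserving_flatten.measurable
  have : {q : (Fin s → Fin n → ℝ) × ℝ | Escapes K ε q.1 q.2} =
      ⋃ p, {q | IsNear K (flatten q.1) q.2 p} ∩ {q | ε ≤ |flatten q.1 p - q.2|} := by
    ext q; simp [Escapes]
  rw [this]
  refine MeasurableSet.iUnion fun p => MeasurableSet.inter ?_ ?_
  · exact (measurableSet_isNear K p).preimage
      (f := fun q : (Fin s → Fin n → ℝ) × ℝ => (flatten q.1, q.2)) (by fun_prop)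
  · exact measurableSet_le (by fun_prop) (by fun_prop)

/-- There are (s n²)² pairs of index pairs, each with probability at most 512 K³/(s n)³. -/
lemma lintegral_quadCount_le (hs : 2 ≤ s) (hn : 2 ≤ n) (K : ℕ) (x : ℝ) :
    ∫⁻ X, (quadCount K X x : ℝ≥0∞) ∂(covariateLaw s n) ≤
      ENNReal.ofReal (512 * K ^ 3 * n / s) := by
  classical
  set Q := covariateLaw s n
  have hcard : Fintype.card (Fin s × Fin n) = s * n := by simp
  have h4 : 4 ≤ Fintype.card (Fin s × Fin n) := by rw [hcard]; nlinarith
  have hN0 : ((s * n : ℕ) : ℝ≥0∞) ^ 3 ≠ 0 := by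
    simp only [ne_eq, pow_eq_zero_iff, OfNat.ofNat_ne_zero, not_false_eq_true, Nat.cast_eq_zero]
    intro h; rw [hcard, h] at h4; omega
  have hNt : ((s * n : ℕ) : ℝ≥0∞) ^ 3 ≠ ⊤ := ENNReal.pow_ne_top (ENNReal.natCast_ne_top _)
  have hq : ∀ X : Fin s → Fin n → ℝ, (quadCount K X x : ℝ≥0∞) =
      ∑ e : (Fin s × Fin n × Fin n) × (Fin s × Fin n × Fin n),
        if (e.1.1 ≠ e.2.1 ∧ e.1.2.1 ≠ e.1.2.2 ∧ e.2.2.1 ≠ e.2.2.2) ∧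
        IsNear K (flatten X) x (e.1.1, e.1.2.1) ∧ IsNear K (flatten X) x (e.2.1, e.2.2.1) ∧
        IsNear K (flatten X) (flatten X (e.1.1, e.1.2.2)) (e.2.1, e.2.2.2) then 1 else 0 := by
    intro X
    rw [quadCount, Finset.sum_boole]
  have hm : ∀ (p p' q q' : Fin s × Fin n), Measurable fun Z : Fin s × Fin n → ℝ =>
      if IsNear K Z x p ∧ IsNear K Z x p' ∧ IsNear K Z (Z q) q' then (1 : ℝ≥0∞) else 0 :=
    fun p p' q q' => Measurable.ite ((measurableSet_isNear_left K x _).inter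
      ((measurableSet_isNear_left K x _).inter (measurableSet_isNear_pair K _ _)))
      measurable_const measurable_const
  have hterm : ∀ e : (Fin s × Fin n × Fin n) × (Fin s × Fin n × Fin n),
      ((s * n : ℕ) : ℝ≥0∞) ^ 3 * ∫⁻ X, (if (e.1.1 ≠ e.2.1 ∧ e.1.2.1 ≠ e.1.2.2 ∧
        e.2.2.1 ≠ e.2.2.2) ∧
        IsNear K (flatten X) x (e.1.1, e.1.2.1) ∧ IsNear K (flatten X) x (e.2.1, e.2.2.1) ∧
        IsNear K (flatten X) (flatten X (e.1.1, e.1.2.2)) (e.2.1, e.2.2.2) then 1 else 0) ∂Q ≤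
        512 * (K : ℝ≥0∞) ^ 3 := by
    intro e
    by_cases he : e.1.1 ≠ e.2.1 ∧ e.1.2.1 ≠ e.1.2.2 ∧ e.2.2.1 ≠ e.2.2.2
    · simp only [he, ne_eq, not_false_eq_true, true_and, and_self]
      -- Distinct clusters and distinct positions within each pair make the four points different,
      -- as exchangeability requires.
      have hinj : Function.Injective ![(e.1.1, e.1.2.1), (e.2.1, e.2.2.1), (e.1.1, e.1.2.2),
          (e.2.1, e.2.2.2)] := by
        obtain ⟨h1, h2, h3⟩ := he
        intro a b
        fin_cases a <;> fin_cases b <;> simp [h1, h2, h3, h1.symm, h2.symm, h3.symm]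
      have := lintegral_isNear_quadruple_le unif h4 K x hinj
      rw [hcard, ← measurePreserving_flatten.lintegral_comp (hm _ _ _ _)] at this
      exact this
    · simp [he]
  have hms : ∀ e : (Fin s × Fin n × Fin n) × (Fin s × Fin n × Fin n), Measurable fun X =>
      (if (e.1.1 ≠ e.2.1 ∧ e.1.2.1 ≠ e.1.2.2 ∧
        e.2.2.1 ≠ e.2.2.2) ∧
        IsNear K (flatten X) x (e.1.1, e.1.2.1) ∧ IsNear K (flatten X) x (e.2.1, e.2.2.1) ∧
        IsNear K (flatten X) (flatten X (e.1.1, e.1.2.2)) (e.2.1, e.2.2.2) then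
          (1 : ℝ≥0∞) else 0) := by
    intro e
    by_cases he : e.1.1 ≠ e.2.1 ∧ e.1.2.1 ≠ e.1.2.2 ∧ e.2.2.1 ≠ e.2.2.2
    · simp only [he, ne_eq, not_false_eq_true, true_and, and_self]
      exact (hm _ _ _ _).comp measurePreserving_flatten.measurable
    · simp only [he, false_and, if_false]; exact measurable_const
  have hmul : ((s * n : ℕ) : ℝ≥0∞) ^ 3 * ∫⁻ X, (quadCount K X x : ℝ≥0∞) ∂Q ≤
      ((s * n ^ 2) ^ 2 : ℕ) * (512 * (K : ℝ≥0∞) ^ 3) := by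
    simp_rw [hq]
    rw [lintegral_finsetSum _ fun e _ => hms e, Finset.mul_sum]
    refine (Finset.sum_le_sum fun e _ => hterm e).trans (le_of_eq ?_)
    rw [Finset.sum_const, Finset.card_univ, nsmul_eq_mul]
    congr 2
    simp; ring
  have hs0 : (0 : ℝ) < s := by exact_mod_cast (by omega : 0 < s)
  have hn0 : (0 : ℝ) < n := by exact_mod_cast (by omega : 0 < n)
  refine (ENNReal.mul_le_mul_iff_right hN0 hNt).1 (hmul.trans (le_of_eq ?_))
  rw [← ENNReal.ofReal_natCast (s * n), ← ENNReal.ofReal_pow (by positivity),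
    ← ENNReal.ofReal_mul (by positivity), ← ENNReal.ofReal_natCast, ← ENNReal.ofReal_natCast K,
    ← ENNReal.ofReal_pow (by positivity), ← ENNReal.ofReal_ofNat, ← ENNReal.ofReal_mul (by norm_num),
    ← ENNReal.ofReal_mul (by positivity)]
  congr 1
  push_cast
  field_simp

/-- There are s n² index pairs, each with probability at most 4K/(s n) times the mass of `U`. -/
lemma lintegral_pairCount_le (hs : 1 ≤ s) (hn : 2 ≤ n) (K : ℕ) (x : ℝ) {U : Set ℝ}
    (hU : MeasurableSet U) :
    ∫⁻ X, (pairCount K U X x : ℝ≥0∞) ∂(covariateLaw s n) ≤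
      ENNReal.ofReal (4 * K * n * unif.real U) := by
  classical
  set Q := covariateLaw s n
  have hcard : Fintype.card (Fin s × Fin n) = s * n := by simp
  have h2 : 2 ≤ Fintype.card (Fin s × Fin n) := by rw [hcard]; nlinarith
  have hN0 : ((s * n : ℕ) : ℝ≥0∞) ≠ 0 := by
    simp only [ne_eq, Nat.cast_eq_zero]
    intro h; rw [hcard, h] at h2; omega
  have hq : ∀ X : Fin s → Fin n → ℝ, (pairCount K U X x : ℝ≥0∞) =
      ∑ e : Fin s × Fin n × Fin n, if e.2.1 ≠ e.2.2 ∧ IsNear K (flatten X) x (e.1, e.2.1) ∧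
        flatten X (e.1, e.2.2) ∈ U then 1 else 0 := by
    intro X
    rw [pairCount, Finset.sum_boole]
  have hm : ∀ (p q : Fin s × Fin n), Measurable fun Z : Fin s × Fin n → ℝ =>
      if IsNear K Z x p ∧ Z q ∈ U then (1 : ℝ≥0∞) else 0 :=
    fun p q => Measurable.ite ((measurableSet_isNear_left K x _).inter
      (measurable_pi_apply q hU)) measurable_const measurable_const
  have hterm : ∀ e : Fin s × Fin n × Fin n,
      ((s * n : ℕ) : ℝ≥0∞) * ∫⁻ X, (if e.2.1 ≠ e.2.2 ∧ IsNear K (flatten X) x (e.1, e.2.1) ∧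
        flatten X (e.1, e.2.2) ∈ U then 1 else 0) ∂Q ≤ 4 * K * unif U := by
    intro e
    by_cases he : e.2.1 ≠ e.2.2
    · simp only [he, ne_eq, not_false_eq_true, true_and]
      have hpq : ((e.1, e.2.1) : Fin s × Fin n) ≠ (e.1, e.2.2) := by simpa using he
      have := lintegral_isNear_mem_le unif h2 K x hU hpq
      rw [hcard, ← measurePreserving_flatten.lintegral_comp (hm _ _)] at this
      exact this
    · simp [he]
  have hms : ∀ e : Fin s × Fin n × Fin n, Measurable fun X : Fin s → Fin n → ℝ =>
      (if e.2.1 ≠ e.2.2 ∧ IsNear K (flatten X) x (e.1, e.2.1) ∧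
        flatten X (e.1, e.2.2) ∈ U then (1 : ℝ≥0∞) else 0) := by
    intro e
    by_cases he : e.2.1 ≠ e.2.2
    · simp only [he, ne_eq, not_false_eq_true, true_and]
      exact (hm _ _).comp measurePreserving_flatten.measurable
    · simp only [he, false_and, if_false]; exact measurable_const
  have hmul : ((s * n : ℕ) : ℝ≥0∞) * ∫⁻ X, (pairCount K U X x : ℝ≥0∞) ∂Q ≤
      (s * n ^ 2 : ℕ) * (4 * K * unif U) := by
    simp_rw [hq]
    rw [lintegral_finsetSum _ fun e _ => hms e, Finset.mul_sum]
    refine (Finset.sum_le_sum fun e _ => hterm e).trans (le_of_eq ?_)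
    rw [Finset.sum_const, Finset.card_univ, nsmul_eq_mul]
    congr 2
    simp [sq]
  refine (ENNReal.mul_le_mul_iff_right hN0 (ENNReal.natCast_ne_top _)).1
    (hmul.trans (le_of_eq ?_))
  rw [ENNReal.ofReal_mul (by positivity), measureReal_def, ENNReal.ofReal_toReal (measure_ne_top _ _),
    ENNReal.ofReal_mul (by positivity), ENNReal.ofReal_mul (by positivity), ENNReal.ofReal_natCast,
    ENNReal.ofReal_natCast, ENNReal.ofReal_ofNat]
  push_cast
  ring

lemma unif_real_Icc {a b : ℝ} (ha : 0 ≤ a) (hab : a ≤ b) (hb : b ≤ 1) :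
    unif.real (Icc a b) = b - a := by
  rw [unif, measureReal_restrict_apply measurableSet_Icc,
    inter_eq_self_of_subset_left (Icc_subset_Icc ha hb), Real.volume_real_Icc_of_le hab]

/-- A near point at distance ε or more on one side forces fewer than `K` points into the interval of
length ε on that side. This interval lies in [0,1] because the near point does. Chebyshev's
inequality on each side gives 4 + 4. -/
lemma covariateLaw_escapes_le (hs : 1 ≤ s) (hn : 1 ≤ n) (K : ℕ) {x ε : ℝ} (hx : x ∈ Icc (0 : ℝ) 1)
    (hε : 0 < ε) (hK : 2 * K ≤ s * n * ε) :
    covariateLaw s n {X | Escapes K ε X x} ≤ ENNReal.ofReal (8 / (s * n * ε)) := by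
  classical
  have hcard : (Fintype.card (Fin s × Fin n) : ℝ) = s * n := by simp
  have hcard0 : 0 < Fintype.card (Fin s × Fin n) := by simp; omega
  have hmp := measurePreserving_flatten (s := s) (n := n)
  have hsub : {X : Fin s → Fin n → ℝ | Escapes K ε X x} ⊆ flatten ⁻¹'
      ({Z | ∃ p, Z p ∉ Icc (0 : ℝ) 1} ∪
      ({Z | x + ε ≤ 1 ∧ (Finset.univ.filter fun r => Z r ∈ Icc x (x + ε)).card < K} ∪
       {Z | 0 ≤ x - ε ∧ (Finset.univ.filter fun r => Z r ∈ Icc (x - ε) x).card < K})) := by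
    rintro X ⟨p, hp, hpe⟩
    by_cases hZ : ∃ p, flatten X p ∉ Icc (0 : ℝ) 1
    · exact Or.inl hZ
    push Not at hZ
    right
    rcases le_abs.1 hpe with h | h
    · left
      refine ⟨by linarith [(hZ p).2], lt_of_le_of_lt (Finset.card_le_card fun r hr => ?_) hp⟩
      have hr' := (Finset.mem_filter.1 hr).2
      simp only [Finset.mem_filter, Finset.mem_univ, true_and]
      exact mem_uIcc_of_le hr'.1 (by linarith [hr'.2])
    · right
      refine ⟨by linarith [(hZ p).1], lt_of_le_of_lt (Finset.card_le_card fun r hr => ?_) hp⟩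
      have hr' := (Finset.mem_filter.1 hr).2
      simp only [Finset.mem_filter, Finset.mem_univ, true_and]
      exact mem_uIcc_of_ge (by linarith [hr'.1]) hr'.2
  have hnull : (Measure.pi fun _ : Fin s × Fin n => unif) {Z | ∃ p, Z p ∉ Icc (0 : ℝ) 1} = 0 := by
    have : ∀ᵐ Z ∂(Measure.pi fun _ : Fin s × Fin n => unif), ∀ p, Z p ∈ Icc (0 : ℝ) 1 := by
      rw [ae_all_iff]
      intro p
      have h1 : ∀ᵐ z ∂unif, z ∈ Icc (0 : ℝ) 1 := ae_restrict_mem measurableSet_Icc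
      exact (Measure.quasiMeasurePreserving_eval (fun _ : Fin s × Fin n => unif) p).ae h1
    rw [ae_iff] at this
    simpa using this
  have hpiece : ∀ (c : Prop) (a b : ℝ), b - a = ε → (c → 0 ≤ a ∧ b ≤ 1) →
      (Measure.pi fun _ : Fin s × Fin n => unif)
        {Z | c ∧ (Finset.univ.filter fun r => Z r ∈ Icc a b).card < K} ≤
        ENNReal.ofReal (4 / (s * n * ε)) := by
    intro c a b hab hc
    by_cases h : c
    · have hu : unif.real (Icc a b) = ε := by
        rw [unif_real_Icc (hc h).1 (by linarith) (hc h).2, hab]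
      have := measure_card_lt_le unif (ι := Fin s × Fin n) (I := Icc a b) measurableSet_Icc K
        (by rw [hu]; exact hε) hcard0 (by rw [hu, hcard]; exact hK)
      rw [hu, hcard] at this
      simp only [h, true_and]
      convert this
    · simp [h]
  calc covariateLaw s n {X | Escapes K ε X x} ≤ _ := measure_mono hsub
    _ ≤ (Measure.pi fun _ : Fin s × Fin n => unif) _ := hmp.measure_preimage_le _
    _ ≤ 0 + (ENNReal.ofReal (4 / (s * n * ε)) + ENNReal.ofReal (4 / (s * n * ε))) := by
        refine (measure_union_le _ _).trans (add_le_add hnull.le ((measure_union_le _ _).trans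
          (add_le_add ?_ ?_)))
        · exact hpiece _ _ _ (by ring) fun h => ⟨hx.1, h⟩
        · exact hpiece _ _ _ (by ring) fun h => ⟨h, hx.2⟩
    _ = _ := by
      rw [zero_add, ← ENNReal.ofReal_add (by positivity) (by positivity)]
      congr 1
      ring

end Windows

/-! ### Finitely supported laws -/

section UniformOver
variable {ι E : Type*} [Fintype ι] [MeasurableSpace E]

/-- The uniform law on the entries of a finite family. -/
def uniformOver (v : ι → E) : Measure E :=
  (Fintype.card ι : ℝ≥0∞)⁻¹ • ∑ i, Measure.dirac (v i)

instance isProbabilityMeasure_uniformOver [Nonempty ι] (v : ι → E) :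
    IsProbabilityMeasure (uniformOver v) := by
  constructor
  simp only [uniformOver, Measure.smul_apply, Measure.coe_finsetSum, Finset.sum_apply,
    measure_univ, Finset.sum_const, Finset.card_univ, smul_eq_mul, nsmul_eq_mul, mul_one]
  exact ENNReal.inv_mul_cancel (by simp) (by simp)

lemma integrable_uniformOver [MeasurableSingletonClass E] (v : ι → E) {f : E → ℝ} :
    Integrable f (uniformOver v) := by
  rcases isEmpty_or_nonempty ι with h | h
  · simp [uniformOver]
  · refine Integrable.smul_measure ?_ (by simp)
    rw [integrable_finsetSum_measure]
    intro i _
    exact integrable_dirac (by simp)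

lemma integral_uniformOver [MeasurableSingletonClass E] (v : ι → E) (f : E → ℝ) :
    ∫ e, f e ∂(uniformOver v) = (Fintype.card ι : ℝ)⁻¹ * ∑ i, f (v i) := by
  rw [uniformOver, integral_smul_measure, integral_finsetSum_measure]
  · simp
  · intro i _
    exact integrable_dirac (by simp)

lemma ae_uniformOver [MeasurableSingletonClass E] (v : ι → E) {p : E → Prop}
    (hp : MeasurableSet {e | p e}) (h : ∀ i, p (v i)) :
    ∀ᵐ e ∂(uniformOver v), p e := by
  rw [ae_iff, uniformOver, Measure.smul_apply, Measure.coe_finsetSum, Finset.sum_apply,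
    Finset.sum_eq_zero, smul_zero]
  intro i _
  have hc : MeasurableSet {e | ¬ p e} := hp.compl
  rw [Measure.dirac_apply' _ hc]
  simp [h i]

end UniformOver

/-! ### Bounded noise with an equicorrelated covariance matrix -/

section Noise
variable {n : ℕ}

/-- The support of the equicorrelated noise: scaled copies of `±√r • 1` and `±√(1-r) • e_i`. -/
def noiseVec (n : ℕ) (r : ℝ) (q : Option (Fin n) × Bool) (j : Fin n) : ℝ :=
  (if q.2 then 1 else -1) * √(n + 1) *
    (match q.1 with
      | none => √r
      | some i => if i = j then √(1 - r) else 0)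

/-- A law on `ℝⁿ` with mean zero and covariance `(1-r) I + r J`. -/
def noiseLaw (n : ℕ) (r : ℝ) : Measure (Fin n → ℝ) := uniformOver (noiseVec n r)

instance (n : ℕ) (r : ℝ) : IsProbabilityMeasure (noiseLaw n r) := by
  unfold noiseLaw; infer_instance

lemma sum_mul_noiseVec (r : ℝ) (a : Fin n → ℝ) (q : Option (Fin n) × Bool) :
    ∑ j, a j * noiseVec n r q j = (if q.2 then 1 else -1) * √(n + 1) *
      (match q.1 with
      | none => √r * ∑ j, a j
      | some i => √(1 - r) * a i) := by
  rcases q with ⟨_ | i, b⟩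
  · simp only [noiseVec, Finset.mul_sum]
    exact Finset.sum_congr rfl fun j _ => by ring
  · simp only [noiseVec, mul_ite, mul_zero, Finset.sum_ite_eq, Finset.mem_univ, if_true]
    ring

lemma integral_sum_mul_noise (r : ℝ) (a : Fin n → ℝ) :
    ∫ e, ∑ j, a j * e j ∂(noiseLaw n r) = 0 := by
  rw [noiseLaw, integral_uniformOver]
  simp_rw [sum_mul_noiseVec]
  rw [Fintype.sum_prod_type]
  simp

/-- Each of the n + 1 directions has probability 1/(n+1), signs included, which the factor √(n+1)
compensates. The constant direction yields r(Σa)², the coordinate directions the rest. -/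
lemma integral_sq_sum_mul_noise {r : ℝ} (h0 : 0 ≤ r) (h1 : r ≤ 1) (a : Fin n → ℝ) :
    ∫ e, (∑ j, a j * e j) ^ 2 ∂(noiseLaw n r) = (1 - r) * ∑ j, a j ^ 2 + r * (∑ j, a j) ^ 2 := by
  rw [noiseLaw, integral_uniformOver]
  simp_rw [sum_mul_noiseVec, mul_pow]
  rw [Fintype.sum_prod_type]
  simp only [Fintype.sum_option, Fintype.sum_bool, mul_pow, Real.sq_sqrt h0,
    Real.sq_sqrt (sub_nonneg.2 h1), Fintype.card_prod, Fintype.card_option, Fintype.card_fin,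
    Fintype.card_bool]
  rw [Real.sq_sqrt (by positivity)]
  have : ((n : ℝ) + 1) ≠ 0 := by positivity
  have hg : ∀ S : ℝ, (if (false = true) then (1 : ℝ) else -1) ^ 2 * (n + 1) * S = (n + 1) * S :=
    fun S => by simp
  have hsum : ∑ i, ((n + 1) * ((1 - r) * a i ^ 2) + (n + 1) * ((1 - r) * a i ^ 2)) =
      2 * (n + 1) * (1 - r) * ∑ i, a i ^ 2 := by
    rw [Finset.mul_sum]
    exact Finset.sum_congr rfl fun i _ => by ring
  simp only [hg, if_true, one_pow, one_mul, hsum]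
  push_cast
  field_simp
  ring

lemma integral_pow_four_sum_mul_noise_le (r : ℝ) (a : Fin n → ℝ) :
    ∫ e, (∑ j, a j * e j) ^ 4 ∂(noiseLaw n r) ≤
      (2 * (n + 1)) * (∫ e, (∑ j, a j * e j) ^ 2 ∂(noiseLaw n r)) ^ 2 := by
  rw [noiseLaw, integral_uniformOver, integral_uniformOver]
  set z : Option (Fin n) × Bool → ℝ := fun q => ∑ j, a j * noiseVec n r q j
  have hc : (Fintype.card (Option (Fin n) × Bool) : ℝ) = 2 * (n + 1) := by
    simp; ring
  rw [hc]
  -- Crude, but enough for a finite support: its size 2(n+1) becomes the moment constant.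
  have h4 : ∑ q, z q ^ 4 ≤ (∑ q, z q ^ 2) ^ 2 := by
    rw [sq, Finset.sum_mul]
    refine Finset.sum_le_sum fun q _ => ?_
    have : z q ^ 2 ≤ ∑ q, z q ^ 2 :=
      Finset.single_le_sum (f := fun q => z q ^ 2) (fun _ _ => sq_nonneg _) (Finset.mem_univ q)
    nlinarith [mul_le_mul_of_nonneg_left this (sq_nonneg (z q))]
  have hp : (0 : ℝ) < 2 * (n + 1) := by positivity
  rw [mul_pow, ← mul_assoc]
  have : 2 * ((n : ℝ) + 1) * (2 * ((n : ℝ) + 1))⁻¹ ^ 2 = (2 * ((n : ℝ) + 1))⁻¹ := by field_simp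
  rw [this]
  gcongr

lemma integrable_noise (r : ℝ) (f : (Fin n → ℝ) → ℝ) : Integrable f (noiseLaw n r) :=
  integrable_uniformOver _

lemma ae_abs_noise_le {r : ℝ} (h0 : 0 ≤ r) (h1 : r ≤ 1) :
    ∀ᵐ e ∂(noiseLaw n r), ∀ j, |e j| ≤ √(n + 1) := by
  refine ae_uniformOver _ ?_ ?_
  · simp only [ofPred_forall]
    exact MeasurableSet.iInter fun j => measurableSet_le (by fun_prop) (by fun_prop)
  · rintro ⟨_ | i, b⟩ j
    · simp only [noiseVec, abs_mul, abs_of_nonneg (Real.sqrt_nonneg _)]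
      have : |(if b = true then (1 : ℝ) else -1)| = 1 := by split_ifs <;> simp
      rw [this, one_mul]
      exact mul_le_of_le_one_right (Real.sqrt_nonneg _) (Real.sqrt_le_one.2 h1)
    · simp only [noiseVec, abs_mul, abs_of_nonneg (Real.sqrt_nonneg _)]
      have : |(if b = true then (1 : ℝ) else -1)| = 1 := by split_ifs <;> simp
      rw [this, one_mul]
      refine mul_le_of_le_one_right (Real.sqrt_nonneg _) ?_
      split_ifs
      · rw [abs_of_nonneg (Real.sqrt_nonneg _)]
        exact Real.sqrt_le_one.2 (by linarith)
      · simp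

lemma integral_noise (r : ℝ) (j : Fin n) : ∫ e, e j ∂(noiseLaw n r) = 0 := by
  simpa [Pi.single_apply] using integral_sum_mul_noise r (Pi.single j (1 : ℝ))

lemma integral_mul_noise {r : ℝ} (h0 : 0 ≤ r) (h1 : r ≤ 1) (j l : Fin n) :
    ∫ e, e j * e l ∂(noiseLaw n r) = if j = l then 1 else r := by
  -- Polarisation.
  have key : ∀ e : Fin n → ℝ, e j * e l =
      2⁻¹ * ((∑ i, (Pi.single j (1 : ℝ) + Pi.single l 1 : Fin n → ℝ) i * e i) ^ 2
        - (∑ i, (Pi.single j (1 : ℝ) : Fin n → ℝ) i * e i) ^ 2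
        - (∑ i, (Pi.single l (1 : ℝ) : Fin n → ℝ) i * e i) ^ 2) := by
    intro e
    simp [add_mul, Finset.sum_add_distrib, Pi.single_apply]
    ring
  simp_rw [key]
  rw [integral_const_mul, integral_sub (integrable_noise _ _) (integrable_noise _ _), integral_sub (integrable_noise _ _) (integrable_noise _ _),
    integral_sq_sum_mul_noise h0 h1, integral_sq_sum_mul_noise h0 h1,
    integral_sq_sum_mul_noise h0 h1]
  by_cases h : j = l
  · subst h
    simp [Pi.single_apply, Finset.sum_add_distrib, add_sq]
    ring
  · simp [Pi.single_apply, Finset.sum_add_distrib, add_sq, h, Ne.symm h]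
    ring

end Noise

/-! ### The noise scale -/

section Scale

/-- The scale of the noise: `η` at `x₀`, and `1` at distance at least `d` from `x₀`. -/
def scaleFn (η d x₀ u : ℝ) : ℝ := min 1 (max η (|u - x₀| / d))

variable {η d x₀ : ℝ}

lemma continuous_scaleFn : Continuous (scaleFn η d x₀) := by
  unfold scaleFn; fun_prop

lemma measurable_scaleFn : Measurable (scaleFn η d x₀) := continuous_scaleFn.measurable

lemma scaleFn_le_one (u : ℝ) : scaleFn η d x₀ u ≤ 1 := min_le_left _ _

lemma le_scaleFn (h : η ≤ 1) (u : ℝ) : η ≤ scaleFn η d x₀ u := le_min h (le_max_left _ _)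

lemma scaleFn_eq_one (hd : 0 < d) {u : ℝ} (h : d ≤ |u - x₀|) : scaleFn η d x₀ u = 1 :=
  min_eq_left (le_max_of_le_right ((one_le_div hd).2 h))

lemma scaleFn_eq_left (h1 : η ≤ 1) (hd : 0 < d) {u : ℝ} (h : |u - x₀| ≤ η * d) :
    scaleFn η d x₀ u = η := by
  unfold scaleFn
  rw [max_eq_left ((div_le_iff₀ hd).2 h), min_eq_right h1]

lemma abs_scaleFn_sub_le (hd : 0 < d) (u v : ℝ) :
    |scaleFn η d x₀ u - scaleFn η d x₀ v| ≤ d⁻¹ * |u - v| := by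
  unfold scaleFn
  refine (abs_min_sub_min_le_max _ _ _ _).trans ?_
  rw [sub_self, abs_zero, max_eq_right (abs_nonneg _)]
  refine (abs_max_sub_max_le_max _ _ _ _).trans ?_
  rw [sub_self, abs_zero, max_eq_right (abs_nonneg _), ← sub_div, abs_div, abs_of_pos hd,
    div_eq_inv_mul]
  refine mul_le_mul_of_nonneg_left ?_ (inv_nonneg.2 hd.le)
  refine (abs_abs_sub_abs_le (u - x₀) (v - x₀)).trans (le_of_eq ?_)
  congr 1
  ring

end Scale

/-! ### The law of a cluster and its admissibility -/

section Law
variable {n : ℕ}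

/-- Multiplication of the noise by the scale. -/
def applyScale (σ : ℝ → ℝ) (x e : Fin n → ℝ) (j : Fin n) : ℝ := σ (x j) * e j

lemma measurable_applyScale {σ : ℝ → ℝ} (hσ : Measurable σ) :
    Measurable fun p : (Fin n → ℝ) × (Fin n → ℝ) => applyScale σ p.1 p.2 := by
  unfold applyScale
  fun_prop

/-- The conditional law of the responses given the covariates. -/
def scaleKernel (n : ℕ) (r : ℝ) (σ : ℝ → ℝ) (hσ : Measurable σ) :
    Kernel (Fin n → ℝ) (Fin n → ℝ) where
  toFun x := (noiseLaw n r).map (applyScale σ x)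
  measurable' := by
    refine Measure.measurable_of_measurable_coe _ fun t ht => ?_
    have : ∀ x, ((noiseLaw n r).map (applyScale σ x)) t =
        (noiseLaw n r) (Prod.mk x ⁻¹' ((fun p : (Fin n → ℝ) × (Fin n → ℝ) =>
          applyScale σ p.1 p.2) ⁻¹' t)) := fun x => by
      rw [Measure.map_apply (f := applyScale σ x)
        ((measurable_applyScale hσ).comp measurable_prodMk_left) ht]
      rfl
    simp_rw [this]
    exact measurable_measure_prodMk_left (measurable_applyScale hσ ht)

variable {r : ℝ} {σ : ℝ → ℝ} (hσ : Measurable σ)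

lemma scaleKernel_apply (x : Fin n → ℝ) :
    scaleKernel n r σ hσ x = (noiseLaw n r).map (applyScale σ x) := rfl

lemma measurable_applyScale_right (hσ : Measurable σ) (x : Fin n → ℝ) :
    Measurable (applyScale σ x) := (measurable_applyScale hσ).comp measurable_prodMk_left

instance : IsMarkovKernel (scaleKernel n r σ hσ) :=
  ⟨fun x => by
    rw [scaleKernel_apply]
    exact Measure.isProbabilityMeasure_map (measurable_applyScale_right hσ x).aemeasurable⟩

lemma integral_scaleKernel (x : Fin n → ℝ) {f : (Fin n → ℝ) → ℝ} (hf : Measurable f) :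
    ∫ y, f y ∂(scaleKernel n r σ hσ x) = ∫ e, f (applyScale σ x e) ∂(noiseLaw n r) := by
  rw [scaleKernel_apply, integral_map (measurable_applyScale_right hσ x).aemeasurable
    hf.aestronglyMeasurable]

/-- The law of a cluster with independent uniform covariates and responses `σ (X_j) ε_j`. -/
def scaleLaw (n : ℕ) (r : ℝ) (σ : ℝ → ℝ) (hσ : Measurable σ) : Measure (Cluster n) :=
  (Measure.pi fun _ : Fin n => unif) ⊗ₘ scaleKernel n r σ hσ

instance : IsProbabilityMeasure (scaleLaw n r σ hσ) := by
  unfold scaleLaw; infer_instance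

lemma fst_scaleLaw : (scaleLaw n r σ hσ).fst = Measure.pi fun _ : Fin n => unif :=
  Measure.fst_compProd _ _

/-- A cluster as an image of independent covariates and noise, which later allows the noise of a
whole sample to be integrated out separately. -/
lemma scaleLaw_eq_map : scaleLaw n r σ hσ =
    ((Measure.pi fun _ : Fin n => unif).prod (noiseLaw n r)).map
      fun p => (p.1, applyScale σ p.1 p.2) := by
  have hm : Measurable fun p : (Fin n → ℝ) × (Fin n → ℝ) => (p.1, applyScale σ p.1 p.2) :=
    measurable_fst.prodMk (measurable_applyScale hσ)
  ext t ht
  rw [scaleLaw, Measure.compProd_apply ht, Measure.map_apply hm ht, Measure.prod_apply (hm ht)]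
  refine lintegral_congr fun x => ?_
  rw [scaleKernel_apply, Measure.map_apply (measurable_applyScale_right hσ x)
    (measurable_prodMk_left ht)]
  rfl

lemma condKernel_scaleLaw :
    ∀ᵐ x ∂(scaleLaw n r σ hσ).fst, (scaleLaw n r σ hσ).condKernel x = scaleKernel n r σ hσ x := by
  rw [fst_scaleLaw]
  exact condKernel_compProd _ _

lemma marginalX_scaleLaw (j : Fin n) : marginalX (scaleLaw n r σ hσ) j = unif := by
  have : (fun z : Cluster n => z.1 j) = (fun x : Fin n → ℝ => x j) ∘ Prod.fst := rfl
  rw [marginalX, this, ← Measure.map_map (by fun_prop) measurable_fst]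
  rw [← Measure.fst, fst_scaleLaw]
  exact (measurePreserving_eval (fun _ : Fin n => unif) j).map_eq


lemma condMean_scaleLaw :
    ∀ᵐ x ∂(scaleLaw n r σ hσ).fst, ∀ j, condMean (scaleLaw n r σ hσ) x j = 0 := by
  filter_upwards [condKernel_scaleLaw hσ] with x hx j
  rw [condMean, hx, integral_scaleKernel hσ x (by fun_prop)]
  simp only [applyScale]
  rw [integral_const_mul, integral_noise, mul_zero]

lemma condCov_scaleLaw (h0 : 0 ≤ r) (h1 : r ≤ 1) :
    ∀ᵐ x ∂(scaleLaw n r σ hσ).fst, ∀ j l, condCov (scaleLaw n r σ hσ) x j l =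
      (if j = l then 1 else r) * (σ (x j) * σ (x l)) := by
  filter_upwards [condKernel_scaleLaw hσ, condMean_scaleLaw hσ] with x hx hm j l
  have hm' : ∀ j, ∫ y, y j ∂((scaleLaw n r σ hσ).condKernel x) = 0 := hm
  rw [condCov, Matrix.of_apply, covariance, hm', hm', hx, integral_scaleKernel hσ x (by fun_prop)]
  simp only [applyScale, sub_zero]
  rw [← integral_mul_noise h0 h1, ← integral_mul_const]
  exact integral_congr_ae (ae_of_all _ fun e => by simp only; ring)

lemma hasCondCorr_scaleLaw (h0 : 0 ≤ r) (h1 : r ≤ 1) (hpos : ∀ u, 0 < σ u) :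
    HasCondCorr (scaleLaw n r σ hσ) r := by
  filter_upwards [condCov_scaleLaw hσ h0 h1] with x hx j l hjl
  have h2 : ∀ j, √(σ (x j) * σ (x j)) = σ (x j) := fun j => Real.sqrt_mul_self (hpos _).le
  simp only [hx, if_neg hjl, if_true, one_mul, h2]
  have := (hpos (x j)).ne'
  have := (hpos (x l)).ne'
  field_simp

lemma ae_abs_scaleLaw_le (h0 : 0 ≤ r) (h1 : r ≤ 1) (hσ1 : ∀ u, |σ u| ≤ 1) :
    ∀ᵐ z ∂(scaleLaw n r σ hσ), ∀ j, |z.2 j| ≤ √(n + 1) := by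
  have hm : Measurable fun p : (Fin n → ℝ) × (Fin n → ℝ) => (p.1, applyScale σ p.1 p.2) :=
    measurable_fst.prodMk (measurable_applyScale hσ)
  rw [scaleLaw_eq_map, ae_map_iff hm.aemeasurable]
  · have := (Measure.quasiMeasurePreserving_snd (μ := Measure.pi fun _ : Fin n => unif)
      (ν := noiseLaw n r)).ae (ae_abs_noise_le h0 h1)
    filter_upwards [this] with p hp j
    simp only [applyScale, abs_mul]
    nlinarith [hσ1 (p.1 j), hp j, abs_nonneg (p.2 j), abs_nonneg (σ (p.1 j))]
  · simp only [Set.ofPred_forall]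
    exact MeasurableSet.iInter fun j => measurableSet_le (by fun_prop) (by fun_prop)

/-- An event in terms of the two covariates is a cylinder over the covariate space, so the defining
integral identity can be checked after integrating the noise for fixed covariates. -/
lemma condExp_mul_scaleLaw (h0 : 0 ≤ r) (h1 : r ≤ 1) (hσ1 : ∀ u, |σ u| ≤ 1) (j l : Fin n) :
    (scaleLaw n r σ hσ)[fun z => z.2 j * z.2 l |
        MeasurableSpace.comap (fun z : Cluster n => (z.1 j, z.1 l)) inferInstance]
      =ᵐ[scaleLaw n r σ hσ] fun z => (if j = l then 1 else r) * (σ (z.1 j) * σ (z.1 l)) := by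
  have hle : MeasurableSpace.comap (fun z : Cluster n => (z.1 j, z.1 l)) inferInstance ≤
      (inferInstance : MeasurableSpace (Cluster n)) := by
    refine Measurable.comap_le ?_
    fun_prop
  have hint : Integrable (fun z : Cluster n => z.2 j * z.2 l) (scaleLaw n r σ hσ) := by
    refine Integrable.of_bound (C := √(n + 1) * √(n + 1)) (by fun_prop) ?_
    filter_upwards [ae_abs_scaleLaw_le hσ h0 h1 hσ1] with z hz
    rw [norm_mul]
    exact mul_le_mul (hz j) (hz l) (abs_nonneg _) (Real.sqrt_nonneg _)
  have hint' : Integrable (fun z : Cluster n => (if j = l then 1 else r) *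
      (σ (z.1 j) * σ (z.1 l))) (scaleLaw n r σ hσ) := by
    refine Integrable.of_bound (C := 1) (by fun_prop) (ae_of_all _ fun z => ?_)
    rw [norm_mul, norm_mul]
    have : ‖(if j = l then 1 else r : ℝ)‖ ≤ 1 := by
      split_ifs
      · simp
      · rw [Real.norm_eq_abs, abs_of_nonneg h0]; exact h1
    exact mul_le_one₀ this (by positivity) (mul_le_one₀ (hσ1 _) (by positivity) (hσ1 _))
  symm
  refine ae_eq_condExp_of_forall_setIntegral_eq hle hint (fun _ _ _ => hint'.integrableOn) ?_ ?_
  · rintro _ ⟨t, ht, rfl⟩ -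
    have hA : MeasurableSet ((fun x : Fin n → ℝ => (x j, x l)) ⁻¹' t) :=
      ht.preimage (by fun_prop)
    have hset : (fun z : Cluster n => (z.1 j, z.1 l)) ⁻¹' t =
        ((fun x : Fin n → ℝ => (x j, x l)) ⁻¹' t) ×ˢ univ := by
      ext z; simp
    rw [hset, scaleLaw, Measure.setIntegral_compProd hA MeasurableSet.univ hint.integrableOn,
      Measure.setIntegral_compProd hA MeasurableSet.univ hint'.integrableOn]
    refine setIntegral_congr_fun hA fun x _ => ?_
    simp only [Measure.restrict_univ]
    rw [integral_const, integral_scaleKernel hσ x (by fun_prop)]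
    simp only [applyScale, probReal_univ, one_smul]
    rw [← integral_mul_noise h0 h1, ← integral_mul_const]
    exact integral_congr_ae (ae_of_all _ fun e => by simp only; ring)
  · refine StronglyMeasurable.aestronglyMeasurable (Measurable.stronglyMeasurable ?_)
    have : Measurable fun p : ℝ × ℝ => (if j = l then 1 else r) * (σ p.1 * σ p.2) := by fun_prop
    exact this.comp (comap_measurable _)

lemma eigenvalue_mem_scaleLaw {η : ℝ} (h0 : 0 ≤ r) (h1 : r < 1) (hη : 0 < η)
    (hση : ∀ u, η ≤ σ u) (hσ1 : ∀ u, σ u ≤ 1) :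
    ∃ lam : ℝ, 1 ≤ lam ∧ ∀ᵐ x ∂(scaleLaw n r σ hσ).fst, ∀ t : ℝ,
      Module.End.HasEigenvalue (Matrix.toLin' (condCov (scaleLaw n r σ hσ) x)) t →
        t ∈ Icc lam⁻¹ lam := by
  have hlow : 0 < (1 - r) * η ^ 2 := mul_pos (by linarith) (by positivity)
  -- For an eigenvector `f` the quadratic form lies between (1 - r)η²‖f‖² and (1 + n)‖f‖².
  refine ⟨max (1 + n) ((1 - r) * η ^ 2)⁻¹, le_max_of_le_left (by simp), ?_⟩
  filter_upwards [condCov_scaleLaw hσ h0 h1.le] with x hx t ht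
  obtain ⟨f, hf⟩ := ht.exists_hasEigenvector
  have hmul : ∀ j, ∑ l, (if j = l then 1 else r) * (σ (x j) * σ (x l)) * f l = t * f j := by
    intro j
    have := congrFun hf.apply_eq_smul j
    simp only [Matrix.toLin'_apply, Matrix.mulVec, dotProduct, Pi.smul_apply, smul_eq_mul, hx] at this
    exact this
  have hq : (1 - r) * ∑ j, (σ (x j) * f j) ^ 2 + r * (∑ j, σ (x j) * f j) ^ 2 =
      t * ∑ j, f j ^ 2 := by
    have h3 : t * ∑ j, f j ^ 2 = ∑ j, f j *
        (∑ l, (if j = l then 1 else r) * (σ (x j) * σ (x l)) * f l) := by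
      rw [Finset.mul_sum]
      exact Finset.sum_congr rfl fun j _ => by rw [hmul]; ring
    have h4 : ∀ j, ∑ l, (if j = l then 1 else r) * (σ (x j) * σ (x l)) * f l =
        (1 - r) * σ (x j) ^ 2 * f j + r * σ (x j) * ∑ l, σ (x l) * f l := by
      intro j
      have : ∀ l, (if j = l then 1 else r) * (σ (x j) * σ (x l)) * f l =
          (if j = l then (1 - r) * (σ (x j) * σ (x l)) * f l else 0) +
            r * σ (x j) * (σ (x l) * f l) := by
        intro l; split_ifs <;> ring
      rw [Finset.sum_congr rfl fun l _ => this l, Finset.sum_add_distrib, Finset.sum_ite_eq,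
        if_pos (Finset.mem_univ _), Finset.mul_sum]
      ring
    simp only [h3, h4]
    rw [sq (∑ j, σ (x j) * f j), Finset.sum_mul, Finset.mul_sum,
      Finset.mul_sum, ← Finset.sum_add_distrib]
    exact Finset.sum_congr rfl fun j _ => by ring
  have hfpos : 0 < ∑ j, f j ^ 2 := by
    obtain ⟨j, hj⟩ := Function.ne_iff.1 hf.2
    exact lt_of_lt_of_le (pow_pos (abs_pos.2 hj) 2 |>.trans_eq (sq_abs _))
      (Finset.single_le_sum (f := fun j => f j ^ 2) (fun _ _ => sq_nonneg _) (Finset.mem_univ j))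
  have hup : ∑ j, (σ (x j) * f j) ^ 2 ≤ ∑ j, f j ^ 2 := by
    refine Finset.sum_le_sum fun j _ => ?_
    rw [mul_pow]
    exact mul_le_of_le_one_left (sq_nonneg _) (pow_le_one₀ (hη.le.trans (hση _)) (hσ1 _))
  have hdown : η ^ 2 * ∑ j, f j ^ 2 ≤ ∑ j, (σ (x j) * f j) ^ 2 := by
    rw [Finset.mul_sum]
    refine Finset.sum_le_sum fun j _ => ?_
    rw [mul_pow]
    exact mul_le_mul_of_nonneg_right (pow_le_pow_left₀ hη.le (hση _) 2) (sq_nonneg _)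
  have hcs : (∑ j, σ (x j) * f j) ^ 2 ≤ n * ∑ j, (σ (x j) * f j) ^ 2 := by
    simpa using sq_sum_le_card_mul_sum_sq (s := Finset.univ) (f := fun j => σ (x j) * f j)
  have hnn : (0 : ℝ) ≤ ∑ j, (σ (x j) * f j) ^ 2 := Finset.sum_nonneg fun _ _ => sq_nonneg _
  constructor
  · refine (inv_anti₀ (inv_pos.2 hlow) (le_max_right _ _)).trans ?_
    rw [inv_inv]
    refine le_of_mul_le_mul_right ?_ hfpos
    rw [← hq]
    nlinarith [mul_le_mul_of_nonneg_left hdown (sub_nonneg.2 h1.le),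
      mul_nonneg h0 (sq_nonneg (∑ j, σ (x j) * f j))]
  · refine le_trans ?_ (le_max_left _ _)
    refine le_of_mul_le_mul_right ?_ hfpos
    rw [← hq]
    have h5 : r * (∑ j, σ (x j) * f j) ^ 2 ≤ n * ∑ j, (σ (x j) * f j) ^ 2 :=
      (mul_le_of_le_one_left (sq_nonneg _) h1.le).trans hcs
    nlinarith [mul_nonneg h0 hnn, mul_le_mul_of_nonneg_left hup (Nat.cast_nonneg (α := ℝ) n)]

lemma moments_scaleLaw :
    ∃ δ τ : ℝ, 0 < δ ∧ 0 < τ ∧ ∀ᵐ x ∂(scaleLaw n r σ hσ).fst, ∀ a : Fin n → ℝ,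
      ∫⁻ y, ENNReal.ofReal (|∑ j, a j * (y j - condMean (scaleLaw n r σ hσ) x j)| ^ (2 + δ))
          ∂((scaleLaw n r σ hσ).condKernel x) ≤
        ENNReal.ofReal (τ * (∫ y, (∑ j, a j * (y j - condMean (scaleLaw n r σ hσ) x j)) ^ 2
          ∂((scaleLaw n r σ hσ).condKernel x)) ^ (1 + δ / 2)) := by
  -- δ = 2 turns the condition into a comparison of fourth moments with squared second moments.
  refine ⟨2, 2 * (n + 1), by norm_num, by positivity, ?_⟩
  filter_upwards [condKernel_scaleLaw hσ, condMean_scaleLaw hσ] with x hx hm a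
  simp only [hx, hm, sub_zero]
  have hpow : ∀ z : ℝ, |z| ^ ((2 : ℝ) + 2) = z ^ 4 := by
    intro z
    rw [show (2 : ℝ) + 2 = ((4 : ℕ) : ℝ) by norm_num, Real.rpow_natCast]
    exact Even.pow_abs (by decide) z
  simp only [hpow]
  rw [show (1 : ℝ) + 2 / 2 = ((2 : ℕ) : ℝ) by norm_num, Real.rpow_natCast]
  rw [integral_scaleKernel hσ x (by fun_prop), scaleKernel_apply,
    lintegral_map (by fun_prop) (measurable_applyScale_right hσ x)]
  have hsum : ∀ e : Fin n → ℝ, ∑ j, a j * applyScale σ x e j = ∑ j, (a j * σ (x j)) * e j :=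
    fun e => Finset.sum_congr rfl fun j _ => by rw [applyScale]; ring
  simp only [hsum]
  rw [← ofReal_integral_eq_lintegral_ofReal (integrable_noise _ _)
    (ae_of_all _ fun e => Even.pow_nonneg (by decide) _)]
  exact ENNReal.ofReal_le_ofReal (integral_pow_four_sum_mul_noise_le r _)

lemma dataAssumptions_scaleLaw (k : ℕ → ℕ) {η : ℝ} {Lσ : ℝ≥0} (h0 : 0 ≤ r) (h1 : r < 1)
    (hη : 0 < η) (hση : ∀ u, η ≤ σ u) (hσ1 : ∀ u, σ u ≤ 1)
    (hL : ∀ u v, |σ u - σ v| ≤ Lσ * |u - v|) :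
    DataAssumptions k (scaleLaw n r σ hσ) := by
  have habs : ∀ u, |σ u| ≤ 1 := fun u =>
    abs_le.2 ⟨by linarith [hση u], hσ1 u⟩
  refine ⟨⟨fun _ => 1, 1, le_rfl, measurable_const, fun x _ => by simp, fun j => ?_⟩, Or.inl ?_,
    fun j => ?_, ?_, eigenvalue_mem_scaleLaw hσ h0 h1 hη hση hσ1, moments_scaleLaw hσ⟩
  · rw [marginalX_scaleLaw]
    simp [unif]
  · rw [iIndepFun_iff_map_fun_eq_pi_map (fun j => by fun_prop)]
    have : ∀ j, (scaleLaw n r σ hσ).map (fun z : Cluster n => z.1 j) = unif :=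
      marginalX_scaleLaw hσ
    simp only [this]
    exact fst_scaleLaw hσ
  · refine MemLp.of_bound (by fun_prop) (√(n + 1)) ?_
    filter_upwards [ae_abs_scaleLaw_le hσ h0 h1.le habs] with z hz
    exact hz j
  -- The mean vanishes. The Lipschitz constant 2Lσ is that of a product of two functions bounded by
  -- 1.
  · refine ⟨fun _ => 0, fun j l p => (if j = l then 1 else r) * (σ p.1 * σ p.2), 1, 0, 2 * Lσ,
      LipschitzWith.const _ |>.lipschitzOnWith, fun x _ => by simp, condMean_scaleLaw hσ,
      fun j l => ⟨?_, ?_, ?_⟩⟩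
    · refine LipschitzOnWith.of_dist_le_mul fun p _ q _ => ?_
      rw [Real.dist_eq, Prod.dist_eq, Real.dist_eq, Real.dist_eq, ← mul_sub, abs_mul]
      have hc : |(if j = l then 1 else r : ℝ)| ≤ 1 := by
        split_ifs
        · simp
        · rw [abs_of_nonneg h0]; exact h1.le
      refine (mul_le_of_le_one_left (abs_nonneg _) hc).trans ?_
      have e1 : σ p.1 * σ p.2 - σ q.1 * σ q.2 =
          (σ p.1 - σ q.1) * σ p.2 + σ q.1 * (σ p.2 - σ q.2) := by ring
      rw [e1]
      refine (abs_add_le _ _).trans ?_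
      rw [abs_mul, abs_mul]
      have h3 : |σ p.1 - σ q.1| * |σ p.2| ≤ Lσ * max |p.1 - q.1| |p.2 - q.2| :=
        (mul_le_of_le_one_right (abs_nonneg _) (habs _)).trans
          ((hL _ _).trans (mul_le_mul_of_nonneg_left (le_max_left _ _) Lσ.2))
      have h4 : |σ q.1| * |σ p.2 - σ q.2| ≤ Lσ * max |p.1 - q.1| |p.2 - q.2| :=
        (mul_le_of_le_one_left (abs_nonneg _) (habs _)).trans
          ((hL _ _).trans (mul_le_mul_of_nonneg_left (le_max_right _ _) Lσ.2))
      push_cast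
      linarith
    · intro p _
      have hc : |(if j = l then 1 else r : ℝ)| ≤ 1 := by
        split_ifs
        · simp
        · rw [abs_of_nonneg h0]; exact h1.le
      rw [abs_mul, abs_mul]
      exact mul_le_one₀ hc (by positivity) (mul_le_one₀ (habs _) (abs_nonneg _) (habs _))
    · simp only [sub_zero]
      exact condExp_mul_scaleLaw hσ h0 h1.le habs j l

end Law

/-! ### Leaves of regular trees -/

section Trees

lemma SplitTree.leafOf_node_val (t : ℝ) (l r : SplitTree) (x : ℝ) :
    ((SplitTree.node t l r).leafOf x : ℕ) =
      if x ≤ t then (l.leafOf x : ℕ) else l.numLeaves + (r.leafOf x : ℕ) := by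
  change ((if x ≤ t then Fin.castAdd r.numLeaves (l.leafOf x)
    else Fin.natAdd l.numLeaves (r.leafOf x) : Fin (l.numLeaves + r.numLeaves)) : ℕ) = _
  split_ifs <;> rfl

/-- Leaves of the left subtree are numbered before those of the right one. Hence leaves are
intervals, which the rank windows rely on. -/
lemma SplitTree.monotone_leafOf (T : SplitTree) : Monotone fun x => (T.leafOf x : ℕ) := by
  induction T with
  | leaf => exact monotone_const
  | node t l r hl hr =>
    intro x y hxy
    have h3 : (l.leafOf x : ℕ) ≤ l.leafOf y := hl hxy
    have h4 : (r.leafOf x : ℕ) ≤ r.leafOf y := hr hxy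
    have h5 := (l.leafOf x).isLt
    simp only [SplitTree.leafOf_node_val]
    split_ifs with h1 h2 h2
    · exact h3
    · omega
    · exact absurd (hxy.trans h2) h1
    · omega

lemma SplitTree.IsRegular.card_leaf {ι : Type*} {α : ℝ} {k : ℕ} {obs : ι → ℝ} {T : SplitTree}
    {S : Finset ι} (h : T.IsRegular α k obs S) {m : ℕ} (hm : m < T.numLeaves) :
    k ≤ (S.filter fun i => (T.leafOf (obs i) : ℕ) = m).card ∧
      (S.filter fun i => (T.leafOf (obs i) : ℕ) = m).card < 2 * k := by
  induction T generalizing S m with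
  | leaf =>
    have hm0 : m = 0 := by simpa [SplitTree.numLeaves] using hm
    have : (S.filter fun i => (SplitTree.leaf.leafOf (obs i) : ℕ) = m) = S := by
      refine Finset.filter_true_of_mem fun i _ => ?_
      have := (SplitTree.leaf.leafOf (obs i)).isLt
      simp only [SplitTree.numLeaves] at this
      omega
    rw [this]
    exact h
  | node t l r hl hr =>
    obtain ⟨-, -, h1, h2⟩ := h
    by_cases hml : m < l.numLeaves
    · have : (S.filter fun i => ((SplitTree.node t l r).leafOf (obs i) : ℕ) = m) =
          (S.filter fun i => obs i ≤ t).filter fun i => (l.leafOf (obs i) : ℕ) = m := by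
        ext i
        simp only [Finset.mem_filter, SplitTree.leafOf_node_val]
        split_ifs with hi
        · simp [hi]
        · simp only [hi, and_false, false_and, iff_false, not_and]
          omega
      rw [this]
      exact hl h1 hml
    · have hmr : m - l.numLeaves < r.numLeaves := by
        simp only [SplitTree.numLeaves] at hm
        omega
      have : (S.filter fun i => ((SplitTree.node t l r).leafOf (obs i) : ℕ) = m) =
          (S.filter fun i => t < obs i).filter fun i =>
            (r.leafOf (obs i) : ℕ) = m - l.numLeaves := by
        ext i
        simp only [Finset.mem_filter, SplitTree.leafOf_node_val]
        split_ifs with hi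
        · have := (l.leafOf (obs i)).isLt
          simp only [not_lt.2 hi, and_false, false_and, iff_false, not_and]
          omega
        · simp only [not_le.1 hi, and_true]
          refine and_congr_right fun _ => ?_
          omega
      rw [this]
      exact hr h2 hmr

/-- The labels of the evaluation observations. -/
def SplitTree.labels {s n : ℕ} (T : SplitTree) (X : Fin s → Fin n → ℝ) (i : Fin s) (j : Fin n) :
    ℕ := T.leafOf (X i j)

lemma SplitTree.IsRegular.labelRegular {s n : ℕ} {α : ℝ} {k : ℕ} {X : Fin s → Fin n → ℝ}
    {T : SplitTree}
    (h : T.IsRegular α k (fun p : Fin s × Fin n => X p.1 p.2) Finset.univ) :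
    LabelRegular k T.numLeaves (T.labels X) := by
  have hcard : ∀ m, leafSize (T.labels X) m =
      ((Finset.univ.filter fun p : Fin s × Fin n => (T.leafOf (X p.1 p.2) : ℕ) = m).card : ℝ) := by
    intro m
    rw [Finset.card_filter, Fintype.sum_prod_type]
    push_cast
    rfl
  refine ⟨fun i j => (T.leafOf (X i j)).isLt, fun m hm => ?_, fun m hm => ?_⟩
  · rw [hcard]
    exact_mod_cast (h.card_leaf hm).1
  · rw [hcard]
    exact_mod_cast (h.card_leaf hm).2

end Trees

/-! ### From the matrix formula to the normal equations -/

section MatrixWeights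
variable {s n : ℕ}

/-- The parameter of the inverse of the equicorrelation matrix. -/
def shrinkage (n : ℕ) (ρ : ℝ) : ℝ := ρ / (1 + (n - 1) * ρ)

lemma equiWeight_denom_pos (hn : 1 ≤ n) {ρ : ℝ} (h0 : 0 ≤ ρ) : 0 < 1 + ((n : ℝ) - 1) * ρ := by
  have : (1 : ℝ) ≤ n := by exact_mod_cast hn
  nlinarith

lemma shrinkage_nonneg (hn : 1 ≤ n) {ρ : ℝ} (h0 : 0 ≤ ρ) : 0 ≤ shrinkage n ρ :=
  div_nonneg h0 (equiWeight_denom_pos hn h0).le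

lemma one_sub_mul_shrinkage (hn : 1 ≤ n) {ρ : ℝ} (h0 : 0 ≤ ρ) :
    1 - n * shrinkage n ρ = (1 - ρ) / (1 + (n - 1) * ρ) := by
  have := (equiWeight_denom_pos hn h0).ne'
  rw [shrinkage, eq_div_iff this, sub_mul, mul_assoc, div_mul_cancel₀ _ this]
  ring

lemma mul_shrinkage_lt_one (hn : 1 ≤ n) {ρ : ℝ} (h0 : 0 ≤ ρ) (h1 : ρ < 1) :
    n * shrinkage n ρ < 1 := by
  have h := one_sub_mul_shrinkage hn h0
  have : 0 < (1 - ρ) / (1 + (n - 1) * ρ) := div_pos (by linarith) (equiWeight_denom_pos hn h0)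
  linarith

lemma equiWeight_apply (hn : 1 ≤ n) {ρ : ℝ} (h0 : 0 ≤ ρ) (h1 : ρ < 1) (j l : Fin n) :
    equiWeight n ρ j l = (1 - ρ)⁻¹ * ((if j = l then 1 else 0) - shrinkage n ρ) := by
  have hd := (equiWeight_denom_pos hn h0).ne'
  have hr : (1 - ρ) ≠ 0 := by linarith
  have : equiWeight n ρ = Matrix.of fun j l : Fin n =>
      (1 - ρ)⁻¹ * ((if j = l then (1 : ℝ) else 0) - shrinkage n ρ) := by
    refine Matrix.inv_eq_right_inv ?_
    ext j l
    simp only [Matrix.mul_apply, Matrix.of_apply, Matrix.one_apply]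
    have h : ∀ x, (if j = x then (1 : ℝ) else ρ) *
        ((1 - ρ)⁻¹ * ((if x = l then (1 : ℝ) else 0) - shrinkage n ρ)) =
        (1 - ρ)⁻¹ * ((if x = l then (if j = x then (1 : ℝ) else ρ) else 0) -
          ((if j = x then (1 - ρ) * shrinkage n ρ else 0) + ρ * shrinkage n ρ)) := by
      intro x; split_ifs <;> ring
    simp only [h]
    rw [← Finset.mul_sum, Finset.sum_sub_distrib, Finset.sum_add_distrib, Finset.sum_ite_eq',
      Finset.sum_ite_eq, if_pos (Finset.mem_univ _), if_pos (Finset.mem_univ _), Finset.sum_const,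
      Finset.card_univ, Fintype.card_fin, nsmul_eq_mul]
    have hS : shrinkage n ρ * (1 + (n - 1) * ρ) = ρ := div_mul_cancel₀ _ hd
    have e : (1 - ρ) * shrinkage n ρ + n * (ρ * shrinkage n ρ) = ρ := by linear_combination hS
    rw [e]
    split_ifs
    · exact inv_mul_cancel₀ hr
    · rw [sub_self, mul_zero]
  rw [this, Matrix.of_apply]

/-- The matrix of leaf memberships of the observations of one cluster with given labels. -/
def labelMatrix (M : ℕ) (c : Fin n → ℕ) : Matrix (Fin n) (Fin M) ℝ :=
  Matrix.of fun j m => if c j = m then 1 else 0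

/-- The Gram matrix of the generalised least squares problem. -/
def gramMatrix (ρ : ℝ) (M : ℕ) (L : Fin s → Fin n → ℕ) : Matrix (Fin M) (Fin M) ℝ :=
  ∑ i, (labelMatrix M (L i)).transpose * equiWeight n ρ * labelMatrix M (L i)

/-- The weight of the response `(i, j)` in the prediction at the leaf `l`. -/
def leafWeight (ρ : ℝ) (M : ℕ) (L : Fin s → Fin n → ℕ) (l : ℕ) (i : Fin s) (j : Fin n) : ℝ :=
  -- The value 0 for `l ≥ M` makes the weight a total function of discrete data, hence measurable in
  -- them.
  if h : l < M then ∑ m, (gramMatrix ρ M L)⁻¹ ⟨l, h⟩ m *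
    ((labelMatrix M (L i)).transpose * equiWeight n ρ) m j else 0

lemma clusteredTree_eq_sum (ρ : ℝ) (T : SplitTree) (E : Fin s → Cluster n) (x : ℝ) :
    clusteredTree ρ T E x = ∑ i, ∑ j,
      leafWeight ρ T.numLeaves (T.labels fun i => (E i).1) (T.leafOf x) i j * (E i).2 j := by
  have hm : ∀ i, leafMatrix T (E i).1 =
      labelMatrix T.numLeaves (T.labels (fun i => (E i).1) i) := by
    intro i
    ext j m
    simp only [leafMatrix, labelMatrix, Matrix.of_apply, SplitTree.labels, Fin.ext_iff]
    rfl
  simp only [clusteredTree, hm, leafWeight, Fin.is_lt, dite_true, Fin.eta]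
  rw [← gramMatrix, Matrix.mulVec, dotProduct]
  simp only [Finset.sum_apply, Matrix.mulVec, dotProduct, Finset.mul_sum, Finset.sum_mul]
  rw [Finset.sum_comm]
  refine Finset.sum_congr rfl fun i _ => ?_
  rw [Finset.sum_comm]
  refine Finset.sum_congr rfl fun j _ => Finset.sum_congr rfl fun m _ => by ring

lemma labelMatrix_mulVec {M : ℕ} {c : Fin n → ℕ} (hc : ∀ j, c j < M) (b : Fin M → ℝ) (j : Fin n) :
    (labelMatrix M c).mulVec b j = b ⟨c j, hc j⟩ := by
  simp only [Matrix.mulVec, dotProduct, labelMatrix, Matrix.of_apply, ite_mul, one_mul, zero_mul]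
  rw [Finset.sum_eq_single ⟨c j, hc j⟩]
  · simp
  · intro m _ hm
    rw [if_neg]
    rintro h
    exact hm (Fin.ext h.symm)
  · simp

lemma equiWeight_mulVec (hn : 1 ≤ n) {ρ : ℝ} (h0 : 0 ≤ ρ) (h1 : ρ < 1) (b : Fin n → ℝ) (j : Fin n) :
    (equiWeight n ρ).mulVec b j = (1 - ρ)⁻¹ * (b j - shrinkage n ρ * ∑ l, b l) := by
  simp only [Matrix.mulVec, dotProduct, equiWeight_apply hn h0 h1]
  have : ∀ x, (1 - ρ)⁻¹ * ((if j = x then (1 : ℝ) else 0) - shrinkage n ρ) * b x =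
      (1 - ρ)⁻¹ * ((if j = x then b x else 0) - shrinkage n ρ * b x) := by
    intro x; split_ifs <;> ring
  simp only [this]
  rw [← Finset.mul_sum, Finset.sum_sub_distrib, Finset.sum_ite_eq, if_pos (Finset.mem_univ _),
    Finset.mul_sum]

/-- W(ρ) is positive definite, so a kernel vector `b` of the Gram matrix vanishes at the label of
every observation, and every label occurs. -/
lemma isUnit_det_gramMatrix (hn : 1 ≤ n) {ρ : ℝ} (h0 : 0 ≤ ρ) (h1 : ρ < 1) {M : ℕ}
    {L : Fin s → Fin n → ℕ} (hlt : ∀ i j, L i j < M) (hne : ∀ m < M, ∃ i j, L i j = m) :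
    IsUnit (gramMatrix ρ M L).det := by
  rw [isUnit_iff_ne_zero]
  intro hdet
  obtain ⟨b, hb0, hb⟩ := Matrix.exists_mulVec_eq_zero_iff.2 hdet
  have hq : ∑ i, ((labelMatrix M (L i)).mulVec b) ⬝ᵥ
      ((equiWeight n ρ).mulVec ((labelMatrix M (L i)).mulVec b)) = 0 := by
    have : b ⬝ᵥ (gramMatrix ρ M L).mulVec b = 0 := by rw [hb, dotProduct_zero]
    rw [← this, gramMatrix, Matrix.sum_mulVec, dotProduct_sum]
    refine Finset.sum_congr rfl fun i _ => ?_
    rw [← Matrix.mulVec_mulVec, ← Matrix.mulVec_mulVec, Matrix.dotProduct_transpose_mulVec, dotProduct_comm]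
  have hpos : 0 < 1 - n * shrinkage n ρ := by linarith [mul_shrinkage_lt_one hn h0 h1]
  have hr : (0 : ℝ) < 1 - ρ := by linarith
  have hlow : ∀ c : Fin n → ℝ, (1 - ρ)⁻¹ * (1 - n * shrinkage n ρ) * ∑ j, c j ^ 2 ≤
      c ⬝ᵥ (equiWeight n ρ).mulVec c := by
    intro c
    have h2 : c ⬝ᵥ (equiWeight n ρ).mulVec c =
        (1 - ρ)⁻¹ * (∑ j, c j ^ 2 - shrinkage n ρ * (∑ j, c j) ^ 2) := by
      simp only [dotProduct, equiWeight_mulVec hn h0 h1]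
      have e : ∀ S x : ℝ, x * ((1 - ρ)⁻¹ * (x - shrinkage n ρ * S)) =
          (1 - ρ)⁻¹ * x ^ 2 - (1 - ρ)⁻¹ * shrinkage n ρ * S * x := fun S x => by ring
      simp only [e]
      rw [Finset.sum_sub_distrib, ← Finset.mul_sum, ← Finset.mul_sum]
      ring
    have hcs : (∑ j, c j) ^ 2 ≤ n * ∑ j, c j ^ 2 := by
      simpa using sq_sum_le_card_mul_sum_sq (s := Finset.univ) (f := c)
    rw [h2, mul_assoc]
    refine mul_le_mul_of_nonneg_left ?_ (inv_nonneg.2 hr.le)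
    nlinarith [mul_le_mul_of_nonneg_left hcs (shrinkage_nonneg hn h0)]
  have hc0 : 0 < (1 - ρ)⁻¹ * (1 - n * shrinkage n ρ) := mul_pos (inv_pos.2 hr) hpos
  have hz : ∀ i j, (labelMatrix M (L i)).mulVec b j = 0 := by
    have hnn : ∀ i ∈ Finset.univ, 0 ≤ (labelMatrix M (L i)).mulVec b ⬝ᵥ
        ((equiWeight n ρ).mulVec ((labelMatrix M (L i)).mulVec b)) := fun i _ =>
      (mul_nonneg hc0.le (Finset.sum_nonneg fun _ _ => sq_nonneg _)).trans (hlow _)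
    intro i j
    have h3 := (Finset.sum_eq_zero_iff_of_nonneg hnn).1 hq i (Finset.mem_univ i)
    have h4 : ∑ j, (labelMatrix M (L i)).mulVec b j ^ 2 ≤ 0 := by
      have h5 := hlow ((labelMatrix M (L i)).mulVec b)
      rw [h3] at h5
      by_contra! h6
      linarith [mul_pos hc0 h6]
    have h7 := (Finset.sum_eq_zero_iff_of_nonneg
      (fun j _ => sq_nonneg ((labelMatrix M (L i)).mulVec b j))).1
      (le_antisymm h4 (Finset.sum_nonneg fun _ _ => sq_nonneg _)) j (Finset.mem_univ j)
    exact pow_eq_zero_iff (two_ne_zero) |>.1 h7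
  refine hb0 (funext fun m => ?_)
  obtain ⟨i, j, hij⟩ := hne m m.isLt
  have := hz i j
  rw [labelMatrix_mulVec (hlt i)] at this
  rw [Pi.zero_apply, ← this]
  exact congrArg b (Fin.ext hij.symm)

lemma LabelRegular.exists_label {k M : ℕ} {L : Fin s → Fin n → ℕ} (h : LabelRegular k M L)
    (hk : 0 < k) {m : ℕ} (hm : m < M) : ∃ i j, L i j = m := by
  by_contra! hc
  have h0 : leafSize L m = 0 := by
    refine Finset.sum_eq_zero fun i _ => Finset.sum_eq_zero fun j _ => ?_
    rw [leafInd, if_neg (hc i j)]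
  have h1 := h.le_size m hm
  rw [h0] at h1
  have : (0 : ℝ) < k := by exact_mod_cast hk
  linarith

/-- Up to the factor (1 - ρ)⁻¹, row `l` of the inverse Gram matrix is the coefficient vector `a`.
The test identities are row `l` of A⁻¹A = 1. -/
lemma isLeafWeight_leafWeight (hn : 1 ≤ n) {ρ : ℝ} (h0 : 0 ≤ ρ) (h1 : ρ < 1) {k M : ℕ}
    {L : Fin s → Fin n → ℕ} (h : LabelRegular k M L) (hk : 0 < k) {l : ℕ} (hl : l < M) :
    IsLeafWeight (shrinkage n ρ) L l (leafWeight ρ M L l) := by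
  have hdet := isUnit_det_gramMatrix hn h0 h1 h.lt fun m hm => h.exists_label hk hm
  set A := gramMatrix ρ M L with hA
  have hw : ∀ i j, leafWeight ρ M L l i j =
      ((equiWeight n ρ).mulVec ((labelMatrix M (L i)).mulVec (A⁻¹ ⟨l, hl⟩))) j := by
    intro i j
    rw [leafWeight, dif_pos hl, ← hA]
    simp only [Matrix.mul_apply, Matrix.mulVec, dotProduct, Finset.mul_sum, Matrix.transpose_apply]
    rw [Finset.sum_comm]
    refine Finset.sum_congr rfl fun j' _ => Finset.sum_congr rfl fun m _ => ?_
    rw [equiWeight_apply hn h0 h1, equiWeight_apply hn h0 h1]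
    simp only [eq_comm]
    ring
  refine ⟨fun m => if hm : m < M then (1 - ρ)⁻¹ * A⁻¹ ⟨l, hl⟩ ⟨m, hm⟩ else 0, fun i j => ?_,
    fun b => ?_⟩
  · rw [hw, equiWeight_mulVec hn h0 h1]
    simp only [labelMatrix_mulVec (h.lt _), h.lt, dite_true]
    rw [← Finset.mul_sum]
    ring
  · have h2 : ∀ i, (labelMatrix M (L i)).mulVec (fun m : Fin M => b m) = fun j => b (L i j) :=
      fun i => funext fun j => labelMatrix_mulVec (h.lt i) _ j
    have h3 : ∀ i, ∑ j, leafWeight ρ M L l i j * b (L i j) = A⁻¹ ⟨l, hl⟩ ⬝ᵥ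
        (((labelMatrix M (L i)).transpose * equiWeight n ρ * labelMatrix M (L i)).mulVec
          fun m : Fin M => b m) := by
      intro i
      rw [← Matrix.mulVec_mulVec, h2]
      simp only [leafWeight, dif_pos hl, ← hA, dotProduct, Matrix.mulVec, Finset.sum_mul,
        Finset.mul_sum]
      rw [Finset.sum_comm]
      exact Finset.sum_congr rfl fun m _ => Finset.sum_congr rfl fun j _ => by ring
    simp only [h3]
    rw [← dotProduct_sum, ← Matrix.sum_mulVec, ← gramMatrix, ← hA]
    change A⁻¹.mulVec (A.mulVec fun m : Fin M => b m) ⟨l, hl⟩ = b l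
    rw [Matrix.mulVec_mulVec, Matrix.nonsing_inv_mul _ hdet, Matrix.one_mulVec]

lemma continuousOn_shrinkage (hn : 1 ≤ n) : ContinuousOn (shrinkage n) (Ico 0 1) := by
  unfold shrinkage
  exact continuousOn_id.div (by fun_prop) fun ρ hρ => (equiWeight_denom_pos hn hρ.1).ne'

lemma continuousOn_equiWeight (hn : 1 ≤ n) :
    ContinuousOn (fun ρ => equiWeight n ρ) (Ico 0 1) := by
  have : ContinuousOn (fun ρ => Matrix.of fun j l : Fin n =>
      (1 - ρ)⁻¹ * ((if j = l then (1 : ℝ) else 0) - shrinkage n ρ)) (Ico 0 1) := by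
    refine continuousOn_pi.2 fun j => continuousOn_pi.2 fun l => ?_
    refine ContinuousOn.mul (ContinuousOn.inv₀ (by fun_prop) fun ρ hρ => ?_)
      (continuousOn_const.sub (continuousOn_shrinkage hn))
    linarith [hρ.2]
  refine this.congr fun ρ hρ => ?_
  ext j l
  exact equiWeight_apply hn hρ.1 hρ.2 j l

lemma continuousOn_leafWeight (hn : 1 ≤ n) {k M : ℕ}
    {L : Fin s → Fin n → ℕ} (h : LabelRegular k M L) (hk : 0 < k) (l : ℕ) (i : Fin s) (j : Fin n) :
    ContinuousOn (fun ρ => leafWeight ρ M L l i j) (Ico 0 1) := by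
  unfold leafWeight
  split_ifs with hl
  · have hW := continuousOn_equiWeight hn
    have hG : ContinuousOn (fun ρ => gramMatrix ρ M L) (Ico 0 1) := by
      unfold gramMatrix
      refine continuousOn_finsetSum _ fun i _ => ?_
      have h1 : Continuous fun W : Matrix (Fin n) (Fin n) ℝ =>
          (labelMatrix M (L i)).transpose * W * labelMatrix M (L i) :=
        (continuous_const.matrix_mul continuous_id).matrix_mul continuous_const
      exact h1.comp_continuousOn hW
    have hinv : ContinuousOn (fun ρ => (gramMatrix ρ M L)⁻¹) (Ico 0 1) := by
      intro ρ hρ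
      refine ContinuousAt.comp_continuousWithinAt (g := fun A : Matrix (Fin M) (Fin M) ℝ => A⁻¹)
        ?_ (hG ρ hρ)
      refine continuousAt_matrix_inv _ ?_
      rw [Ring.inverse_eq_inv']
      exact continuousAt_inv₀ (isUnit_det_gramMatrix hn hρ.1 hρ.2 h.lt
        fun m hm => h.exists_label hk hm).ne_zero
    refine continuousOn_finsetSum _ fun m _ => ContinuousOn.mul ?_ ?_
    · exact (continuous_apply_apply (⟨l, hl⟩ : Fin M) m).comp_continuousOn hinv
    · have h1 : Continuous fun W : Matrix (Fin n) (Fin n) ℝ =>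
          ((labelMatrix M (L i)).transpose * W) m j :=
        (continuous_const.matrix_mul continuous_id).matrix_elem m j
      exact h1.comp_continuousOn hW
  · exact continuousOn_const

end MatrixWeights

/-! ### Second moments of linear forms in the noise -/

section NoiseIntegrals
variable {s n : ℕ} {r : ℝ}

/-- The law of the noise of all clusters. -/
def clusterNoise (s n : ℕ) (r : ℝ) : Measure (Fin s → Fin n → ℝ) :=
  Measure.pi fun _ => noiseLaw n r

instance : IsProbabilityMeasure (clusterNoise s n r) := by
  unfold clusterNoise; infer_instance

lemma memLp_sum_mul_noise (h0 : 0 ≤ r) (h1 : r ≤ 1) (a : Fin n → ℝ) (p : ℝ≥0∞) :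
    MemLp (fun e : Fin n → ℝ => ∑ j, a j * e j) p (noiseLaw n r) := by
  refine MemLp.of_bound (by fun_prop : Measurable _).aestronglyMeasurable (∑ j, |a j| * √(n + 1)) ?_
  filter_upwards [ae_abs_noise_le h0 h1] with e he
  refine (norm_sum_le _ _).trans (Finset.sum_le_sum fun j _ => ?_)
  rw [norm_mul]
  exact mul_le_mul_of_nonneg_left (he j) (abs_nonneg _)

lemma memLp_clusterNoise (h0 : 0 ≤ r) (h1 : r ≤ 1) (c : Fin s → Fin n → ℝ) (p : ℝ≥0∞) :
    MemLp (fun e => ∑ i, ∑ j, c i j * e i j) p (clusterNoise s n r) := by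
  refine memLp_finsetSum _ fun i _ => ?_
  exact (memLp_sum_mul_noise h0 h1 (c i) p).comp_measurePreserving
    (measurePreserving_eval (fun _ : Fin s => noiseLaw n r) i)

lemma integral_clusterNoise (h0 : 0 ≤ r) (h1 : r ≤ 1) (c : Fin s → Fin n → ℝ) :
    ∫ e, ∑ i, ∑ j, c i j * e i j ∂(clusterNoise s n r) = 0 := by
  have hmp := fun i => measurePreserving_eval (fun _ : Fin s => noiseLaw n r) i
  rw [integral_finsetSum]
  · refine Finset.sum_eq_zero fun i _ => ?_
    have h2 := integral_map (μ := clusterNoise s n r) (φ := Function.eval i)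
      (measurable_pi_apply i).aemeasurable
      (f := fun e : Fin n → ℝ => ∑ j, c i j * e j)
      (by fun_prop : Measurable _).aestronglyMeasurable
    rw [clusterNoise, (hmp i).map_eq] at h2
    rw [clusterNoise]
    refine h2.symm.trans ?_
    exact integral_sum_mul_noise r (c i)
  · intro i _
    exact memLp_one_iff_integrable.1 ((memLp_sum_mul_noise h0 h1 (c i) 1).comp_measurePreserving
      (hmp i))

/-- Clusters are independent, so variances add; each contributes the equicorrelated form of its
coefficients. -/
lemma integral_sq_clusterNoise (h0 : 0 ≤ r) (h1 : r ≤ 1) (c : Fin s → Fin n → ℝ) :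
    ∫ e, (∑ i, ∑ j, c i j * e i j) ^ 2 ∂(clusterNoise s n r) = equiForm r c := by
  have hm := memLp_clusterNoise h0 h1 c 2
  have hv : Var[fun e => ∑ i, ∑ j, c i j * e i j; clusterNoise s n r] =
      ∫ e, (∑ i, ∑ j, c i j * e i j) ^ 2 ∂(clusterNoise s n r) := by
    rw [variance_eq_integral hm.aemeasurable, integral_clusterNoise h0 h1 c]
    simp
  have h3 := variance_sum_pi (μ := fun _ : Fin s => noiseLaw n r)
    (X := fun i e => ∑ j, c i j * e j) fun i => memLp_sum_mul_noise h0 h1 (c i) 2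
  have h4 : (∑ i, fun ω : Fin s → Fin n → ℝ => ∑ j, c i j * ω i j) =
      fun e => ∑ i, ∑ j, c i j * e i j := by
    ext e; simp
  rw [h4] at h3
  rw [← hv, clusterNoise, h3, equiForm, Finset.mul_sum, Finset.mul_sum, ← Finset.sum_add_distrib]
  refine Finset.sum_congr rfl fun i _ => ?_
  rw [variance_eq_integral (memLp_sum_mul_noise h0 h1 (c i) 2).aemeasurable,
    integral_sum_mul_noise]
  simp only [sub_zero]
  exact integral_sq_sum_mul_noise h0 h1 (c i)

lemma lintegral_enorm_sq_clusterNoise (h0 : 0 ≤ r) (h1 : r ≤ 1) (c : Fin s → Fin n → ℝ) :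
    ∫⁻ e, ‖∑ i, ∑ j, c i j * e i j‖ₑ ^ 2 ∂(clusterNoise s n r) =
      ENNReal.ofReal (equiForm r c) := by
  rw [← integral_sq_clusterNoise h0 h1 c, ofReal_integral_eq_lintegral_ofReal
    (memLp_clusterNoise h0 h1 c 2).integrable_sq (ae_of_all _ fun e => sq_nonneg _)]
  refine lintegral_congr fun e => ?_
  rw [Real.enorm_eq_ofReal_abs, ← ENNReal.ofReal_pow (abs_nonneg _), sq_abs]

end NoiseIntegrals

/-! ### Separation of the evaluation noise from everything else -/

section BaseLaw
variable {s n : ℕ} {Ξ : Type*} [MeasurableSpace Ξ]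

/-- Splitting clusters, evaluation covariates and auxiliary randomness of one tree. -/
abbrev TreeBase (n s : ℕ) (Ξ : Type*) : Type _ :=
  (Fin s → Cluster n) × (Fin s → Fin n → ℝ) × Ξ

/-- The law of splitting clusters, evaluation covariates and auxiliary randomness. -/
def baseLaw (s : ℕ) (P : Measure (Cluster n)) (ν : Measure Ξ) : Measure (TreeBase n s Ξ) :=
  (Measure.pi fun _ : Fin s => P).prod ((covariateLaw s n).prod ν)

instance (P : Measure (Cluster n)) [IsProbabilityMeasure P] (ν : Measure Ξ)
    [IsProbabilityMeasure ν] : IsProbabilityMeasure (baseLaw s P ν) := by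
  unfold baseLaw; infer_instance

/-- The sample of one tree with noise `e` and noise scale `σ`. -/
def attachNoise (σ : ℝ → ℝ) (p : TreeBase n s Ξ × (Fin s → Fin n → ℝ)) : TreeSample n s Ξ :=
  (p.1.1, fun i => (p.1.2.1 i, applyScale σ (p.1.2.1 i) (p.2 i)), p.1.2.2)

lemma measurePreserving_clusters (r : ℝ) {σ : ℝ → ℝ} (hσ : Measurable σ) :
    MeasurePreserving (fun (p : (Fin s → Fin n → ℝ) × (Fin s → Fin n → ℝ)) (i : Fin s) =>
      (p.1 i, applyScale σ (p.1 i) (p.2 i)))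
      ((covariateLaw s n).prod (clusterNoise s n r))
      (Measure.pi fun _ : Fin s => scaleLaw n r σ hσ) := by
  have h1 := (measurePreserving_arrowProdEquivProdArrow (Fin n → ℝ) (Fin n → ℝ) (Fin s)
    (fun _ => Measure.pi fun _ : Fin n => unif) (fun _ => noiseLaw n r)).symm
  have h2 := measurePreserving_pi (fun _ : Fin s =>
      (Measure.pi fun _ : Fin n => unif).prod (noiseLaw n r)) (fun _ : Fin s => scaleLaw n r σ hσ)
    (f := fun _ p => (p.1, applyScale σ p.1 p.2)) fun _ =>
      ⟨measurable_fst.prodMk (measurable_applyScale hσ), (scaleLaw_eq_map hσ).symm⟩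
  exact h2.comp h1

/-- A rearrangement of product measures that puts the evaluation noise last, ready for Fubini
conditionally on the base data. -/
lemma measurePreserving_attachNoise (r : ℝ) {σ : ℝ → ℝ} (hσ : Measurable σ)
    (ν : Measure Ξ) [IsProbabilityMeasure ν] :
    MeasurePreserving (attachNoise σ)
      ((baseLaw s (scaleLaw n r σ hσ) ν).prod (clusterNoise s n r))
      (treeLaw s (scaleLaw n r σ hσ) ν) := by
  have h1 := measurePreserving_prodAssoc (Measure.pi fun _ : Fin s => scaleLaw n r σ hσ)
    ((covariateLaw s n).prod ν) (clusterNoise s n r)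
  have h2 := measurePreserving_prodAssoc (covariateLaw s n) ν (clusterNoise s n r)
  have h3 := (MeasurePreserving.id (covariateLaw s n)).prod
    (Measure.measurePreserving_swap (μ := ν) (ν := clusterNoise s n r))
  have h4 := (measurePreserving_prodAssoc (covariateLaw s n) (clusterNoise s n r) ν).symm
  have h5 := (measurePreserving_clusters (s := s) (n := n) r hσ).prod (MeasurePreserving.id ν)
  have h6 := ((h5.comp h4).comp h3).comp h2
  have h7 := ((MeasurePreserving.id (Measure.pi fun _ : Fin s => scaleLaw n r σ hσ)).prod h6).comp h1
  exact h7

end BaseLaw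

/-! ### The integrated variance as a mean of conditional variances -/

section Prediction
variable {s n : ℕ} {Ξ : Type*} [MeasurableSpace Ξ]

namespace SplittingRule

/-- The tree as a function of its base data. -/
def baseTree (R : SplittingRule n s Ξ) (b : TreeBase n s Ξ) : SplitTree := R.tree b.1 b.2.1 b.2.2

/-- The discrete data that determine the weights. -/
def leafData (R : SplittingRule n s Ξ) (p : ℝ × TreeBase n s Ξ) :
    ℕ × (Fin s → Fin n → ℕ) × ℕ :=
  ((R.baseTree p.2).numLeaves, (R.baseTree p.2).labels p.2.2.1, (R.baseTree p.2).leafOf p.1)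

lemma measurable_leafData (R : SplittingRule n s Ξ) : Measurable R.leafData := by
  refine Measurable.prodMk (R.measurable_numLeaves.comp measurable_snd) (Measurable.prodMk ?_ ?_)
  · refine measurable_pi_lambda _ fun i => measurable_pi_lambda _ fun j => ?_
    have : Measurable fun p : ℝ × TreeBase n s Ξ => (p.2, p.2.2.1 i j) := by fun_prop
    exact R.measurable_leafOf.comp this
  · exact R.measurable_leafOf.comp (measurable_snd.prodMk measurable_fst)

/-- The weight of the response `(i, j)` in the prediction at `x`. -/
def weight (R : SplittingRule n s Ξ) (ρ : ℝ) (p : ℝ × TreeBase n s Ξ) : Fin s → Fin n → ℝ :=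
  leafWeight ρ (R.leafData p).1 (R.leafData p).2.1 (R.leafData p).2.2

lemma measurable_weight (R : SplittingRule n s Ξ) (ρ : ℝ) (i : Fin s) (j : Fin n) :
    Measurable fun p => R.weight ρ p i j :=
  -- The weights factor through countable discrete data, on which every function is measurable.
  (Measurable.of_discrete (f := fun q : ℕ × (Fin s → Fin n → ℕ) × ℕ =>
    leafWeight ρ q.1 q.2.1 q.2.2 i j)).comp R.measurable_leafData

lemma prediction_eq_sum (R : SplittingRule n s Ξ) (ρ x : ℝ) (ω : TreeSample n s Ξ) :
    R.prediction ρ x ω = ∑ i, ∑ j,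
      R.weight ρ (x, ω.1, fun i => (ω.2.1 i).1, ω.2.2) i j * (ω.2.1 i).2 j :=
  clusteredTree_eq_sum _ _ _ _

lemma measurable_prediction (R : SplittingRule n s Ξ) (ρ x : ℝ) :
    Measurable (R.prediction ρ x) := by
  have : R.prediction ρ x = fun ω => ∑ i, ∑ j,
      R.weight ρ (x, ω.1, fun i => (ω.2.1 i).1, ω.2.2) i j * (ω.2.1 i).2 j :=
    funext (R.prediction_eq_sum ρ x)
  rw [this]
  refine Finset.measurable_sum _ fun i _ => Finset.measurable_sum _ fun j _ => ?_
  refine Measurable.mul ((R.measurable_weight ρ i j).comp ?_) (by fun_prop)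
  fun_prop

/-- The conditional variance of the prediction given the base data. -/
def condVariance (R : SplittingRule n s Ξ) (r : ℝ) (σ : ℝ → ℝ) (ρ : ℝ)
    (p : ℝ × TreeBase n s Ξ) : ℝ :=
  equiForm r fun i j => σ (p.2.2.1 i j) * R.weight ρ p i j

lemma measurable_condVariance (R : SplittingRule n s Ξ) (r : ℝ) {σ : ℝ → ℝ} (hσ : Measurable σ)
    (ρ : ℝ) : Measurable (R.condVariance r σ ρ) := by
  have hw := fun i j => R.measurable_weight ρ i j
  unfold condVariance equiForm
  fun_prop

lemma prediction_attachNoise (R : SplittingRule n s Ξ) (σ : ℝ → ℝ) (ρ x : ℝ)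
    (p : TreeBase n s Ξ × (Fin s → Fin n → ℝ)) :
    R.prediction ρ x (attachNoise σ p) = ∑ i, ∑ j,
      (σ (p.1.2.1 i j) * R.weight ρ (x, p.1) i j) * p.2 i j := by
  rw [prediction_eq_sum]
  refine Finset.sum_congr rfl fun i _ => Finset.sum_congr rfl fun j _ => ?_
  simp only [attachNoise, applyScale]
  ring

lemma integral_prediction (R : SplittingRule n s Ξ) {r : ℝ} (h0 : 0 ≤ r) (h1 : r ≤ 1)
    {σ : ℝ → ℝ} (hσ : Measurable σ) (ν : Measure Ξ) [IsProbabilityMeasure ν] (ρ x : ℝ) :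
    ∫ ω, R.prediction ρ x ω ∂(treeLaw s (scaleLaw n r σ hσ) ν) = 0 := by
  have hmp := measurePreserving_attachNoise (s := s) (n := n) r hσ ν
  rw [← hmp.map_eq, integral_map hmp.aemeasurable
    (R.measurable_prediction ρ x).aestronglyMeasurable]
  by_cases hint : Integrable (fun p => R.prediction ρ x (attachNoise σ p))
      ((baseLaw s (scaleLaw n r σ hσ) ν).prod (clusterNoise s n r))
  · rw [integral_prod _ hint]
    refine integral_eq_zero_of_ae (ae_of_all _ fun b => ?_)
    simp only [prediction_attachNoise]
    exact integral_clusterNoise h0 h1 _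
  -- Without integrability the Bochner integral is 0 by convention, so no moment bound is needed
  -- here.
  · exact integral_undef hint

/-- By honesty the weights depend on the base data alone. Given these data, the prediction has mean
zero, so no variance of conditional means appears. -/
lemma evariance_prediction (R : SplittingRule n s Ξ) {r : ℝ} (h0 : 0 ≤ r) (h1 : r ≤ 1)
    {σ : ℝ → ℝ} (hσ : Measurable σ) (ν : Measure Ξ) [IsProbabilityMeasure ν] (ρ x : ℝ) :
    evariance (R.prediction ρ x) (treeLaw s (scaleLaw n r σ hσ) ν) =
      ∫⁻ b, ENNReal.ofReal (R.condVariance r σ ρ (x, b)) ∂(baseLaw s (scaleLaw n r σ hσ) ν) := by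
  have hmp := measurePreserving_attachNoise (s := s) (n := n) r hσ ν
  have hmeas := R.measurable_prediction ρ x
  rw [evariance, R.integral_prediction h0 h1 hσ]
  simp only [sub_zero]
  rw [← hmp.map_eq, lintegral_map (by fun_prop) hmp.measurable]
  have hmeas' : Measurable fun p => ‖R.prediction ρ x (attachNoise σ p)‖ₑ ^ 2 :=
    (hmeas.enorm.pow_const 2).comp hmp.measurable
  rw [lintegral_prod _ hmeas'.aemeasurable]
  refine lintegral_congr fun b => ?_
  simp only [prediction_attachNoise]
  exact lintegral_enorm_sq_clusterNoise h0 h1 _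

lemma integratedVariance_eq (R : SplittingRule n s Ξ) {r : ℝ} (h0 : 0 ≤ r) (h1 : r ≤ 1)
    {σ : ℝ → ℝ} (hσ : Measurable σ) (ν : Measure Ξ) [IsProbabilityMeasure ν] (k : ℕ)
    (Q : Measure ℝ) [IsProbabilityMeasure Q] (ρ : ℝ) :
    R.integratedVariance ν k (scaleLaw n r σ hσ) Q ρ =
      ∫⁻ p, ENNReal.ofReal (k * R.condVariance r σ ρ p)
        ∂(Q.prod (baseLaw s (scaleLaw n r σ hσ) ν)) := by
  have hm := R.measurable_condVariance r hσ ρ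
  rw [lintegral_prod _ (by fun_prop), integratedVariance, ← lintegral_const_mul']
  · refine lintegral_congr fun x => ?_
    rw [R.evariance_prediction h0 h1 hσ, ← lintegral_const_mul' _ _ (by simp)]
    refine lintegral_congr fun b => ?_
    rw [ENNReal.ofReal_mul (Nat.cast_nonneg _), ENNReal.ofReal_natCast]
  · simp

end SplittingRule

end Prediction

/-! ### Almost sure regularity of the trees -/

section GeneralPosition
variable {s n : ℕ} {Ξ : Type*} [MeasurableSpace Ξ]

/-- Ties lie in finitely many proper linear subspaces, which are null sets. -/
lemma ae_injective_pi_unif (ι : Type*) [Fintype ι] :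
    ∀ᵐ Z ∂(Measure.pi fun _ : ι => unif), Function.Injective Z := by
  classical
  have hac : (Measure.pi fun _ : ι => unif) ≪ (volume : Measure (ι → ℝ)) := by
    unfold unif
    rw [← Measure.restrict_pi_pi]
    exact Measure.restrict_le_self.absolutelyContinuous
  have : ∀ᵐ Z ∂(volume : Measure (ι → ℝ)), ∀ p q : ι, p ≠ q → Z p ≠ Z q := by
    rw [ae_all_iff]
    intro p
    rw [ae_all_iff]
    intro q
    by_cases hpq : p = q
    · simp [hpq]
    · have hz := Measure.addHaar_submodule (volume : Measure (ι → ℝ))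
        (LinearMap.ker ((LinearMap.proj p : (ι → ℝ) →ₗ[ℝ] ℝ) - LinearMap.proj q)) (by
          intro htop
          have h1 : (Pi.single p 1 : ι → ℝ) ∈
              LinearMap.ker ((LinearMap.proj p : (ι → ℝ) →ₗ[ℝ] ℝ) - LinearMap.proj q) := by
            rw [htop]; trivial
          simp [Ne.symm hpq] at h1)
      rw [ae_iff]
      refine measure_mono_null (fun Z hZ => ?_) hz
      have hZ' : Z p = Z q := by
        by_contra hne
        exact hZ fun _ => hne
      simp [hZ']
  filter_upwards [hac.ae_le this] with Z hZ p q hpq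
  by_contra hne
  exact hZ p q hne hpq

lemma ae_generalPosition (s n : ℕ) : ∀ᵐ X ∂(covariateLaw s n), GeneralPosition X := by
  have hmp := measurePreserving_flatten (s := s) (n := n)
  have h1 := hmp.quasiMeasurePreserving.ae (ae_injective_pi_unif (Fin s × Fin n))
  have h2 : ∀ᵐ Z ∂(Measure.pi fun _ : Fin s × Fin n => unif), ∀ p, Z p ∈ Icc (0 : ℝ) 1 := by
    rw [ae_all_iff]
    intro p
    have h1 : ∀ᵐ z ∂unif, z ∈ Icc (0 : ℝ) 1 := ae_restrict_mem measurableSet_Icc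
    exact (Measure.quasiMeasurePreserving_eval (fun _ : Fin s × Fin n => unif) p).ae h1
  filter_upwards [h1, hmp.quasiMeasurePreserving.ae h2] with X hX hX2
  exact ⟨fun i j => hX2 (i, j), hX⟩

lemma ae_generalPosition_clusters (r : ℝ) {σ : ℝ → ℝ} (hσ : Measurable σ) :
    ∀ᵐ D ∂(Measure.pi fun _ : Fin s => scaleLaw n r σ hσ), GeneralPosition fun i => (D i).1 := by
  have h1 := measurePreserving_pi (fun _ : Fin s => scaleLaw n r σ hσ)
    (fun _ : Fin s => Measure.pi fun _ : Fin n => unif) (f := fun _ => Prod.fst) fun _ =>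
      ⟨measurable_fst, fst_scaleLaw hσ⟩
  exact h1.quasiMeasurePreserving.ae (ae_generalPosition s n)

lemma SplittingRule.IsRegular.ae_labelRegular {R : SplittingRule n s Ξ} {ν : Measure Ξ}
    [IsProbabilityMeasure ν] {α : ℝ} {k : ℕ} (h : R.IsRegular ν α k) (r : ℝ) {σ : ℝ → ℝ}
    (hσ : Measurable σ) :
    ∀ᵐ b ∂(baseLaw s (scaleLaw n r σ hσ) ν),
      LabelRegular k (R.baseTree b).numLeaves ((R.baseTree b).labels b.2.1) := by
  -- Fubini for almost sure statements needs a measurable event; label regularity is one, since it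
  -- is read off the discrete leaf data.
  have hm : MeasurableSet {b : TreeBase n s Ξ |
      LabelRegular k (R.baseTree b).numLeaves ((R.baseTree b).labels b.2.1)} := by
    have h1 : Measurable fun b : TreeBase n s Ξ => R.leafData (0, b) :=
      R.measurable_leafData.comp measurable_prodMk_left
    exact h1 (MeasurableSet.of_discrete
      (s := {q : ℕ × (Fin s → Fin n → ℕ) × ℕ | LabelRegular k q.1 q.2.1}))
  refine (Measure.ae_prod_mem_iff_ae_ae_mem hm).2 ?_
  filter_upwards [ae_generalPosition_clusters r hσ] with D hD
  refine (Measure.ae_prod_mem_iff_ae_ae_mem (measurable_prodMk_left hm)).2 ?_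
  filter_upwards [ae_generalPosition s n] with X hX
  filter_upwards [h D X hD hX] with ξ hξ
  exact hξ.labelRegular

end GeneralPosition

/-! ### Bounds on the conditional variance in tree-free terms -/

section Pointwise
variable {s n : ℕ} {Ξ : Type*} [MeasurableSpace Ξ]

/-- Linearises the square roots of error terms, so that first moments suffice after integration. -/
lemma sqrt_le_add_div {y ζ : ℝ} (hy : 0 ≤ y) (hζ : 0 < ζ) : √y ≤ ζ + y / ζ := by
  rw [← sub_le_iff_le_add', le_div_iff₀ hζ]
  nlinarith [Real.sq_sqrt hy, sq_nonneg (√y - ζ), Real.sqrt_nonneg y]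

/-- A bound for the sibling defect of the leaf that contains `x`. -/
def defectBound (k : ℕ) (X : Fin s → Fin n → ℝ) (x : ℝ) : ℝ :=
  2 * n ^ 3 / k + quadCount (2 * k) X x / k ^ 2

/-- A bound for the siblings in `U` of observations in the leaf that contains `x`. -/
def pairBound (k : ℕ) (U : Set ℝ) (X : Fin s → Fin n → ℝ) (x : ℝ) : ℝ :=
  n / k * pairCount (2 * k) U X x

open scoped Classical in
/-- A bound for the influence of a neighbourhood of `x₀` on the leaf that contains `x`. -/
def spillBound (k : ℕ) (d x₀ : ℝ) (X : Fin s → Fin n → ℝ) (x : ℝ) : ℝ :=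
  2 * pairBound k (Metric.ball x₀ d) X x +
    2 * ((if |x - x₀| < 2 * d then 1 else 0) + if Escapes (2 * k) d X x then 1 else 0)

lemma defectBound_nonneg (k : ℕ) (X : Fin s → Fin n → ℝ) (x : ℝ) : 0 ≤ defectBound k X x := by
  unfold defectBound; positivity

lemma pairBound_nonneg (k : ℕ) (U : Set ℝ) (X : Fin s → Fin n → ℝ) (x : ℝ) :
    0 ≤ pairBound k U X x := by
  unfold pairBound; positivity

/-- The tree of the base data `p.2` has regular leaves. -/
def SplittingRule.Good (R : SplittingRule n s Ξ) (k : ℕ) (p : ℝ × TreeBase n s Ξ) : Prop :=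
  LabelRegular k (R.leafData p).1 (R.leafData p).2.1

namespace SplittingRule.Good
variable {R : SplittingRule n s Ξ} {k : ℕ} {p : ℝ × TreeBase n s Ξ} {r η d x₀ ρ : ℝ}

lemma leaf_lt : (R.leafData p).2.2 < (R.leafData p).1 := ((R.baseTree p.2).leafOf p.1).isLt

lemma isLeafWeight (h : R.Good k p) (hk : 0 < k) (hn : 1 ≤ n) (hρ0 : 0 ≤ ρ) (hρ1 : ρ < 1) :
    IsLeafWeight (shrinkage n ρ) (R.leafData p).2.1 (R.leafData p).2.2 (R.weight ρ p) :=
  isLeafWeight_leafWeight hn hρ0 hρ1 h hk leaf_lt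

lemma leafSize_pos (h : R.Good k p) (hk : 0 < k) :
    0 < leafSize (R.leafData p).2.1 (R.leafData p).2.2 :=
  lt_of_lt_of_le (by exact_mod_cast hk) (h.le_size _ leaf_lt)

/-- Normalising by `k` instead of the leaf size costs at most a factor `2`. -/
lemma exists_ratio (h : R.Good k p) (hk : 0 < k) : ∃ t : ℝ, 1 / 2 ≤ t ∧ t ≤ 1 ∧ ∀ v : ℝ,
    k * v = t * (leafSize (R.leafData p).2.1 (R.leafData p).2.2 * v) := by
  have hN := h.leafSize_pos hk
  have h1 := h.le_size _ leaf_lt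
  have h2 := h.size_lt _ leaf_lt
  refine ⟨k / leafSize (R.leafData p).2.1 (R.leafData p).2.2, ?_, ?_, fun v => ?_⟩
  · rw [le_div_iff₀ hN]; linarith
  · rw [div_le_one hN]; exact h1
  · field_simp

lemma siblingDefect_le (h : R.Good k p) (hk : 0 < k) :
    siblingDefect k (R.leafData p).1 (R.leafData p).2.1 (R.leafData p).2.2 ≤
      defectBound k p.2.2.1 p.1 :=
  LabelRegular.siblingDefect_le (lab := fun x => ((R.baseTree p.2).leafOf x : ℕ)) (x := p.1)
    (X := p.2.2.1) h (R.baseTree p.2).monotone_leafOf (fun _ _ => rfl) leaf_lt hk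

lemma scaleFn_ne_one (hd : 0 < d) {u : ℝ} (h : scaleFn η d x₀ u ≠ 1) : u ∈ Metric.ball x₀ d := by
  by_contra hu
  refine h (scaleFn_eq_one hd ?_)
  simpa [Real.dist_eq] using hu

lemma siblingSpill_le (h : R.Good k p) (hk : 0 < k) (hd : 0 < d) :
    siblingSpill (fun i j => scaleFn η d x₀ (p.2.2.1 i j)) (R.leafData p).2.1 (R.leafData p).2.2 ≤
      pairBound k (Metric.ball x₀ d) p.2.2.1 p.1 :=
  LabelRegular.siblingSpill_le h (R.baseTree p.2).monotone_leafOf (fun _ _ => rfl) leaf_lt hk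
    fun _ _ => scaleFn_ne_one hd

lemma spill_le (h : R.Good k p) (hk : 0 < k) (hd : 0 < d) :
    spill (fun i j => scaleFn η d x₀ (p.2.2.1 i j)) (R.leafData p).2.1 (R.leafData p).2.2 ≤
      spillBound k d x₀ p.2.2.1 p.1 := by
  classical
  have hN := h.leafSize_pos hk
  have h1 := _root_.spill_le (sg := fun i j => scaleFn η d x₀ (p.2.2.1 i j))
    (lab := fun x => ((R.baseTree p.2).leafOf x : ℕ)) (x := p.1) hN
  have h2 := h.siblingSpill_le (η := η) (x₀ := x₀) hk hd
  refine h1.trans (add_le_add (mul_le_mul_of_nonneg_left h2 zero_le_two)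
    (mul_le_mul_of_nonneg_left ?_ zero_le_two))
  -- For a test point at distance 2d or more from x₀, the leaf meets the quiet ball only if its
  -- window reaches distance `d` from the test point.
  by_cases hx : |p.1 - x₀| < 2 * d
  · rw [if_pos hx]
    have : (0 : ℝ) ≤ if Escapes (2 * k) d p.2.2.1 p.1 then 1 else 0 := by split_ifs <;> norm_num
    refine le_trans ?_ (le_add_of_nonneg_right this)
    refine (div_le_one hN).2 ?_
    refine Finset.sum_le_sum fun i _ => Finset.sum_le_sum fun j _ => ?_
    split_ifs
    · exact leafInd_nonneg _ _ _ _
    · exact le_rfl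
  · rw [if_neg hx, zero_add]
    refine LabelRegular.sum_ite_leafInd_div_le h (R.baseTree p.2).monotone_leafOf
      (fun _ _ => rfl) hN fun i j hij => scaleFn_eq_one hd ?_
    have h3 := abs_sub_le p.1 (p.2.2.1 i j) x₀
    rw [abs_sub_comm p.1 (p.2.2.1 i j)] at h3
    linarith

lemma escape_le (h : R.Good k p) (hk : 0 < k) (hd : 0 < d) (hη : η ≤ 1) (hx : p.1 = x₀)
    [Decidable (Escapes (2 * k) (η * d) p.2.2.1 p.1)] :
    (∑ i, ∑ j, if scaleFn η d x₀ (p.2.2.1 i j) = η then 0 else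
      leafInd (R.leafData p).2.1 (R.leafData p).2.2 i j) /
      leafSize (R.leafData p).2.1 (R.leafData p).2.2 ≤
      if Escapes (2 * k) (η * d) p.2.2.1 p.1 then 1 else 0 :=
  LabelRegular.sum_ite_leafInd_div_le h (R.baseTree p.2).monotone_leafOf (fun _ _ => rfl)
    (sg := fun i j => scaleFn η d x₀ (p.2.2.1 i j))
    (h.leafSize_pos hk) fun i j hij => scaleFn_eq_left hη hd (by rw [← hx]; exact hij.le)

/-- The loss of weights near zero or near one compared with the weight `r`, which is optimal for
homoscedastic data. -/
lemma condVariance_sub_ge (h : R.Good k p) (hk : 0 < k) (hn : 2 ≤ n) (hd : 0 < d) (hη0 : 0 < η)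
    (hη1 : η ≤ 1) (hr0 : 0 < r) (hr1 : r < 1) (hρ0 : 0 ≤ ρ) (hρ1 : ρ < 1) {ζ g K : ℝ}
    (hζ : 0 < ζ) (hg : 0 ≤ g) (hK : K = (1 + (n - 1) * r) / (1 - r))
    (hρ : n * shrinkage n ρ ≤ 1 / 2 ∧
        (1 - r) / (1 - shrinkage n r) + g ≤ 1 - 2 * n * shrinkage n ρ ∨
      (1 - r) / (1 - shrinkage n r) + g ≤
        (1 - r) * (n / (n - 1)) - 4 * (1 - n * shrinkage n ρ)) :
    g / 2 - ζ * (n + 9 + n * K) - ((n + 9) / ζ + (1 + 1 / ζ) * n * (2 * K + 8) + 4 / η ^ 2) *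
        (defectBound k p.2.2.1 p.1 + spillBound k d x₀ p.2.2.1 p.1) ≤
      k * R.condVariance r (scaleFn η d x₀) ρ p - k * R.condVariance r (scaleFn η d x₀) r p := by
  have hn1 : 1 ≤ n := by omega
  have hn' : (2 : ℝ) ≤ n := by exact_mod_cast hn
  have hw := h.isLeafWeight hk hn1 hρ0 hρ1
  have hwr := h.isLeafWeight hk hn1 hr0.le hr1
  have hsg0 : ∀ i j, η ≤ scaleFn η d x₀ (p.2.2.1 i j) := fun i j => le_scaleFn hη1 _
  have hsgn : ∀ i j, 0 ≤ scaleFn η d x₀ (p.2.2.1 i j) := fun i j => hη0.le.trans (hsg0 i j)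
  have hsg1 : ∀ i j, scaleFn η d x₀ (p.2.2.1 i j) ≤ 1 := fun i j => scaleFn_le_one _
  have hD := h.siblingDefect_le hk
  have hS := h.spill_le (η := η) (x₀ := x₀) hk hd
  have hD0 : 0 ≤ siblingDefect k (R.leafData p).1 (R.leafData p).2.1 (R.leafData p).2.2 := by
    unfold siblingDefect; positivity
  have hS0 := spill_nonneg (fun i j => scaleFn η d x₀ (p.2.2.1 i j))
    (R.leafData p).2.1 (R.leafData p).2.2
  have hup := hwr.equiForm_mul_le hr0 hr1 h hk leaf_lt hn hsgn hsg1 hζ hK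
  have hlow1 := fun h1 => hw.equiForm_ge_of_near_zero (r := r) h hk leaf_lt hn
    (shrinkage_nonneg hn1 hρ0) h1 hr0.le hr1.le hsgn hsg1
  have hlow2 := hw.equiForm_ge_of_near_one (r := r) h hk leaf_lt hn (shrinkage_nonneg hn1 hρ0)
    (mul_shrinkage_lt_one hn1 hρ0 hρ1) hr0.le hr1.le hη0 hsg0
  -- Both variances carry the same random factor k/N in [1/2, 1]. The comparison is therefore made
  -- for each sample before integration, where it costs only half of the gap `g`.
  obtain ⟨t, ht0, ht1, ht⟩ := h.exists_ratio hk
  rw [ht, ht]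
  change _ ≤ t * (_ * equiForm r fun i j => scaleFn η d x₀ (p.2.2.1 i j) * R.weight ρ p i j) -
    t * (_ * equiForm r fun i j => scaleFn η d x₀ (p.2.2.1 i j) * R.weight r p i j)
  have hKpos : 0 < K := by rw [hK]; apply div_pos <;> nlinarith
  generalize siblingDefect k (R.leafData p).1 (R.leafData p).2.1 (R.leafData p).2.2 = δ at *
  generalize spill (fun i j => scaleFn η d x₀ (p.2.2.1 i j)) (R.leafData p).2.1
    (R.leafData p).2.2 = S at *
  generalize leafSize (R.leafData p).2.1 (R.leafData p).2.2 *
    equiForm r (fun i j => scaleFn η d x₀ (p.2.2.1 i j) * R.weight ρ p i j) = A at *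
  generalize leafSize (R.leafData p).2.1 (R.leafData p).2.2 *
    equiForm r (fun i j => scaleFn η d x₀ (p.2.2.1 i j) * R.weight r p i j) = B at *
  generalize defectBound k p.2.2.1 p.1 = δ' at *
  generalize spillBound k d x₀ p.2.2.1 p.1 = S' at *
  have e1 := sqrt_le_add_div hD0 hζ
  have e2 := sqrt_le_add_div hS0 hζ
  have hi : 0 < 1 / ζ := by positivity
  have hη2 : 0 < 4 / η ^ 2 := by positivity
  have q1 : √δ ≤ ζ + (δ' + S') / ζ := e1.trans (by gcongr; linarith)
  have q2 : √S ≤ ζ + (δ' + S') / ζ := e2.trans (by gcongr; linarith)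
  set T := δ' + S' with hT
  have hST : S ≤ T := by linarith
  have hδT : δ ≤ T := by linarith
  have hTn : 0 ≤ T := by linarith
  have hup' : B ≤ (1 - r) / (1 - shrinkage n r) + n * (ζ + T / ζ) + ζ * (n * K) +
      (1 + 1 / ζ) * n * (2 * K + 8) * T := by
    refine hup.trans ?_
    have a1 : (n : ℝ) * √δ ≤ n * (ζ + T / ζ) := by gcongr
    have a2 : (1 + 1 / ζ) * n * (2 * K * δ + 8 * S) ≤ (1 + 1 / ζ) * n * (2 * K * T + 8 * T) := by
      gcongr
    have a3 : (1 + 1 / ζ) * n * (2 * K * T + 8 * T) = (1 + 1 / ζ) * n * (2 * K + 8) * T := by ring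
    unfold shrinkage
    linarith
  have hlow : (1 - r) / (1 - shrinkage n r) + g - 9 * (ζ + T / ζ) - 4 / η ^ 2 * T ≤ A := by
    have a1 : 4 / η ^ 2 * S ≤ 4 / η ^ 2 * T := by gcongr
    have a2 : 0 ≤ 4 / η ^ 2 * T := by positivity
    have a3 : 0 ≤ ζ + T / ζ := by positivity
    rcases hρ with ⟨h1, h2⟩ | h2
    · have := hlow1 h1
      linarith
    · linarith
  set E := ζ * (n + 9 + n * K) + ((n + 9) / ζ + (1 + 1 / ζ) * n * (2 * K + 8) + 4 / η ^ 2) * T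
    with hE
  have hE0 : 0 ≤ E := by positivity
  have hAB : g - E ≤ A - B := by
    have : E = n * (ζ + T / ζ) + ζ * (n * K) + (1 + 1 / ζ) * n * (2 * K + 8) * T +
      (9 * (ζ + T / ζ) + 4 / η ^ 2 * T) := by rw [hE]; ring
    linarith
  have h5 : t * (g - E) ≤ t * (A - B) := by gcongr
  have h6 : g / 2 - E ≤ t * (g - E) := by nlinarith
  linarith

/-- The variance at `x₀` of a weight that is not close to zero. -/
lemma condVariance_ge_of_le (h : R.Good k p) (hk : 0 < k) (hn : 2 ≤ n) (hd : 0 < d) (hη0 : 0 < η)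
    (hη1 : η ≤ 1) (hr0 : 0 < r) (hr1 : r < 1) (hρ0 : 0 ≤ ρ) (hρ1 : ρ < 1) {ζ θ : ℝ}
    (hζ : 0 < ζ) (hθ0 : 0 ≤ θ) (hθ : θ ≤ shrinkage n ρ) :
    (1 - r) * θ ^ 2 / n ^ 2 / 2 - 4 * ζ - 4 / ζ * defectBound k p.2.2.1 p.1 -
      1 / η ^ 2 * pairBound k (Metric.ball x₀ d) p.2.2.1 p.1 ≤
      k * R.condVariance r (scaleFn η d x₀) ρ p := by
  have hn1 : 1 ≤ n := by omega
  have hw := h.isLeafWeight hk hn1 hρ0 hρ1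
  have hsg0 : ∀ i j, η ≤ scaleFn η d x₀ (p.2.2.1 i j) := fun i j => le_scaleFn hη1 _
  have hD := h.siblingDefect_le hk
  have hS := h.siblingSpill_le (η := η) (x₀ := x₀) hk hd
  have hD0 : 0 ≤ siblingDefect k (R.leafData p).1 (R.leafData p).2.1 (R.leafData p).2.2 := by
    unfold siblingDefect; positivity
  have hS0 := siblingSpill_nonneg (fun i j => scaleFn η d x₀ (p.2.2.1 i j))
    (R.leafData p).2.1 (R.leafData p).2.2
  have hlow := hw.equiForm_ge_of_le (r := r) h hk leaf_lt hn (shrinkage_nonneg hn1 hρ0)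
    (mul_shrinkage_lt_one hn1 hρ0 hρ1) hr0.le hr1.le hη0 hsg0
  obtain ⟨t, ht0, ht1, ht⟩ := h.exists_ratio hk
  rw [ht]
  change _ ≤ t * (_ * equiForm r fun i j => scaleFn η d x₀ (p.2.2.1 i j) * R.weight ρ p i j)
  have hmono : (1 - r) * θ ^ 2 / n ^ 2 ≤ (1 - r) * shrinkage n ρ ^ 2 / n ^ 2 := by
    have : 0 ≤ 1 - r := by linarith
    gcongr
  have hb0 : 0 ≤ (1 - r) * θ ^ 2 / n ^ 2 := by
    have : 0 ≤ 1 - r := by linarith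
    positivity
  generalize siblingDefect k (R.leafData p).1 (R.leafData p).2.1 (R.leafData p).2.2 = δ at *
  generalize siblingSpill (fun i j => scaleFn η d x₀ (p.2.2.1 i j)) (R.leafData p).2.1
    (R.leafData p).2.2 = S at *
  generalize leafSize (R.leafData p).2.1 (R.leafData p).2.2 *
    equiForm r (fun i j => scaleFn η d x₀ (p.2.2.1 i j) * R.weight ρ p i j) = A at *
  generalize defectBound k p.2.2.1 p.1 = δ' at *
  generalize pairBound k (Metric.ball x₀ d) p.2.2.1 p.1 = S' at *
  generalize (1 - r) * shrinkage n ρ ^ 2 / n ^ 2 = b' at *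
  generalize (1 - r) * θ ^ 2 / n ^ 2 = b at *
  have e1 := sqrt_le_add_div hD0 hζ
  have q1 : δ / ζ ≤ δ' / ζ := by gcongr
  have q2 : 1 / η ^ 2 * S ≤ 1 / η ^ 2 * S' := by gcongr
  have q3 : 4 / ζ * δ' = 4 * (δ' / ζ) := by ring
  have q4 : 0 ≤ δ' / ζ := div_nonneg (by linarith) hζ.le
  have q5 : 0 ≤ 1 / η ^ 2 * S' := mul_nonneg (by positivity) (by linarith)
  set E := 4 * ζ + 4 / ζ * δ' + 1 / η ^ 2 * S' with hE
  have hE0 : 0 ≤ E := by linarith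
  have hA : b - E ≤ A := by linarith
  have h5 : t * (b - E) ≤ t * A := by gcongr
  nlinarith

open scoped Classical in
/-- The variance at `x₀` of the weight zero. -/
lemma condVariance_zero_le (h : R.Good k p) (hk : 0 < k) (hn : 2 ≤ n) (hd : 0 < d) (hη0 : 0 < η)
    (hη1 : η ≤ 1) (hr0 : 0 < r) (hr1 : r < 1) {ζ : ℝ} (hζ : 0 < ζ) (hx : p.1 = x₀) :
    k * R.condVariance r (scaleFn η d x₀) 0 p ≤
      η ^ 2 + ζ + 1 / ζ * defectBound k p.2.2.1 p.1 +
        if Escapes (2 * k) (η * d) p.2.2.1 p.1 then 1 else 0 := by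
  have hw := h.isLeafWeight hk (by omega) le_rfl zero_lt_one
  rw [shrinkage, zero_div] at hw
  have hsg0 : ∀ i j, 0 ≤ scaleFn η d x₀ (p.2.2.1 i j) := fun i j => hη0.le.trans (le_scaleFn hη1 _)
  have hup := hw.equiForm_le_of_zero (r := r) (η := η) h hk leaf_lt hr0.le hr1.le hsg0
    fun i j => scaleFn_le_one _
  have hesc := h.escape_le hk hd hη1 hx
  have hD := h.siblingDefect_le hk
  have hD0 : 0 ≤ siblingDefect k (R.leafData p).1 (R.leafData p).2.1 (R.leafData p).2.2 := by
    unfold siblingDefect; positivity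
  obtain ⟨t, ht0, ht1, ht⟩ := h.exists_ratio hk
  rw [ht]
  have hA0 : 0 ≤ leafSize (R.leafData p).2.1 (R.leafData p).2.2 *
      R.condVariance r (scaleFn η d x₀) 0 p :=
    mul_nonneg (leafSize_nonneg _ _) (equiForm_nonneg hr0.le hr1.le _)
  refine (mul_le_of_le_one_left hA0 ht1).trans (hup.trans ?_)
  have e1 := sqrt_le_add_div hD0 hζ
  have e2 : siblingDefect k (R.leafData p).1 (R.leafData p).2.1 (R.leafData p).2.2 / ζ ≤
    defectBound k p.2.2.1 p.1 / ζ := by gcongr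
  rw [one_div_mul_eq_div]
  linarith

/-- The constraint that the weights sum to 1 over the leaf forces N‖w‖² ≥ 1 by Cauchy-Schwarz. The
resulting positivity of the risk is needed for the denominator of the ratio. -/
lemma condVariance_pos (h : R.Good k p) (hk : 0 < k) (hn : 2 ≤ n) (hη0 : 0 < η)
    (hη1 : η ≤ 1) (hr0 : 0 < r) (hr1 : r < 1) (hρ0 : 0 ≤ ρ) (hρ1 : ρ < 1) :
    (1 - r) * η ^ 2 / 2 ≤ k * R.condVariance r (scaleFn η d x₀) ρ p := by
  have hw := h.isLeafWeight hk (by omega) hρ0 hρ1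
  have hN := h.leafSize_pos hk
  obtain ⟨t, ht0, ht1, ht⟩ := h.exists_ratio hk
  rw [ht]
  have h1 : 1 ≤ leafSize (R.leafData p).2.1 (R.leafData p).2.2 *
      ∑ i, ∑ j, R.weight ρ p i j ^ 2 := by
    have h2 := hw.sum_mul_leafInd
    have h3 : 0 ≤ ∑ i, ∑ j, (leafSize (R.leafData p).2.1 (R.leafData p).2.2 * R.weight ρ p i j -
        leafInd (R.leafData p).2.1 (R.leafData p).2.2 i j) ^ 2 :=
      Finset.sum_nonneg fun _ _ => Finset.sum_nonneg fun _ _ => sq_nonneg _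
    have h4 : ∀ i j, (leafSize (R.leafData p).2.1 (R.leafData p).2.2 * R.weight ρ p i j -
        leafInd (R.leafData p).2.1 (R.leafData p).2.2 i j) ^ 2 =
        leafSize (R.leafData p).2.1 (R.leafData p).2.2 ^ 2 * R.weight ρ p i j ^ 2 -
        2 * leafSize (R.leafData p).2.1 (R.leafData p).2.2 * (R.weight ρ p i j *
          leafInd (R.leafData p).2.1 (R.leafData p).2.2 i j) +
        leafInd (R.leafData p).2.1 (R.leafData p).2.2 i j := fun i j => by
      rw [sub_sq, sq (leafInd _ _ _ _), leafInd_mul_self]; ring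
    simp only [h4, Finset.sum_add_distrib, Finset.sum_sub_distrib, ← Finset.mul_sum] at h3
    rw [h2, ← leafSize] at h3
    by_contra! h5
    have := mul_lt_mul_of_pos_left h5 hN
    nlinarith
  have h2 : (1 - r) * (η ^ 2 * ∑ i, ∑ j, R.weight ρ p i j ^ 2) ≤
      R.condVariance r (scaleFn η d x₀) ρ p := by
    refine le_trans ?_ (equiForm_ge hr0.le _)
    refine mul_le_mul_of_nonneg_left ?_ (by linarith)
    simp only [Finset.mul_sum]
    refine Finset.sum_le_sum fun i _ => Finset.sum_le_sum fun j _ => ?_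
    rw [mul_pow]
    gcongr
    exact le_scaleFn hη1 _
  have hc : 0 < (1 - r) * η ^ 2 := mul_pos (by linarith) (by positivity)
  have h3 : (1 - r) * η ^ 2 ≤ leafSize (R.leafData p).2.1 (R.leafData p).2.2 *
      R.condVariance r (scaleFn η d x₀) ρ p := by
    have h4 := mul_le_mul_of_nonneg_left h2 hN.le
    have h5 := mul_le_mul_of_nonneg_left h1 hc.le
    nlinarith
  nlinarith

lemma condVariance_nonneg (hr0 : 0 ≤ r) (hr1 : r ≤ 1) {σ : ℝ → ℝ} :
    0 ≤ k * R.condVariance r σ ρ p :=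
  mul_nonneg (Nat.cast_nonneg _) (equiForm_nonneg hr0 hr1 _)

/-- A bound that does not depend on the sample, used for domination on compact subintervals of
[0,1). The blow-up at 1 comes from the eigenvalue 1 - nθ. -/
lemma condVariance_le (h : R.Good k p) (hk : 0 < k) (hn : 2 ≤ n) (hη0 : 0 ≤ η)
    (hη1 : η ≤ 1) (hr0 : 0 ≤ r) (hr1 : r ≤ 1) (hρ0 : 0 ≤ ρ) (hρ1 : ρ < 1) :
    k * R.condVariance r (scaleFn η d x₀) ρ p ≤ n ^ 2 / (1 - ρ) := by
  have hn1 : 1 ≤ n := by omega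
  have hn' : (2 : ℝ) ≤ n := by exact_mod_cast hn
  have hw := h.isLeafWeight hk hn1 hρ0 hρ1
  have hN := h.leafSize_pos hk
  obtain ⟨t, ht0, ht1, ht⟩ := h.exists_ratio hk
  rw [ht]
  have hA0 : 0 ≤ leafSize (R.leafData p).2.1 (R.leafData p).2.2 *
      R.condVariance r (scaleFn η d x₀) ρ p :=
    mul_nonneg hN.le (equiForm_nonneg hr0 hr1 _)
  refine (mul_le_of_le_one_left hA0 ht1).trans ?_
  have h2 : R.condVariance r (scaleFn η d x₀) ρ p ≤ n * ∑ i, ∑ j, R.weight ρ p i j ^ 2 := by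
    refine (equiForm_le_mul hn hr0 hr1 _).trans ?_
    refine mul_le_mul_of_nonneg_left (Finset.sum_le_sum fun i _ => Finset.sum_le_sum fun j _ => ?_)
      (Nat.cast_nonneg _)
    rw [mul_pow]
    exact mul_le_of_le_one_left (sq_nonneg _)
      (pow_le_one₀ (hη0.trans (le_scaleFn hη1 _)) (scaleFn_le_one _))
  have h3 := hw.leafSize_mul_sum_sq_le hN (shrinkage_nonneg hn1 hρ0)
    (mul_shrinkage_lt_one hn1 hρ0 hρ1)
  rw [one_sub_mul_shrinkage hn1 hρ0, one_div_div] at h3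
  have h4 : (1 + ((n : ℝ) - 1) * ρ) / (1 - ρ) ≤ n / (1 - ρ) := by
    have : 0 < 1 - ρ := by linarith
    gcongr
    nlinarith
  calc _ ≤ leafSize (R.leafData p).2.1 (R.leafData p).2.2 *
        (n * ∑ i, ∑ j, R.weight ρ p i j ^ 2) := by gcongr
    _ = n * (leafSize (R.leafData p).2.1 (R.leafData p).2.2 *
        ∑ i, ∑ j, R.weight ρ p i j ^ 2) := by ring
    _ ≤ n * (n / (1 - ρ)) := by gcongr; exact h3.trans h4
    _ = n ^ 2 / (1 - ρ) := by ring

lemma continuousOn_condVariance (h : R.Good k p) (hk : 0 < k) (hn : 1 ≤ n) (σ : ℝ → ℝ) :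
    ContinuousOn (fun ρ => k * R.condVariance r σ ρ p) (Ico 0 1) := by
  have hw : ∀ i j, ContinuousOn (fun ρ => R.weight ρ p i j) (Ico 0 1) := fun i j =>
    continuousOn_leafWeight hn h hk _ i j
  unfold SplittingRule.condVariance equiForm
  fun_prop

end SplittingRule.Good

end Pointwise

/-! ### Expectations of the tree-free error bounds -/

section Expectations
variable {s n : ℕ} {Ξ : Type*} [MeasurableSpace Ξ] {r : ℝ} {σ : ℝ → ℝ} (hσ : Measurable σ)
  (ν : Measure Ξ) [IsProbabilityMeasure ν] (Q : Measure ℝ) [IsProbabilityMeasure Q]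

/-- The joint law of the test point and the base data. -/
def testLaw (s n : ℕ) (r : ℝ) {σ : ℝ → ℝ} (hσ : Measurable σ) (ν : Measure Ξ) (Q : Measure ℝ) :
    Measure (ℝ × TreeBase n s Ξ) :=
  Q.prod (baseLaw s (scaleLaw n r σ hσ) ν)

instance : IsProbabilityMeasure (testLaw s n r hσ ν Q) := by
  unfold testLaw; infer_instance

/-- The error bounds involve only the evaluation covariates, so a bound uniform in the test point
integrates against every `Q` on [0,1]. -/
lemma integral_covariates_le (hQ : ∀ᵐ x ∂Q, x ∈ Icc (0 : ℝ) 1)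
    {f : (Fin s → Fin n → ℝ) → ℝ → ℝ} (hf : Measurable fun q : (Fin s → Fin n → ℝ) × ℝ => f q.1 q.2)
    (h0 : ∀ X x, 0 ≤ f X x) {c : ℝ} (hc0 : 0 ≤ c)
    (hc : ∀ x ∈ Icc (0 : ℝ) 1, ∫⁻ X, ENNReal.ofReal (f X x) ∂(covariateLaw s n) ≤
      ENNReal.ofReal c) :
    Integrable (fun p : ℝ × TreeBase n s Ξ => f p.2.2.1 p.1) (testLaw s n r hσ ν Q) ∧
      ∫ p, f p.2.2.1 p.1 ∂(testLaw s n r hσ ν Q) ≤ c := by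
  have hm : Measurable fun p : ℝ × TreeBase n s Ξ => f p.2.2.1 p.1 :=
    hf.comp (by fun_prop : Measurable fun p : ℝ × TreeBase n s Ξ => (p.2.2.1, p.1))
  have hX : MeasurePreserving (fun b : TreeBase n s Ξ => b.2.1)
      (baseLaw s (scaleLaw n r σ hσ) ν) (covariateLaw s n) :=
    (measurePreserving_fst (μ := covariateLaw s n) (ν := ν)).comp measurePreserving_snd
  have hlin : ∫⁻ p, ENNReal.ofReal (f p.2.2.1 p.1) ∂(testLaw s n r hσ ν Q) ≤ ENNReal.ofReal c := by
    rw [testLaw, lintegral_prod _ (by fun_prop)]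
    calc _ ≤ ∫⁻ _, ENNReal.ofReal c ∂Q := by
          refine lintegral_mono_ae ?_
          filter_upwards [hQ] with x hx
          have hfx : Measurable fun X => ENNReal.ofReal (f X x) :=
            (hf.comp (measurable_id.prodMk measurable_const)).ennreal_ofReal
          exact (hX.lintegral_comp hfx).trans_le (hc x hx)
      _ = _ := by simp
  refine ⟨⟨hm.aestronglyMeasurable, ?_⟩, ?_⟩
  · rw [hasFiniteIntegral_iff_ofReal (ae_of_all _ fun p => h0 _ _)]
    exact hlin.trans_lt ENNReal.ofReal_lt_top
  · rw [integral_eq_lintegral_of_nonneg_ae (ae_of_all _ fun p => h0 _ _) hm.aestronglyMeasurable]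
    exact ENNReal.toReal_le_of_le_ofReal hc0 hlin

/-- The window size is K = 2k, hence the constant 512·8 = 4096. -/
lemma integral_defectBound_le (hQ : ∀ᵐ x ∂Q, x ∈ Icc (0 : ℝ) 1) (hs : 2 ≤ s) (hn : 2 ≤ n) {k : ℕ}
    (hk : 0 < k) :
    Integrable (fun p : ℝ × TreeBase n s Ξ => defectBound k p.2.2.1 p.1) (testLaw s n r hσ ν Q) ∧
      ∫ p, defectBound k p.2.2.1 p.1 ∂(testLaw s n r hσ ν Q) ≤
        2 * n ^ 3 / k + 4096 * n * (k / s) := by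
  have hk' : (0 : ℝ) < k := by exact_mod_cast hk
  have hs' : (0 : ℝ) < s := by exact_mod_cast (by omega : 0 < s)
  have hq : Measurable fun q : (Fin s → Fin n → ℝ) × ℝ => (quadCount (2 * k) q.1 q.2 : ℝ) :=
    (measurable_from_top (f := fun m : ℕ => (m : ℝ))).comp (measurable_quadCount (2 * k))
  refine integral_covariates_le hσ ν Q hQ (f := fun X x => defectBound k X x) ?_
    (defectBound_nonneg k) (by positivity) fun x _ => ?_
  · unfold defectBound
    fun_prop
  · have h1 : ∀ X : Fin s → Fin n → ℝ, ENNReal.ofReal (defectBound k X x) =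
        ENNReal.ofReal (2 * n ^ 3 / k) +
          ENNReal.ofReal (1 / k ^ 2) * (quadCount (2 * k) X x : ℝ≥0∞) := by
      intro X
      rw [defectBound, ENNReal.ofReal_add (by positivity) (by positivity),
        ← ENNReal.ofReal_natCast (quadCount (2 * k) X x), ← ENNReal.ofReal_mul (by positivity)]
      congr 2
      ring
    simp only [h1]
    rw [lintegral_add_left measurable_const, lintegral_const, measure_univ, mul_one,
      lintegral_const_mul' _ _ ENNReal.ofReal_ne_top]
    refine (add_le_add le_rfl (mul_le_mul_right (lintegral_quadCount_le hs hn (2 * k) x) _)).trans ?_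
    rw [← ENNReal.ofReal_mul (by positivity), ← ENNReal.ofReal_add (by positivity) (by positivity)]
    refine ENNReal.ofReal_le_ofReal (le_of_eq ?_)
    push_cast
    field_simp
    ring

lemma unif_real_ball_le {x₀ d : ℝ} (hd : 0 ≤ d) : unif.real (Metric.ball x₀ d) ≤ 2 * d := by
  refine ENNReal.toReal_le_of_le_ofReal (by positivity) ?_
  refine (Measure.restrict_apply_le _ _).trans ?_
  rw [Real.volume_ball]

lemma integral_pairBound_le (hQ : ∀ᵐ x ∂Q, x ∈ Icc (0 : ℝ) 1) (hs : 1 ≤ s) (hn : 2 ≤ n) {k : ℕ}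
    (hk : 0 < k) {x₀ d : ℝ} (hd : 0 ≤ d) :
    Integrable (fun p : ℝ × TreeBase n s Ξ => pairBound k (Metric.ball x₀ d) p.2.2.1 p.1)
      (testLaw s n r hσ ν Q) ∧
      ∫ p, pairBound k (Metric.ball x₀ d) p.2.2.1 p.1 ∂(testLaw s n r hσ ν Q) ≤
        16 * n ^ 2 * d := by
  have hk' : (0 : ℝ) < k := by exact_mod_cast hk
  have hq : Measurable fun q : (Fin s → Fin n → ℝ) × ℝ =>
      (pairCount (2 * k) (Metric.ball x₀ d) q.1 q.2 : ℝ) :=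
    (measurable_from_top (f := fun m : ℕ => (m : ℝ))).comp
      (measurable_pairCount (2 * k) measurableSet_ball)
  refine integral_covariates_le hσ ν Q hQ (f := fun X x => pairBound k (Metric.ball x₀ d) X x) ?_
    (pairBound_nonneg k _) (by positivity) fun x _ => ?_
  · unfold pairBound
    fun_prop
  · have h1 : ∀ X : Fin s → Fin n → ℝ, ENNReal.ofReal (pairBound k (Metric.ball x₀ d) X x) =
        ENNReal.ofReal (n / k) * (pairCount (2 * k) (Metric.ball x₀ d) X x : ℝ≥0∞) := by
      intro X
      rw [pairBound, ENNReal.ofReal_mul (by positivity), ENNReal.ofReal_natCast]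
    simp only [h1]
    rw [lintegral_const_mul' _ _ ENNReal.ofReal_ne_top]
    refine (mul_le_mul_right (lintegral_pairCount_le hs hn (2 * k) x measurableSet_ball) _).trans ?_
    rw [← ENNReal.ofReal_mul (by positivity)]
    refine ENNReal.ofReal_le_ofReal ?_
    calc (n : ℝ) / k * (4 * (2 * k : ℕ) * n * unif.real (Metric.ball x₀ d))
        = 8 * n ^ 2 * unif.real (Metric.ball x₀ d) := by
          push_cast
          field_simp
          ring
      _ ≤ 8 * n ^ 2 * (2 * d) := by gcongr; exact unif_real_ball_le hd
      _ = 16 * n ^ 2 * d := by ring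

open scoped Classical in
lemma integral_escapes_le (hQ : ∀ᵐ x ∂Q, x ∈ Icc (0 : ℝ) 1) (hs : 1 ≤ s) (hn : 1 ≤ n) {K : ℕ}
    {ε : ℝ} (hε : 0 < ε) (hK : 2 * K ≤ s * n * ε) :
    Integrable (fun p : ℝ × TreeBase n s Ξ =>
      if Escapes K ε p.2.2.1 p.1 then (1 : ℝ) else 0) (testLaw s n r hσ ν Q) ∧
      ∫ p, (if Escapes K ε p.2.2.1 p.1 then (1 : ℝ) else 0) ∂(testLaw s n r hσ ν Q) ≤
        8 / (s * n * ε) := by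
  refine integral_covariates_le hσ ν Q hQ
    (f := fun X x => if Escapes K ε X x then (1 : ℝ) else 0) ?_
    (fun X x => by split_ifs <;> norm_num) (by positivity) fun x hx => ?_
  · exact Measurable.ite (measurableSet_escapes K ε) measurable_const measurable_const
  · have hms : MeasurableSet {X : Fin s → Fin n → ℝ | Escapes K ε X x} :=
      measurable_prodMk_right (measurableSet_escapes K ε)
    have h1 : ∀ X : Fin s → Fin n → ℝ,
        ENNReal.ofReal (if Escapes K ε X x then (1 : ℝ) else 0) =
          {X : Fin s → Fin n → ℝ | Escapes K ε X x}.indicator 1 X := by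
      intro X
      simp only [indicator_apply, Pi.one_apply]
      by_cases h : Escapes K ε X x
      · simp [h]
      · simp [h]
    simp only [h1]
    rw [lintegral_indicator_one hms]
    exact covariateLaw_escapes_le hs hn K hx hε hK

lemma ae_unif_mem : ∀ᵐ x ∂unif, x ∈ Icc (0 : ℝ) 1 := ae_restrict_mem measurableSet_Icc

-- Siblings in the quiet ball contribute 2·16n²d, test points within 2d of x₀ contribute 2·4d, and
-- escaping windows 2·8/(s n d).
open scoped Classical in
lemma integral_spillBound_le (hs : 1 ≤ s) (hn : 2 ≤ n) {k : ℕ} (hk : 0 < k) {x₀ d : ℝ} (hd : 0 < d)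
    (hK : 4 * k ≤ s * n * d) :
    Integrable (fun p : ℝ × TreeBase n s Ξ => spillBound k d x₀ p.2.2.1 p.1)
      (testLaw s n r hσ ν unif) ∧
      ∫ p, spillBound k d x₀ p.2.2.1 p.1 ∂(testLaw s n r hσ ν unif) ≤
        (32 * n ^ 2 + 8) * d + 16 / (s * n * d) := by
  obtain ⟨i1, b1⟩ := integral_pairBound_le (s := s) (n := n) (r := r) hσ ν unif ae_unif_mem hs hn hk
    (x₀ := x₀) hd.le
  obtain ⟨i2, b2⟩ := integral_escapes_le (s := s) (n := n) (r := r) hσ ν unif ae_unif_mem hs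
    (by omega) (K := 2 * k) hd (by push_cast; linarith)
  have hms : MeasurableSet {x : ℝ | |x - x₀| < 2 * d} := measurableSet_lt (by fun_prop) (by fun_prop)
  have i3' : Integrable (fun x : ℝ => if |x - x₀| < 2 * d then (1 : ℝ) else 0) unif :=
    Integrable.of_bound (C := 1)
      (Measurable.ite hms measurable_const measurable_const).aestronglyMeasurable
      (ae_of_all _ fun x => by split_ifs <;> simp)
  have hmp : MeasurePreserving (Prod.fst : ℝ × TreeBase n s Ξ → ℝ) (testLaw s n r hσ ν unif) unif :=
    measurePreserving_fst
  have i3 : Integrable (fun p : ℝ × TreeBase n s Ξ => if |p.1 - x₀| < 2 * d then (1 : ℝ) else 0)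
      (testLaw s n r hσ ν unif) := hmp.integrable_comp_of_integrable i3'
  have b3 : ∫ p : ℝ × TreeBase n s Ξ, (if |p.1 - x₀| < 2 * d then (1 : ℝ) else 0)
      ∂(testLaw s n r hσ ν unif) ≤ 4 * d := by
    have h1 := integral_map (μ := testLaw s n r hσ ν unif) hmp.measurable.aemeasurable
      (f := fun x : ℝ => if |x - x₀| < 2 * d then (1 : ℝ) else 0)
      (Measurable.ite hms measurable_const measurable_const).aestronglyMeasurable
    rw [hmp.map_eq] at h1
    rw [← h1]
    have h2 : (fun x : ℝ => if |x - x₀| < 2 * d then (1 : ℝ) else 0) =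
        (Metric.ball x₀ (2 * d)).indicator fun _ => 1 := by
      ext x
      simp [indicator_apply, Real.dist_eq]
    rw [h2, integral_indicator measurableSet_ball, setIntegral_const, smul_eq_mul, mul_one]
    refine (unif_real_ball_le (by positivity)).trans (by linarith)
  have i32 : Integrable (fun p : ℝ × TreeBase n s Ξ => (if |p.1 - x₀| < 2 * d then (1 : ℝ) else 0) +
      if Escapes (2 * k) d p.2.2.1 p.1 then 1 else 0) (testLaw s n r hσ ν unif) := i3.add i2
  refine ⟨(i1.const_mul 2).add (i32.const_mul 2), ?_⟩
  unfold spillBound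
  rw [integral_add (i1.const_mul 2) (i32.const_mul 2), integral_const_mul,
    integral_const_mul, integral_add i3 i2]
  have : 16 / (s * n * d) = 2 * (8 / (s * n * d)) := by ring
  rw [this]
  linarith

end Expectations

/-! ### The real-valued risk, its continuity and its minimisers -/

section Risk
variable {s n : ℕ} {Ξ : Type*} [MeasurableSpace Ξ]

/-- The real-valued integrated variance. -/
def SplittingRule.risk (R : SplittingRule n s Ξ) (k : ℕ) (r : ℝ) {σ : ℝ → ℝ} (hσ : Measurable σ)
    (ν : Measure Ξ) (Q : Measure ℝ) (ρ : ℝ) : ℝ :=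
  ∫ p, k * R.condVariance r σ ρ p ∂(testLaw s n r hσ ν Q)

variable {R : SplittingRule n s Ξ} {k : ℕ} {r η d x₀ ρ : ℝ} {ν : Measure Ξ}
  {Q : Measure ℝ}

lemma SplittingRule.risk_nonneg (R : SplittingRule n s Ξ) (k : ℕ) (hr0 : 0 ≤ r) (hr1 : r ≤ 1)
    {σ : ℝ → ℝ} (hσ : Measurable σ) (ν : Measure Ξ) (Q : Measure ℝ) (ρ : ℝ) :
    0 ≤ R.risk k r hσ ν Q ρ :=
  integral_nonneg fun _ => SplittingRule.Good.condVariance_nonneg hr0 hr1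

variable [IsProbabilityMeasure ν]

lemma SplittingRule.IsRegular.ae_good {α : ℝ} (h : R.IsRegular ν α k) {σ : ℝ → ℝ}
    (hσ : Measurable σ) : ∀ᵐ p ∂(testLaw s n r hσ ν Q), R.Good k p :=
  Measure.quasiMeasurePreserving_snd.ae (h.ae_labelRegular r hσ)

variable [IsProbabilityMeasure Q]

lemma integrable_condVariance
    (hgood : ∀ᵐ p ∂(testLaw s n r (measurable_scaleFn (η := η) (d := d) (x₀ := x₀)) ν Q),
      R.Good k p)
    (hk : 0 < k) (hn : 2 ≤ n) (hη0 : 0 ≤ η) (hη1 : η ≤ 1) (hr0 : 0 ≤ r)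
    (hr1 : r ≤ 1) (hρ : ρ ∈ Ico (0 : ℝ) 1) :
    Integrable (fun p => k * R.condVariance r (scaleFn η d x₀) ρ p)
      (testLaw s n r (measurable_scaleFn (η := η) (d := d) (x₀ := x₀)) ν Q) := by
  have hm := R.measurable_condVariance r (measurable_scaleFn (η := η) (d := d) (x₀ := x₀)) ρ
  refine Integrable.of_bound (C := n ^ 2 / (1 - ρ)) (by fun_prop) ?_
  filter_upwards [hgood] with p hp
  rw [Real.norm_of_nonneg (SplittingRule.Good.condVariance_nonneg hr0 hr1)]
  exact hp.condVariance_le hk hn hη0 hη1 hr0 hr1 hρ.1 hρ.2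

lemma integratedVariance_eq_risk
    (hgood : ∀ᵐ p ∂(testLaw s n r (measurable_scaleFn (η := η) (d := d) (x₀ := x₀)) ν Q),
      R.Good k p)
    (hk : 0 < k) (hn : 2 ≤ n) (hη0 : 0 ≤ η) (hη1 : η ≤ 1)
    (hr0 : 0 ≤ r) (hr1 : r ≤ 1) (hρ : ρ ∈ Ico (0 : ℝ) 1) :
    R.integratedVariance ν k (scaleLaw n r _ (measurable_scaleFn (η := η) (d := d) (x₀ := x₀))) Q ρ =
      ENNReal.ofReal (R.risk k r (measurable_scaleFn (η := η) (d := d) (x₀ := x₀)) ν Q ρ) := by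
  rw [R.integratedVariance_eq hr0 hr1, SplittingRule.risk, ofReal_integral_eq_lintegral_ofReal
    (integrable_condVariance hgood hk hn hη0 hη1 hr0 hr1 hρ)
    (ae_of_all _ fun p => SplittingRule.Good.condVariance_nonneg hr0 hr1)]
  rfl

lemma continuousOn_risk
    (hgood : ∀ᵐ p ∂(testLaw s n r (measurable_scaleFn (η := η) (d := d) (x₀ := x₀)) ν Q),
      R.Good k p)
    (hk : 0 < k) (hn : 2 ≤ n) (hη0 : 0 ≤ η) (hη1 : η ≤ 1) (hr0 : 0 ≤ r)
    (hr1 : r ≤ 1) {c : ℝ} (hc : c < 1) :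
    ContinuousOn (R.risk k r (measurable_scaleFn (η := η) (d := d) (x₀ := x₀)) ν Q) (Icc 0 c) := by
  refine continuousOn_of_dominated (bound := fun _ => n ^ 2 / (1 - c)) ?_ ?_
    (integrable_const _) ?_
  · intro ρ hρ
    have hm := R.measurable_condVariance r (measurable_scaleFn (η := η) (d := d) (x₀ := x₀)) ρ
    fun_prop
  · intro ρ hρ
    filter_upwards [hgood] with p hp
    rw [Real.norm_of_nonneg (SplittingRule.Good.condVariance_nonneg hr0 hr1)]
    refine (hp.condVariance_le hk hn hη0 hη1 hr0 hr1 hρ.1 (hρ.2.trans_lt hc)).trans ?_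
    have : 0 < 1 - c := by linarith
    have := hρ.2
    gcongr
  · filter_upwards [hgood] with p hp
    exact (hp.continuousOn_condVariance hk (by omega) _).mono fun ρ hρ => ⟨hρ.1, hρ.2.trans_lt hc⟩

/-- [0,1) is not compact: the minimum over [0,c] is global as soon as some point of [0,c] does at
least as well as everything beyond `c`. -/
lemma exists_forall_risk_le
    (hgood : ∀ᵐ p ∂(testLaw s n r (measurable_scaleFn (η := η) (d := d) (x₀ := x₀)) ν Q),
      R.Good k p)
    (hk : 0 < k) (hn : 2 ≤ n) (hη0 : 0 ≤ η) (hη1 : η ≤ 1) (hr0 : 0 ≤ r)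
    (hr1 : r ≤ 1) {c : ℝ} (hc : c < 1) (hρ0 : 0 ≤ ρ) (hρc : ρ ≤ c)
    (h : ∀ ρ' ∈ Ico c 1, R.risk k r (measurable_scaleFn (η := η) (d := d) (x₀ := x₀)) ν Q ρ ≤
      R.risk k r (measurable_scaleFn (η := η) (d := d) (x₀ := x₀)) ν Q ρ') :
    ∃ ρ', IsOptimalWeight (R.integratedVariance ν k
      (scaleLaw n r _ (measurable_scaleFn (η := η) (d := d) (x₀ := x₀))) Q) ρ' := by
  obtain ⟨m, hm, hmin⟩ := isCompact_Icc.exists_isMinOn ⟨ρ, hρ0, hρc⟩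
    (continuousOn_risk hgood hk hn hη0 hη1 hr0 hr1 hc)
  have hm' : m ∈ Ico (0 : ℝ) 1 := ⟨hm.1, hm.2.trans_lt hc⟩
  refine ⟨m, hm', fun ρ' hρ' => ?_⟩
  rw [mem_ofPred_eq, integratedVariance_eq_risk hgood hk hn hη0 hη1 hr0 hr1 hm',
    integratedVariance_eq_risk hgood hk hn hη0 hη1 hr0 hr1 hρ']
  refine ENNReal.ofReal_le_ofReal ?_
  rcases le_total ρ' c with h1 | h1
  · exact hmin ⟨hρ'.1, h1⟩
  · exact (hmin ⟨hρ0, hρc⟩ : _ ≤ _).trans (h ρ' ⟨h1, hρ'.2⟩)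

lemma IsOptimalWeight.risk_le
    (hgood : ∀ᵐ p ∂(testLaw s n r (measurable_scaleFn (η := η) (d := d) (x₀ := x₀)) ν Q),
      R.Good k p)
    (hk : 0 < k) (hn : 2 ≤ n) (hη0 : 0 ≤ η) (hη1 : η ≤ 1) (hr0 : 0 ≤ r)
    (hr1 : r ≤ 1) (h : IsOptimalWeight (R.integratedVariance ν k
      (scaleLaw n r _ (measurable_scaleFn (η := η) (d := d) (x₀ := x₀))) Q) ρ) {ρ' : ℝ}
    (hρ' : ρ' ∈ Ico (0 : ℝ) 1) :
    R.risk k r (measurable_scaleFn (η := η) (d := d) (x₀ := x₀)) ν Q ρ ≤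
      R.risk k r (measurable_scaleFn (η := η) (d := d) (x₀ := x₀)) ν Q ρ' := by
  have h1 := h.2 hρ'
  rw [mem_ofPred_eq, integratedVariance_eq_risk hgood hk hn hη0 hη1 hr0 hr1 h.1,
    integratedVariance_eq_risk hgood hk hn hη0 hη1 hr0 hr1 hρ'] at h1
  exact (ENNReal.ofReal_le_ofReal_iff (R.risk_nonneg k hr0 hr1 _ ν Q ρ')).1 h1

end Risk

/-! ### Risk bounds for the uniform law and for the point mass -/

section Bounds
variable {s n : ℕ} {Ξ : Type*} [MeasurableSpace Ξ] {R : SplittingRule n s Ξ} {k : ℕ}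
  {r η d x₀ ρ : ℝ} {ν : Measure Ξ} [IsProbabilityMeasure ν]

/-- A bound for the expected sibling defect. -/
def meanDefect (n k s : ℕ) : ℝ := 2 * n ^ 3 / k + 4096 * n * (k / s)

lemma le_risk_sub_risk
    (hgood : ∀ᵐ p ∂(testLaw s n r (measurable_scaleFn (η := η) (d := d) (x₀ := x₀)) ν unif),
      R.Good k p)
    (hs : 2 ≤ s) (hk : 0 < k) (hn : 2 ≤ n) (hd : 0 < d) (hη0 : 0 < η)
    (hη1 : η ≤ 1) (hr0 : 0 < r) (hr1 : r < 1) (hρ : ρ ∈ Ico (0 : ℝ) 1) {ζ g K : ℝ}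
    (hζ : 0 < ζ) (hg : 0 ≤ g) (hK : K = (1 + (n - 1) * r) / (1 - r))
    (hρ' : n * shrinkage n ρ ≤ 1 / 2 ∧
        (1 - r) / (1 - shrinkage n r) + g ≤ 1 - 2 * n * shrinkage n ρ ∨
      (1 - r) / (1 - shrinkage n r) + g ≤
        (1 - r) * (n / (n - 1)) - 4 * (1 - n * shrinkage n ρ))
    (hsd : 4 * k ≤ s * n * d) :
    g / 2 - ζ * (n + 9 + n * K) - ((n + 9) / ζ + (1 + 1 / ζ) * n * (2 * K + 8) + 4 / η ^ 2) *
        (meanDefect n k s + ((32 * n ^ 2 + 8) * d + 16 / (s * n * d))) ≤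
      R.risk k r (measurable_scaleFn (η := η) (d := d) (x₀ := x₀)) ν unif ρ -
        R.risk k r (measurable_scaleFn (η := η) (d := d) (x₀ := x₀)) ν unif r := by
  have hσ := measurable_scaleFn (η := η) (d := d) (x₀ := x₀)
  obtain ⟨i1, b1⟩ := integral_defectBound_le (r := r) hσ ν unif ae_unif_mem hs hn hk
  obtain ⟨i2, b2⟩ := integral_spillBound_le (r := r) (x₀ := x₀) hσ ν (by omega : 1 ≤ s) hn hk hd hsd
  have j1 := integrable_condVariance hgood hk hn hη0.le hη1 hr0.le hr1.le hρ
  have j2 := integrable_condVariance hgood hk hn hη0.le hη1 hr0.le hr1.le (ρ := r) ⟨hr0.le, hr1⟩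
  have hKpos : 0 < K := by
    rw [hK]
    exact div_pos (equiWeight_denom_pos (by omega) hr0.le) (by linarith)
  set C := (n + 9) / ζ + (1 + 1 / ζ) * n * (2 * K + 8) + 4 / η ^ 2 with hC
  have hC0 : 0 ≤ C := by positivity
  have i12 : Integrable (fun p : ℝ × TreeBase n s Ξ => defectBound k p.2.2.1 p.1 +
      spillBound k d x₀ p.2.2.1 p.1) (testLaw s n r hσ ν unif) := i1.add i2
  have h1 : ∫ p : ℝ × TreeBase n s Ξ, (g / 2 - ζ * (n + 9 + n * K) -
      C * (defectBound k p.2.2.1 p.1 + spillBound k d x₀ p.2.2.1 p.1)) ∂(testLaw s n r hσ ν unif) ≤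
      ∫ p, (k * R.condVariance r (scaleFn η d x₀) ρ p - k * R.condVariance r (scaleFn η d x₀) r p)
        ∂(testLaw s n r hσ ν unif) := by
    refine integral_mono_ae ((integrable_const _).sub (i12.const_mul C)) (j1.sub j2) ?_
    filter_upwards [hgood] with p hp
    exact hp.condVariance_sub_ge hk hn hd hη0 hη1 hr0 hr1 hρ.1 hρ.2 hζ hg hK hρ'
  rw [integral_sub j1 j2, integral_sub (integrable_const _) (i12.const_mul C), integral_const,
    probReal_univ, one_smul, integral_const_mul, integral_add i1 i2] at h1
  refine le_trans ?_ h1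
  have := mul_le_mul_of_nonneg_left (add_le_add b1 b2) hC0
  rw [meanDefect]
  linarith

lemma le_risk_dirac
    (hgood : ∀ᵐ p ∂(testLaw s n r (measurable_scaleFn (η := η) (d := d) (x₀ := x₀)) ν
      (Measure.dirac x₀)), R.Good k p)
    (hs : 2 ≤ s) (hk : 0 < k) (hn : 2 ≤ n) (hd : 0 < d) (hη0 : 0 < η) (hη1 : η ≤ 1) (hr0 : 0 < r)
    (hr1 : r < 1) (hx₀ : x₀ ∈ Icc (0 : ℝ) 1) (hρ : ρ ∈ Ico (0 : ℝ) 1) {ζ θ : ℝ}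
    (hζ : 0 < ζ) (hθ0 : 0 ≤ θ) (hθ : θ ≤ shrinkage n ρ) :
    (1 - r) * θ ^ 2 / n ^ 2 / 2 - 4 * ζ - 4 / ζ * meanDefect n k s -
      1 / η ^ 2 * (16 * n ^ 2 * d) ≤
      R.risk k r (measurable_scaleFn (η := η) (d := d) (x₀ := x₀)) ν (Measure.dirac x₀) ρ := by
  have hσ := measurable_scaleFn (η := η) (d := d) (x₀ := x₀)
  have hQ : ∀ᵐ x ∂(Measure.dirac x₀), x ∈ Icc (0 : ℝ) 1 := by
    rw [ae_dirac_eq]; exact hx₀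
  obtain ⟨i1, b1⟩ := integral_defectBound_le (r := r) hσ ν _ hQ hs hn hk
  obtain ⟨i2, b2⟩ := integral_pairBound_le (r := r) (x₀ := x₀) hσ ν _ hQ (by omega : 1 ≤ s) hn hk
    hd.le
  have j1 := integrable_condVariance hgood hk hn hη0.le hη1 hr0.le hr1.le hρ
  have i1' := i1.const_mul (4 / ζ)
  have i2' := i2.const_mul (1 / η ^ 2)
  have i3 : Integrable (fun _ : ℝ × TreeBase n s Ξ => (1 - r) * θ ^ 2 / n ^ 2 / 2 - 4 * ζ)
    (testLaw s n r hσ ν (Measure.dirac x₀)) := integrable_const _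
  have i4 : Integrable (fun p : ℝ × TreeBase n s Ξ => (1 - r) * θ ^ 2 / n ^ 2 / 2 - 4 * ζ -
      4 / ζ * defectBound k p.2.2.1 p.1) (testLaw s n r hσ ν (Measure.dirac x₀)) := i3.sub i1'
  have h1 : ∫ p : ℝ × TreeBase n s Ξ, ((1 - r) * θ ^ 2 / n ^ 2 / 2 - 4 * ζ -
      4 / ζ * defectBound k p.2.2.1 p.1 - 1 / η ^ 2 * pairBound k (Metric.ball x₀ d) p.2.2.1 p.1)
        ∂(testLaw s n r hσ ν (Measure.dirac x₀)) ≤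
      R.risk k r hσ ν (Measure.dirac x₀) ρ := by
    refine integral_mono_ae (i4.sub i2') j1 ?_
    filter_upwards [hgood] with p hp
    exact hp.condVariance_ge_of_le hk hn hd hη0 hη1 hr0 hr1 hρ.1 hρ.2 hζ hθ0 hθ
  rw [integral_sub i4 i2', integral_sub i3 i1', integral_const,
    probReal_univ, one_smul, integral_const_mul, integral_const_mul] at h1
  refine le_trans ?_ h1
  have q1 := mul_le_mul_of_nonneg_left b1 (by positivity : 0 ≤ 4 / ζ)
  have q2 := mul_le_mul_of_nonneg_left b2 (by positivity : 0 ≤ 1 / η ^ 2)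
  rw [meanDefect]
  linarith

lemma risk_dirac_zero_le
    (hgood : ∀ᵐ p ∂(testLaw s n r (measurable_scaleFn (η := η) (d := d) (x₀ := x₀)) ν
      (Measure.dirac x₀)), R.Good k p)
    (hs : 2 ≤ s) (hk : 0 < k) (hn : 2 ≤ n) (hd : 0 < d) (hη0 : 0 < η) (hη1 : η ≤ 1) (hr0 : 0 < r)
    (hr1 : r < 1) (hx₀ : x₀ ∈ Icc (0 : ℝ) 1) {ζ : ℝ} (hζ : 0 < ζ)
    (hsd : 4 * k ≤ s * n * (η * d)) :
    R.risk k r (measurable_scaleFn (η := η) (d := d) (x₀ := x₀)) ν (Measure.dirac x₀) 0 ≤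
      η ^ 2 + ζ + 1 / ζ * meanDefect n k s + 8 / (s * n * (η * d)) := by
  classical
  have hσ := measurable_scaleFn (η := η) (d := d) (x₀ := x₀)
  have hQ : ∀ᵐ x ∂(Measure.dirac x₀), x ∈ Icc (0 : ℝ) 1 := by
    rw [ae_dirac_eq]; exact hx₀
  obtain ⟨i1, b1⟩ := integral_defectBound_le (r := r) hσ ν _ hQ hs hn hk
  obtain ⟨i2, b2⟩ := integral_escapes_le (s := s) (n := n) (r := r) hσ ν _ hQ (by omega)
    (by omega) (K := 2 * k) (mul_pos hη0 hd) (by push_cast; linarith)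
  have j1 := integrable_condVariance hgood hk hn hη0.le hη1 hr0.le hr1.le (ρ := 0)
    ⟨le_rfl, zero_lt_one⟩
  have hx : ∀ᵐ p ∂(testLaw s n r hσ ν (Measure.dirac x₀)), p.1 = x₀ := by
    have h : ∀ᵐ x ∂(Measure.dirac x₀), x = x₀ := by rw [ae_dirac_eq]; rfl
    exact Measure.quasiMeasurePreserving_fst.ae h
  have i1' := i1.const_mul (1 / ζ)
  have i3 : Integrable (fun _ : ℝ × TreeBase n s Ξ => η ^ 2 + ζ)
    (testLaw s n r hσ ν (Measure.dirac x₀)) := integrable_const _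
  have i4 : Integrable (fun p : ℝ × TreeBase n s Ξ => η ^ 2 + ζ +
      1 / ζ * defectBound k p.2.2.1 p.1) (testLaw s n r hσ ν (Measure.dirac x₀)) := i3.add i1'
  have h1 : R.risk k r hσ ν (Measure.dirac x₀) 0 ≤
      ∫ p : ℝ × TreeBase n s Ξ, (η ^ 2 + ζ + 1 / ζ * defectBound k p.2.2.1 p.1 +
        if Escapes (2 * k) (η * d) p.2.2.1 p.1 then 1 else 0)
        ∂(testLaw s n r hσ ν (Measure.dirac x₀)) := by
    refine integral_mono_ae j1 (i4.add i2) ?_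
    filter_upwards [hgood, hx] with p hp hpx
    exact hp.condVariance_zero_le hk hn hd hη0 hη1 hr0 hr1 hζ hpx
  rw [integral_add i4 i2, integral_add i3 i1', integral_const,
    probReal_univ, one_smul, integral_const_mul] at h1
  refine h1.trans ?_
  have q1 := mul_le_mul_of_nonneg_left b1 (by positivity : 0 ≤ 1 / ζ)
  rw [meanDefect]
  linarith

lemma risk_pos {Q : Measure ℝ} [IsProbabilityMeasure Q]
    (hgood : ∀ᵐ p ∂(testLaw s n r (measurable_scaleFn (η := η) (d := d) (x₀ := x₀)) ν Q),
      R.Good k p)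
    (hk : 0 < k) (hn : 2 ≤ n) (hη0 : 0 < η) (hη1 : η ≤ 1) (hr0 : 0 < r)
    (hr1 : r < 1) (hρ : ρ ∈ Ico (0 : ℝ) 1) :
    0 < R.risk k r (measurable_scaleFn (η := η) (d := d) (x₀ := x₀)) ν Q ρ := by
  have hσ := measurable_scaleFn (η := η) (d := d) (x₀ := x₀)
  have j1 := integrable_condVariance hgood hk hn hη0.le hη1 hr0.le hr1.le hρ
  have h1 : ∫ _ : ℝ × TreeBase n s Ξ, (1 - r) * η ^ 2 / 2 ∂(testLaw s n r hσ ν Q) ≤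
      R.risk k r hσ ν Q ρ := by
    refine integral_mono_ae (integrable_const _) j1 ?_
    filter_upwards [hgood] with p hp
    exact hp.condVariance_pos hk hn hη0 hη1 hr0 hr1 hρ.1 hρ.2
  rw [integral_const, probReal_univ, one_smul] at h1
  have : 0 < (1 - r) * η ^ 2 := mul_pos (by linarith) (by positivity)
  linarith

/-- Transfers closeness of ρ to 1 into closeness of nθ to 1. -/
lemma le_mul_shrinkage (hn : 1 ≤ n) (hρ : ρ ∈ Ico (0 : ℝ) 1) : ρ ≤ n * shrinkage n ρ := by
  have h1 := one_sub_mul_shrinkage hn hρ.1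
  have h2 : (1 - ρ) / (1 + ((n : ℝ) - 1) * ρ) ≤ 1 - ρ := by
    have : (1 : ℝ) ≤ n := by exact_mod_cast hn
    refine div_le_self (by linarith [hρ.2]) ?_
    nlinarith [hρ.1]
  linarith

/-- A weight that is optimal for the uniform distribution is bounded away from zero, and hence
performs badly at `x₀`. -/
lemma exists_optimal_and_ratio_ge
    (hgood₁ : ∀ᵐ p ∂(testLaw s n r (measurable_scaleFn (η := η) (d := d) (x₀ := x₀)) ν
      (Measure.dirac x₀)), R.Good k p)
    (hgood₂ : ∀ᵐ p ∂(testLaw s n r (measurable_scaleFn (η := η) (d := d) (x₀ := x₀)) ν unif),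
      R.Good k p)
    (hk : 0 < k) (hn : 2 ≤ n) (hη0 : 0 < η) (hη1 : η ≤ 1) (hr0 : 0 < r)
    (hr1 : r < 1) {κ θ b g₂ : ℝ} (hκ : 1 ≤ κ) (hθ : n * θ ≤ 1 / 2) (hg₂ : 0 < g₂)
    (h2 : ∀ ρ ∈ Ico (0 : ℝ) 1, shrinkage n ρ < θ ∨ 1 - n * shrinkage n ρ ≤ g₂ →
      R.risk k r (measurable_scaleFn (η := η) (d := d) (x₀ := x₀)) ν unif r <
        R.risk k r (measurable_scaleFn (η := η) (d := d) (x₀ := x₀)) ν unif ρ)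
    (h1 : ∀ ρ ∈ Ico (0 : ℝ) 1, θ ≤ shrinkage n ρ →
      κ * b ≤ R.risk k r (measurable_scaleFn (η := η) (d := d) (x₀ := x₀)) ν (Measure.dirac x₀) ρ)
    (h0 : R.risk k r (measurable_scaleFn (η := η) (d := d) (x₀ := x₀)) ν (Measure.dirac x₀) 0 ≤ b) :
    (∃ ρ₁, IsOptimalWeight (R.integratedVariance ν k
      (scaleLaw n r _ (measurable_scaleFn (η := η) (d := d) (x₀ := x₀))) (Measure.dirac x₀)) ρ₁) ∧
    (∃ ρ₂, IsOptimalWeight (R.integratedVariance ν k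
      (scaleLaw n r _ (measurable_scaleFn (η := η) (d := d) (x₀ := x₀))) unif) ρ₂) ∧
    ∀ ρ₁ ρ₂, IsOptimalWeight (R.integratedVariance ν k
        (scaleLaw n r _ (measurable_scaleFn (η := η) (d := d) (x₀ := x₀))) (Measure.dirac x₀)) ρ₁ →
      IsOptimalWeight (R.integratedVariance ν k
        (scaleLaw n r _ (measurable_scaleFn (η := η) (d := d) (x₀ := x₀))) unif) ρ₂ →
      κ ≤ (R.integratedVariance ν k (scaleLaw n r _
          (measurable_scaleFn (η := η) (d := d) (x₀ := x₀))) (Measure.dirac x₀) ρ₂).toReal /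
        (R.integratedVariance ν k (scaleLaw n r _
          (measurable_scaleFn (η := η) (d := d) (x₀ := x₀))) (Measure.dirac x₀) ρ₁).toReal := by
  have hn1 : 1 ≤ n := by omega
  have hn0 : (0 : ℝ) < n := by exact_mod_cast (by omega : 0 < n)
  have hzero : (0 : ℝ) ∈ Ico (0 : ℝ) 1 := ⟨le_rfl, zero_lt_one⟩
  have hb : 0 < b := (risk_pos hgood₁ hk hn hη0 hη1 hr0 hr1 hzero).trans_le h0
  refine ⟨?_, ?_, fun ρ₁ ρ₂ hρ₁ hρ₂ => ?_⟩
  -- For ρ ≥ 1/2 the shrinkage is at least θ, because nθ ≤ 1/2, so by `h1` and `h0` these weights do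
  -- no better than 0.
  · refine exists_forall_risk_le hgood₁ hk hn hη0.le hη1 hr0.le hr1.le (c := 1 / 2) (ρ := 0)
      (by norm_num) le_rfl (by norm_num) fun ρ hρ => ?_
    have hρ' : ρ ∈ Ico (0 : ℝ) 1 := ⟨by linarith [hρ.1], hρ.2⟩
    have h3 := le_mul_shrinkage hn1 hρ'
    refine h0.trans (le_trans ?_ (h1 ρ hρ' ?_))
    · nlinarith
    · have := hρ.1
      exact le_of_mul_le_mul_left (by linarith) hn0
  -- Beyond this `c`, 1 - n·shrinkage is at most g₂, so `h2` says that `r` is better.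
  · refine exists_forall_risk_le hgood₂ hk hn hη0.le hη1 hr0.le hr1.le (c := max r (1 - g₂)) (ρ := r)
      (max_lt hr1 (by linarith)) hr0.le (le_max_left _ _) fun ρ hρ => ?_
    have hρ' : ρ ∈ Ico (0 : ℝ) 1 := ⟨hr0.le.trans ((le_max_left _ _).trans hρ.1), hρ.2⟩
    have h3 := le_mul_shrinkage hn1 hρ'
    have h4 := (le_max_right r (1 - g₂)).trans hρ.1
    exact (h2 ρ hρ' (Or.inr (by linarith))).le
  -- Otherwise `r` would have strictly smaller risk under the uniform law than the minimiser ρ₂.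
  · have h3 : θ ≤ shrinkage n ρ₂ := by
      by_contra! h4
      have h5 := h2 ρ₂ hρ₂.1 (Or.inl h4)
      exact absurd (hρ₂.risk_le hgood₂ hk hn hη0.le hη1 hr0.le hr1.le ⟨hr0.le, hr1⟩) h5.not_ge
    rw [integratedVariance_eq_risk hgood₁ hk hn hη0.le hη1 hr0.le hr1.le hρ₁.1,
      integratedVariance_eq_risk hgood₁ hk hn hη0.le hη1 hr0.le hr1.le hρ₂.1,
      ENNReal.toReal_ofReal (R.risk_nonneg k hr0.le hr1.le _ ν _ _),
      ENNReal.toReal_ofReal (R.risk_nonneg k hr0.le hr1.le _ ν _ _),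
      le_div_iff₀ (risk_pos hgood₁ hk hn hη0 hη1 hr0 hr1 hρ₁.1)]
    have h6 := hρ₁.risk_le hgood₁ hk hn hη0.le hη1 hr0.le hr1.le hzero
    calc κ * _ ≤ κ * b := mul_le_mul_of_nonneg_left (h6.trans h0) (by linarith)
      _ ≤ _ := h1 ρ₂ hρ₂.1 h3

end Bounds

/-! ### Asymptotics of the error terms -/

section Limits

lemma leafExponent_pos {α π ε : ℝ} (hα : 0 < α ∧ α ≤ 1 / 2) (hπ : 0 < π) (hε : ε < 1) :
    0 < leafExponent α π ε := by
  unfold leafExponent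
  have h1 : 0 < Real.log (1 - α)⁻¹ :=
    Real.log_pos ((one_lt_inv₀ (by linarith)).2 (by linarith [hα.1]))
  have h2 : 0 < Real.log α⁻¹ := Real.log_pos ((one_lt_inv₀ hα.1).2 (by linarith [hα.2]))
  have h3 : 0 < 1 - ε := by linarith
  positivity

/-- The exponent 2φ/(2φ+1) is below 1, so the leaf size is of smaller order than the number of
clusters. -/
lemma tendsto_leafSize_div {φ : ℝ} (hφ : 0 < φ) {s k : ℕ → ℕ} (hs : Tendsto s atTop atTop)
    (hks : (fun I => (k I : ℝ)) =o[atTop] fun I => (s I : ℝ) ^ (2 * φ / (2 * φ + 1))) :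
    Tendsto (fun I => (k I : ℝ) / s I) atTop (𝓝 0) := by
  have hO : (fun I => (s I : ℝ) ^ (2 * φ / (2 * φ + 1))) =O[atTop] fun I => (s I : ℝ) := by
    refine Asymptotics.IsBigO.of_bound 1 ?_
    filter_upwards [hs.eventually_ge_atTop 1] with I hI
    have h1 : (1 : ℝ) ≤ s I := by exact_mod_cast hI
    rw [one_mul, Real.norm_of_nonneg (by positivity), Real.norm_of_nonneg (by positivity)]
    calc (s I : ℝ) ^ (2 * φ / (2 * φ + 1)) ≤ (s I : ℝ) ^ (1 : ℝ) :=
          Real.rpow_le_rpow_of_exponent_le h1 (by rw [div_le_one (by positivity)]; linarith)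
      _ = s I := Real.rpow_one _
  exact (hks.trans_isBigO hO).tendsto_div_nhds_zero

lemma tendsto_meanDefect (n : ℕ) {s k : ℕ → ℕ} (hk : Tendsto k atTop atTop)
    (hks : Tendsto (fun I => (k I : ℝ) / s I) atTop (𝓝 0)) :
    Tendsto (fun I => meanDefect n (k I) (s I)) atTop (𝓝 0) := by
  have h1 : Tendsto (fun I => (2 * n ^ 3 : ℝ) / k I) atTop (𝓝 0) :=
    (tendsto_natCast_atTop_atTop.comp hk).const_div_atTop _
  simpa [meanDefect] using h1.add (hks.const_mul (4096 * n : ℝ))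

lemma eventually_four_mul_le {n : ℕ} (hn : 1 ≤ n) {s k : ℕ → ℕ} (hs : Tendsto s atTop atTop)
    (hks : Tendsto (fun I => (k I : ℝ) / s I) atTop (𝓝 0)) {c : ℝ} (hc : 0 < c) :
    ∀ᶠ I in atTop, 4 * (k I : ℝ) ≤ s I * n * c := by
  filter_upwards [hs.eventually_ge_atTop 1, hks.eventually_le_const (by positivity : 0 < c / 4)]
    with I h1 h2
  have h3 : (0 : ℝ) < s I := by exact_mod_cast h1
  have h4 : (1 : ℝ) ≤ n := by exact_mod_cast hn
  rw [div_le_iff₀ h3] at h2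
  nlinarith [mul_pos h3 hc]

lemma tendsto_const_div_mul {n : ℕ} (hn : 1 ≤ n) {s : ℕ → ℕ} (hs : Tendsto s atTop atTop) (a : ℝ)
    {c : ℝ} (hc : 0 < c) : Tendsto (fun I => a / ((s I : ℝ) * n * c)) atTop (𝓝 0) := by
  have hn0 : (0 : ℝ) < n := by exact_mod_cast (by omega : 0 < n)
  have h1 : Tendsto (fun I => (s I : ℝ)) atTop atTop := tendsto_natCast_atTop_atTop.comp hs
  exact ((h1.atTop_mul_const hn0).atTop_mul_const hc).const_div_atTop a

end Limits

/-! ### Choice of the constants and conclusion -/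

section ShiftGap

lemma shrinkage_lt_self {n : ℕ} (hn : 2 ≤ n) {r : ℝ} (hr0 : 0 < r) : shrinkage n r < r := by
  have hn' : (2 : ℝ) ≤ n := by exact_mod_cast hn
  refine div_lt_self hr0 ?_
  nlinarith

/-- The homoscedastic optimum against the value 1 of plain leaf averaging: siblings help because the
shrinkage is smaller than `r`. -/
lemma optimalVariance_lt_one {n : ℕ} (hn : 2 ≤ n) {r : ℝ} (hr0 : 0 < r) (hr1 : r < 1) :
    (1 - r) / (1 - shrinkage n r) < 1 := by
  have := shrinkage_lt_self hn hr0
  rw [div_lt_one (by linarith)]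
  linarith

/-- The homoscedastic optimum against the limit ρ → 1; equivalent to n·shrinkage < 1. -/
lemma optimalVariance_lt_within {n : ℕ} (hn : 2 ≤ n) {r : ℝ} (hr0 : 0 < r) (hr1 : r < 1) :
    (1 - r) / (1 - shrinkage n r) < (1 - r) * (n / (n - 1)) := by
  have hn' : (2 : ℝ) ≤ n := by exact_mod_cast hn
  have h1 := mul_shrinkage_lt_one (by omega : 1 ≤ n) hr0.le hr1
  have h2 := shrinkage_lt_self hn hr0
  rw [div_eq_mul_inv]
  refine mul_lt_mul_of_pos_left ?_ (by linarith)
  rw [inv_lt_iff_one_lt_mul₀ (by linarith), div_mul_eq_mul_div, one_lt_div (by linarith)]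
  linarith

lemma optimalVariance_nonneg {n : ℕ} (hn : 2 ≤ n) {r : ℝ} (hr0 : 0 < r) (hr1 : r < 1) :
    0 ≤ (1 - r) / (1 - shrinkage n r) :=
  div_nonneg (by linarith) (by linarith [shrinkage_lt_self hn hr0])

/-- The constants are chosen in the order g, θ, b, η, ζ, d, and only then is `I` taken large. In
particular η is fixed by the lower bound `b` at x₀ before `d` makes the quiet region negligible for
the uniform law. -/
theorem exists_shiftGap {Ξ : Type*} [MeasurableSpace Ξ] (ν : Measure Ξ) [IsProbabilityMeasure ν]
    {n : ℕ} (hn : 2 ≤ n) {α : ℝ} {s k : ℕ → ℕ} (hs : Tendsto s atTop atTop)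
    (hk : Tendsto k atTop atTop) (hks : Tendsto (fun I => (k I : ℝ) / s I) atTop (𝓝 0))
    (R : ∀ I, SplittingRule n (s I) Ξ) (hreg : ∀ᶠ I in atTop, (R I).IsRegular ν α (k I))
    {r : ℝ} (hr0 : 0 < r) (hr1 : r < 1) {κ : ℝ} (hκ : 1 ≤ κ) {x₀ : ℝ} (hx₀ : x₀ ∈ Ioo (0 : ℝ) 1) :
    ∃ P : Measure (Cluster n), (∀ j, unif = marginalX P j) ∧
      ShiftGap ν k R r κ P (Measure.dirac x₀) unif := by
  have hn1 : 1 ≤ n := by omega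
  have hn0 : (0 : ℝ) < n := by exact_mod_cast (by omega : 0 < n)
  have hn2 : (2 : ℝ) ≤ n := by exact_mod_cast hn
  set G := (1 - r) / (1 - shrinkage n r) with hG
  have hG0 : 0 ≤ G := optimalVariance_nonneg hn hr0 hr1
  have hG1 : G < 1 := optimalVariance_lt_one hn hr0 hr1
  have hG2 : G < (1 - r) * (n / (n - 1)) := optimalVariance_lt_within hn hr0 hr1
  -- γ₁ and γ₂ are the margins of the optimum over the two ends of [0,1).
  obtain ⟨γ₁, hγ₁⟩ : ∃ γ, γ = 1 - G := ⟨_, rfl⟩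
  obtain ⟨γ₂, hγ₂⟩ : ∃ γ, γ = (1 - r) * (n / (n - 1)) - G := ⟨_, rfl⟩
  obtain ⟨g, hg⟩ : ∃ g, g = min γ₁ γ₂ / 2 := ⟨_, rfl⟩
  have hγ₁0 : 0 < γ₁ := by linarith
  have hγ₂0 : 0 < γ₂ := by linarith
  have hg0 : 0 < g := by rw [hg]; exact half_pos (lt_min hγ₁0 hγ₂0)
  have hg1 : g ≤ γ₁ / 2 := by rw [hg]; linarith [min_le_left γ₁ γ₂]
  have hg2 : g ≤ γ₂ / 2 := by rw [hg]; linarith [min_le_right γ₁ γ₂]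
  -- For shrinkage below θ, 1 - 2n·shrinkage exceeds 1 - γ₁/2, which is at least G + g.
  obtain ⟨θ, hθ⟩ : ∃ θ, θ = γ₁ / (4 * n) := ⟨_, rfl⟩
  have hθ0 : 0 < θ := by rw [hθ]; positivity
  have hnθ : n * θ = γ₁ / 4 := by rw [hθ]; field_simp
  -- The main term of the lower bound in `le_risk_dirac`.
  obtain ⟨b, hb⟩ : ∃ b, b = (1 - r) * θ ^ 2 / n ^ 2 / 2 := ⟨_, rfl⟩
  have h1r : 0 < 1 - r := by linarith
  have hb0 : 0 < b := by rw [hb]; positivity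
  have hb1 : b ≤ 1 := by
    have hθ1 : θ ≤ 1 := by nlinarith
    have : (1 - r) * θ ^ 2 / n ^ 2 ≤ 1 := by
      rw [div_le_one (by positivity)]
      have h1 : θ ^ 2 ≤ 1 := pow_le_one₀ hθ0.le hθ1
      have h2 : (1 : ℝ) ≤ n ^ 2 := one_le_pow₀ (by linarith)
      nlinarith
    rw [hb]
    linarith
  -- The risk of weight 0 at x₀ will be at most 4η²; this η makes κ·4η² equal to b/2.
  obtain ⟨η, hη⟩ : ∃ η, η = √(b / (8 * κ)) := ⟨_, rfl⟩
  have hη2 : η ^ 2 = b / (8 * κ) := by rw [hη]; exact Real.sq_sqrt (by positivity)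
  have hη0 : 0 < η := by rw [hη]; positivity
  have hη1 : η ≤ 1 := by
    rw [hη]
    refine Real.sqrt_le_one.2 ?_
    rw [div_le_one (by positivity)]
    linarith
  have hκη : κ * (4 * η ^ 2) = b / 2 := by rw [hη2]; field_simp; norm_num
  obtain ⟨K, hK⟩ : ∃ K, K = (1 + (n - 1) * r) / (1 - r) := ⟨_, rfl⟩
  have hK0 : 0 < K := by rw [hK]; exact div_pos (equiWeight_denom_pos hn1 hr0.le) h1r
  obtain ⟨ζ, hζ⟩ : ∃ ζ, ζ = g / (8 * (n + 9 + n * K)) := ⟨_, rfl⟩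
  have hζ0 : 0 < ζ := by rw [hζ]; positivity
  have hζg : ζ * (n + 9 + n * K) = g / 8 := by rw [hζ]; field_simp
  obtain ⟨C, hC⟩ : ∃ C, C = (n + 9) / ζ + (1 + 1 / ζ) * n * (2 * K + 8) + 4 / η ^ 2 := ⟨_, rfl⟩
  have hC0 : 0 < C := by rw [hC]; positivity
  -- The first entry serves the uniform law, the second the siblings of observations near x₀ that
  -- are themselves quiet.
  obtain ⟨d, hd⟩ : ∃ d, d = min (g / (16 * C * (32 * n ^ 2 + 8))) (b * η ^ 2 / (128 * n ^ 2)) :=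
    ⟨_, rfl⟩
  have hd0 : 0 < d := by rw [hd]; exact lt_min (by positivity) (by positivity)
  have hdC : C * ((32 * n ^ 2 + 8) * d) ≤ g / 16 := by
    have h1 : d ≤ g / (16 * C * (32 * n ^ 2 + 8)) := by rw [hd]; exact min_le_left _ _
    rw [le_div_iff₀ (by positivity)] at h1
    linarith
  have hdη : 1 / η ^ 2 * (16 * n ^ 2 * d) ≤ b / 8 := by
    have h1 : d ≤ b * η ^ 2 / (128 * n ^ 2) := by rw [hd]; exact min_le_right _ _
    rw [le_div_iff₀ (by positivity)] at h1
    rw [one_div_mul_eq_div, div_le_iff₀ (by positivity)]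
    linarith
  have hσ := measurable_scaleFn (η := η) (d := d) (x₀ := x₀)
  refine ⟨scaleLaw n r _ hσ, fun j => (marginalX_scaleLaw hσ j).symm, inferInstance,
    dataAssumptions_scaleLaw hσ k (Lσ := ⟨d⁻¹, (inv_pos.2 hd0).le⟩) hr0.le hr1 hη0
      (le_scaleFn hη1) scaleFn_le_one (abs_scaleFn_sub_le hd0),
    hasCondCorr_scaleLaw hσ hr0.le hr1.le fun u => hη0.trans_le (le_scaleFn hη1 u),
    inferInstance, ?_, inferInstance, by simp [unif], ?_⟩
  · exact Measure.dirac_apply_of_mem (Ioo_subset_Icc_self hx₀)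
  have hmean := tendsto_meanDefect n hk hks
  filter_upwards [hreg, hk.eventually_gt_atTop 0, hs.eventually_ge_atTop 2,
    eventually_four_mul_le hn1 hs hks hd0, eventually_four_mul_le hn1 hs hks (mul_pos hη0 hd0),
    (tendsto_const_div_mul hn1 hs 16 hd0).eventually_le_const (by positivity : 0 < g / (16 * C)),
    (tendsto_const_div_mul hn1 hs 8 (mul_pos hη0 hd0)).eventually_le_const
      (by positivity : 0 < η ^ 2),
    hmean.eventually_le_const (by positivity : 0 < g / (16 * C)),
    hmean.eventually_le_const (by positivity : 0 < b / 8 / (4 / (b / 32))),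
    hmean.eventually_le_const (by positivity : 0 < η ^ 2 * η ^ 2)]
    with I hR hkI hsI hI1 hI2 hI3 hI4 hI5 hI6 hI7
  refine exists_optimal_and_ratio_ge (θ := θ) (b := 4 * η ^ 2) (g₂ := γ₂ / 8) (hR.ae_good hσ)
    (hR.ae_good hσ) hkI hn hη0 hη1 hr0 hr1 hκ (by linarith) (by positivity) ?_ ?_ ?_
  · intro ρ hρ hcases
    have h1 := le_risk_sub_risk (R := R I) (hR.ae_good hσ) hsI hkI hn hd0 hη0 hη1 hr0 hr1 hρ hζ0
      hg0.le hK (by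
        rcases hcases with h | h
        · left
          have h2 := mul_lt_mul_of_pos_left h hn0
          constructor
          · linarith
          · rw [← hG]; linarith
        · right
          rw [← hG]; linarith) hI1
    rw [hζg, ← hC] at h1
    rw [le_div_iff₀ (by positivity)] at hI3 hI5
    -- Three errors of at most g/16 each; together with g/8 from ζ they stay below the gap g/2.
    have h2 : C * (meanDefect n (k I) (s I) + ((32 * n ^ 2 + 8) * d + 16 / (s I * n * d))) ≤
        3 * g / 16 := by
      linarith
    linarith
  · intro ρ hρ h
    have h1 := le_risk_dirac (R := R I) (hR.ae_good hσ) hsI hkI hn hd0 hη0 hη1 hr0 hr1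
      (Ioo_subset_Icc_self hx₀) hρ (ζ := b / 32) (by positivity) hθ0.le h
    rw [← hb] at h1
    rw [le_div_iff₀ (by positivity)] at hI6
    -- The main term `b` loses three times b/8, which leaves more than b/2.
    rw [hκη]
    linarith
  · have h1 := risk_dirac_zero_le (R := R I) (hR.ae_good hσ) hsI hkI hn hd0 hη0 hη1 hr0 hr1
      (Ioo_subset_Icc_self hx₀) (ζ := η ^ 2) (by positivity) hI2
    -- Four terms of at most η² each: quiet noise, ζ = η², the defect and escaping windows.
    have h2 : 1 / η ^ 2 * meanDefect n (k I) (s I) ≤ η ^ 2 := by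
      rw [one_div_mul_eq_div, div_le_iff₀ (by positivity)]
      exact hI7
    linarith

end ShiftGap

theorem theorem2 {Ξ : Type*} [MeasurableSpace Ξ] (ν : Measure Ξ) [IsProbabilityMeasure ν]
    (n : ℕ) (hn : 2 ≤ n)
    (α : ℝ) (hα : 0 < α ∧ α ≤ 1 / 2) (π : ℝ) (hπ : 0 < π ∧ π ≤ 1) (ε : ℝ) (hε : 0 < ε ∧ ε < 1)
    (s k : ℕ → ℕ) (hs : Tendsto s atTop atTop) (hk : Tendsto k atTop atTop)
    (hks : (fun I => (k I : ℝ)) =o[atTop] fun I =>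
      (s I : ℝ) ^ (2 * leafExponent α π ε / (2 * leafExponent α π ε + 1)))
    (R : ∀ I, SplittingRule n (s I) Ξ)
    (hsymm : ∀ I, (R I).IsSymmetric ν)
    (hreg : ∀ᶠ I in atTop, (R I).IsRegular ν α (k I))
    (ϱ : ℝ) (hϱ : 0 < ϱ ∧ ϱ < 1) (κ : ℝ) (hκ : 1 ≤ κ) :
    (∃ (P : Measure (Cluster n)) (Q₁ Q₂ : Measure ℝ), ShiftGap ν k R ϱ κ P Q₁ Q₂) ∧
    (∃ (P : Measure (Cluster n)) (Q₁ Q₂ : Measure ℝ),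
      (∀ j, Q₂ = marginalX P j) ∧ ShiftGap ν k R ϱ κ P Q₁ Q₂) ∧
    (∀ x ∈ Ioo (0 : ℝ) 1, ∃ (P : Measure (Cluster n)) (Q₂ : Measure ℝ),
      ShiftGap ν k R ϱ κ P (Measure.dirac x) Q₂) ∧
    (∀ x ∈ Ioo (0 : ℝ) 1, ∃ (P : Measure (Cluster n)) (Q₂ : Measure ℝ),
      (∀ j, Q₂ = marginalX P j) ∧ ShiftGap ν k R ϱ κ P (Measure.dirac x) Q₂) := by
  have hks' := tendsto_leafSize_div (leafExponent_pos hα hπ.1 hε.2) hs hks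
  have key : ∀ x ∈ Ioo (0 : ℝ) 1, ∃ P : Measure (Cluster n), (∀ j, unif = marginalX P j) ∧
      ShiftGap ν k R ϱ κ P (Measure.dirac x) unif := fun x hx =>
    exists_shiftGap ν hn hs hk hks' R hreg hϱ.1 hϱ.2 hκ hx
  -- Any interior point serves for the claims that leave Q₁ free.
  obtain ⟨P, hm, hP⟩ := key (1 / 2) ⟨by norm_num, by norm_num⟩
  refine ⟨⟨P, _, _, hP⟩, ⟨P, _, _, hm, hP⟩, fun x hx => ?_, fun x hx => ?_⟩
  · obtain ⟨P, -, hP⟩ := key x hx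
    exact ⟨P, _, hP⟩
  · obtain ⟨P, hm, hP⟩ := key x hx
    exact ⟨P, _, hm, hP⟩

end
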